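/- Let $K$ be a field. A positively graded $K$-algebra is a Noetherian commutative graded $K$-algebra $R=\bigoplus_{i\ge 0}R_i$ with $R_0=K$; put $\mathfrak m=\bigoplus_{i>0}R_i$ and regard $K=R/\mathfrak m$ as a graded $R$-module. For a finitely generated $\mathbb Z$-graded $R$-module $M\neq 0$ define, with infima taken in $\mathbb Z\cup\{\pm\infty\}$, $$\operatorname{reg}^T_R(M)=\inf\{r\in\mathbb Z:\operatorname{Tor}^R_i(M,K)_{i+s}=0\text{ for all } i\ge 0 \text{ and all } s>r\},$$ $$\operatorname{reg}^L_R(M)=\inf\{r\in\mathbb Z: H^i_{\mathfrak m}(M)_{s-i}=0\text{ for all } i\ge 0\text{ and all } s>r\}.$$ The algebra $R$ is called Koszul if it is generated over $K$ by $R_1$ and $\operatorname{reg}^T_R(K)=0$. (1) Let $R$ be a Koszul algebra with $\operatorname{depth}(R)>0$ and $r=\operatorname{reg}^L_R(R)>0$. Then $\operatorname{reg}^L_R(\mathfrak m^j)=\max\{j,r\}$ for all $j\ge 0$. Moreover, for all integers $j$ with $0<j<r$, $$0=\operatorname{reg}^L_R(\mathfrak m^j)-r<\operatorname{reg}^T_R(\mathfrak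 m^j)=j<r=\operatorname{reg}^L_R(\mathfrak m^j).$$ (2) Let $n\ge 2$ and let $S=K[x_1,\dots,x_n]$ be the standard graded polynomial ring over a field $K$. For $d>0$ let $S^{(d)}$ be the $d$-th Veronese subring of $S$, graded by $(S^{(d)})_i=S_{id}$ for $i\ge 0$. Then for all sufficiently large $d$ the algebra $S^{(d)}$ is Koszul, $\operatorname{depth}(S^{(d)})>0$ and $\operatorname{reg}^L_{S^{(d)}}(S^{(d)})>0$, so that (1) applies to $R=S^{(d)}$. -/

import Mathlib

noncomputable section

namespace GradedReg

universe u v w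

/-! ### Graded algebras -/

section Algebra

variable {K : Type u} [Field K] {R : Type v} [CommRing R] [Algebra K R]

/-- `R = ⨁_{i ≥ 0} R_i` (with `R_i = 𝒜 i`) is a positively graded `K`-algebra: Noetherian, with
`R_0 = K`, that is, `K → R` is injective (`R` is nontrivial) with image `R_0`. -/
structure IsPositivelyGraded (𝒜 : ℕ → Submodule K R) : Prop where
  noetherian : IsNoetherianRing R
  nontrivial : Nontrivial R
  gradedMonoid : SetLike.GradedMonoid 𝒜
  internal : DirectSum.IsInternal 𝒜
  zero_eq : 𝒜 0 = 1

/-- `R` is a standard graded `K`-algebra: positively graded and generated in degree one. -/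
structure IsStandardGraded (𝒜 : ℕ → Submodule K R) : Prop extends IsPositivelyGraded 𝒜 where
  adjoin_eq_top : Algebra.adjoin K (𝒜 1 : Set R) = ⊤

/-- The ideal `𝔪 = ⨁_{i > 0} R_i`, generated by the elements of positive degree. -/
def maxIdeal (𝒜 : ℕ → Submodule K R) : Ideal R :=
  Ideal.span (⋃ i : ℕ, ⋃ _ : 0 < i, (𝒜 i : Set R))

/-- `R` as a `ℤ`-graded module over itself: `R_k` for `k ≥ 0` and `0` for `k < 0`. -/
def selfGrading (𝒜 : ℕ → Submodule K R) : ℤ → Submodule K R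
  | Int.ofNat n => 𝒜 n
  | Int.negSucc _ => ⊥

/-- The grading `I_k = I ∩ R_k` of a homogeneous ideal `I`. -/
def idealGrading (𝒜 : ℕ → Submodule K R) (I : Ideal R) (k : ℤ) : Submodule K I :=
  (selfGrading 𝒜 k).comap (I.subtype.restrictScalars K)

/-- The grading of `R ⧸ I` for a homogeneous ideal `I`: the images of the `R_k`. -/
def quotientGrading (𝒜 : ℕ → Submodule K R) (I : Ideal R) (k : ℤ) : Submodule K (R ⧸ I) :=
  (selfGrading 𝒜 k).map (Ideal.Quotient.mkₐ K I).toLinearMap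

/-- `depth R`: the supremum of the lengths of the `R`-regular sequences contained in `𝔪`. -/
def depth (𝒜 : ℕ → Submodule K R) : ℕ∞ :=
  ⨆ (rs : List R) (_ : (∀ a ∈ rs, a ∈ maxIdeal 𝒜) ∧ RingTheory.Sequence.IsRegular R rs),
    (rs.length : ℕ∞)

end Algebra

/-! ### Graded Tor -/

section Tor

variable {K : Type u} [Field K] {R : Type v} [CommRing R] [Algebra K R]

/-- A resolution `⋯ → F_1 → F_0 → N → 0` of the graded `R`-module `N = ⨁_k 𝒩 k` by finitely
generated graded free modules `F_i = ⨁_a R(-deg i a)` (`a : Fin (rank i)`) and homogeneous maps of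
degree `0`; the map `F_{i+1} → F_i` is given by the matrix `d i`, and `F_0 → N` by the images
`aug a` of the basis elements. -/
structure GradedFreeResolution (𝒜 : ℕ → Submodule K R) {N : Type w} [AddCommGroup N]
    [Module K N] [Module R N] (𝒩 : ℤ → Submodule K N) where
  rank : ℕ → ℕ
  deg : ∀ i : ℕ, Fin (rank i) → ℤ
  d : ∀ i : ℕ, Matrix (Fin (rank i)) (Fin (rank (i + 1))) R
  aug : Fin (rank 0) → N
  d_mem : ∀ i a c, d i a c ∈ selfGrading 𝒜 (deg (i + 1) c - deg i a)
  aug_mem : ∀ a, aug a ∈ 𝒩 (deg 0 a)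
  aug_surjective : Function.Surjective (Fintype.linearCombination R aug)
  exact_zero : Function.Exact (d 0).mulVecLin (Fintype.linearCombination R aug)
  exact_succ : ∀ i, Function.Exact (d (i + 1)).mulVecLin (d i).mulVecLin

namespace GradedFreeResolution

variable {𝒜 : ℕ → Submodule K R} {N : Type w} [AddCommGroup N] [Module K N] [Module R N]
  {𝒩 : ℤ → Submodule K N} (F : GradedFreeResolution 𝒜 𝒩)
  {M : Type*} [AddCommGroup M] [Module K M] [Module R M] [IsScalarTower K R M]
  (ℳ : ℤ → Submodule K M)

/-- The map `M ⊗ F_{i+1} → M ⊗ F_i` induced by `d i`, where `M ⊗ F_i = ⨁_a M(-deg i a)` is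
the module of functions `Fin (rank i) → M`. -/
def tensorD (M : Type*) [AddCommGroup M] [Module K M] [Module R M] [IsScalarTower K R M] (i : ℕ) :
    (Fin (F.rank (i + 1)) → M) →ₗ[K] (Fin (F.rank i) → M) :=
  LinearMap.pi fun a => ∑ c, (F.d i a c • LinearMap.proj (R := R) c).restrictScalars K

/-- The component of degree `j` of `M ⊗ F_i = ⨁_a M(-deg i a)`. -/
def tensorDegree (i : ℕ) (j : ℤ) : Submodule K (Fin (F.rank i) → M) :=
  Submodule.pi Set.univ fun a => ℳ (j - F.deg i a)

/-- The cycles of degree `j` of `M ⊗ F` in homological degree `i`. -/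
def cycles : (i : ℕ) → (j : ℤ) → Submodule K (Fin (F.rank i) → M)
  | 0, j => F.tensorDegree ℳ 0 j
  | i + 1, j => F.tensorDegree ℳ (i + 1) j ⊓ LinearMap.ker (F.tensorD M i)

/-- The boundaries of degree `j` of `M ⊗ F` in homological degree `i`. -/
def boundaries (i : ℕ) (j : ℤ) : Submodule K (Fin (F.rank i) → M) :=
  (F.tensorDegree ℳ (i + 1) j).map (F.tensorD M i)

/-- `Tor_i^R(M, N)_j = H_i(M ⊗_R F)_j`, computed with the graded free resolution `F` of `N`. -/
abbrev Tor (i : ℕ) (j : ℤ) : Type _ :=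
  F.cycles ℳ i j ⧸ (F.boundaries ℳ i j).submoduleOf (F.cycles ℳ i j)

end GradedFreeResolution

end Tor

/-! ### Graded local cohomology -/

section LocalCohomology

variable {K : Type u} [Field K] {R : Type v} [CommRing R] [Algebra K R]

/-- Finitely many homogeneous elements `x_1, …, x_n` of positive degrees that generate `𝔪` up to
radical. -/
structure HomogeneousSystem (𝒜 : ℕ → Submodule K R) where
  n : ℕ
  x : Fin n → R
  homogeneous : ∀ t, ∃ e : ℕ, 0 < e ∧ x t ∈ 𝒜 e
  radical_eq : (Ideal.span (Set.range x)).radical = (maxIdeal 𝒜).radical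

/-- The component of degree `j` of the localization `U⁻¹ M` of a graded module: it is spanned by
the fractions `m / s` with `s ∈ U` homogeneous of some degree `e` and `m ∈ M_{j+e}`. -/
def localizedDegree (𝒜 : ℕ → Submodule K R) {M : Type*} [AddCommGroup M] [Module K M]
    [Module R M] [IsScalarTower K R M] (ℳ : ℤ → Submodule K M) (U : Submonoid R) (j : ℤ) :
    Submodule K (LocalizedModule U M) :=
  Submodule.span K {z | ∃ (e : ℕ) (s : U) (m : M), (s : R) ∈ 𝒜 e ∧ m ∈ ℳ (j + e) ∧
    z = LocalizedModule.mk m s}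

namespace HomogeneousSystem

variable {𝒜 : ℕ → Submodule K R} (X : HomogeneousSystem 𝒜)
  {M : Type*} [AddCommGroup M] [Module K M] [Module R M] [IsScalarTower K R M]
  (ℳ : ℤ → Submodule K M)

/-- The multiplicative set generated by the `x_t`, `t ∈ T`; inverting it is the same as
inverting the product of these elements. -/
def mult (T : Finset (Fin X.n)) : Submonoid R := Submonoid.closure (X.x '' T)

theorem mult_mono {S T : Finset (Fin X.n)} (h : S ⊆ T) : X.mult S ≤ X.mult T :=
  Submonoid.closure_mono (Set.image_mono (Finset.coe_subset.mpr h))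

/-- The localization map `M_{x_S} → M_{x_T}` for `S ⊆ T`. -/
def res (M : Type*) [AddCommGroup M] [Module K M] [Module R M] [IsScalarTower K R M]
    {S T : Finset (Fin X.n)} (h : S ⊆ T) :
    LocalizedModule (X.mult S) M →ₗ[R] LocalizedModule (X.mult T) M :=
  IsLocalizedModule.liftOfLE (X.mult S) (X.mult T) (X.mult_mono h)
    (LocalizedModule.mkLinearMap (X.mult S) M) (LocalizedModule.mkLinearMap (X.mult T) M)

/-- The term `C^p = ⨁_{|T| = p} M_{x_T}` of the (modified) Čech complex of `M`. -/
abbrev Cochain (M : Type*) [AddCommGroup M] [Module R M] (p : ℕ) : Type _ :=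
  (T : {T : Finset (Fin X.n) // T.card = p}) → LocalizedModule (X.mult T.1) M

/-- The Čech differential
`(δ c)_T = ∑_{t ∈ T} (-1)^{#{s ∈ T : s < t}} c_{T ∖ {t}}|_{M_{x_T}}`. -/
def cechD (M : Type*) [AddCommGroup M] [Module K M] [Module R M] [IsScalarTower K R M] (p : ℕ) :
    X.Cochain M p →ₗ[K] X.Cochain M (p + 1) :=
  LinearMap.pi fun T => ∑ t : {t // t ∈ T.1},
    ((-1 : R) ^ (T.1.filter (· < t.1)).card • ((X.res M (Finset.erase_subset t.1 T.1)).comp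
      (LinearMap.proj (R := R) (φ := fun S : {S : Finset (Fin X.n) // S.card = p} =>
          LocalizedModule (X.mult S.1) M)
        ⟨T.1.erase t.1, by rw [Finset.card_erase_of_mem t.2, T.2, Nat.add_sub_cancel]⟩))
      ).restrictScalars K

/-- The component of degree `j` of `C^p`. -/
def cochainDegree (p : ℕ) (j : ℤ) : Submodule K (X.Cochain M p) :=
  Submodule.pi Set.univ fun T => localizedDegree 𝒜 ℳ (X.mult T.1) j

/-- The Čech cocycles of degree `j` in `C^p`. -/
def cocycles (p : ℕ) (j : ℤ) : Submodule K (X.Cochain M p) :=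
  X.cochainDegree ℳ p j ⊓ LinearMap.ker (X.cechD M p)

/-- The Čech coboundaries of degree `j` in `C^p`. -/
def coboundaries : (p : ℕ) → (j : ℤ) → Submodule K (X.Cochain M p)
  | 0, _ => ⊥
  | p + 1, j => (X.cochainDegree ℳ p j).map (X.cechD M p)

/-- `H^p_𝔪(M)_j`, computed with the Čech complex of `x_1, …, x_n`. -/
abbrev LocalCohomology (p : ℕ) (j : ℤ) : Type _ :=
  X.cocycles ℳ p j ⧸ (X.coboundaries ℳ p j).submoduleOf (X.cocycles ℳ p j)

end HomogeneousSystem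

end LocalCohomology

/-! ### Regularities -/

section Regularity

variable {K : Type u} [Field K] {R : Type v} [CommRing R] [Algebra K R]

/-- The infimum in `ℤ ∪ {±∞}` (inside the extended reals) of a set of integers. -/
def intInf (s : Set ℤ) : EReal := sInf ((fun r : ℤ => ((r : ℝ) : EReal)) '' s)

/-- `Tor_i^R(M, K)_j = 0`, where `K = R ⧸ 𝔪`. The graded vector space `Tor_i^R(M, K)` does not
depend on the graded free resolution of `K` with which it is computed. -/
def TorVanishes (𝒜 : ℕ → Submodule K R) {M : Type*} [AddCommGroup M] [Module K M] [Module R M]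
    [IsScalarTower K R M] (ℳ : ℤ → Submodule K M) (i : ℕ) (j : ℤ) : Prop :=
  ∀ F : GradedFreeResolution 𝒜 (quotientGrading 𝒜 (maxIdeal 𝒜)), Subsingleton (F.Tor ℳ i j)

/-- `H^i_𝔪(M)_j = 0`. The graded vector space `H^i_𝔪(M)` does not depend on the system of
elements with which it is computed. -/
def LocalCohomologyVanishes (𝒜 : ℕ → Submodule K R) {M : Type*} [AddCommGroup M] [Module K M]
    [Module R M] [IsScalarTower K R M] (ℳ : ℤ → Submodule K M) (i : ℕ) (j : ℤ) : Prop :=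
  ∀ X : HomogeneousSystem 𝒜, Subsingleton (X.LocalCohomology ℳ i j)

/-- The Tor-regularity
`reg^T_R(M) = inf {r ∈ ℤ : Tor_i^R(M, K)_{i+s} = 0 for all i ≥ 0 and all s > r}`. -/
def regT (𝒜 : ℕ → Submodule K R) {M : Type*} [AddCommGroup M] [Module K M] [Module R M]
    [IsScalarTower K R M] (ℳ : ℤ → Submodule K M) : EReal :=
  intInf {r : ℤ | ∀ (i : ℕ) (s : ℤ), r < s → TorVanishes 𝒜 ℳ i (i + s)}

/-- The local-regularity
`reg^L_R(M) = inf {r ∈ ℤ : H^i_𝔪(M)_{s-i} = 0 for all i ≥ 0 and all s > r}`. -/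
def regL (𝒜 : ℕ → Submodule K R) {M : Type*} [AddCommGroup M] [Module K M] [Module R M]
    [IsScalarTower K R M] (ℳ : ℤ → Submodule K M) : EReal :=
  intInf {r : ℤ | ∀ (i : ℕ) (s : ℤ), r < s → LocalCohomologyVanishes 𝒜 ℳ i (s - i)}

/-- `R` is a Koszul algebra: it is standard graded and `reg^T_R(K) = 0` for `K = R ⧸ 𝔪`. -/
structure IsKoszul (𝒜 : ℕ → Submodule K R) : Prop extends IsStandardGraded 𝒜 where
  regT_eq_zero : regT 𝒜 (quotientGrading 𝒜 (maxIdeal 𝒜)) = 0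

end Regularity

/-! ### Veronese subrings of polynomial rings -/

section Veronese

/-- The `d`-th Veronese subring `S^{(d)} = ⨁_i S_{id}` of `S = K[x_1, …, x_n]`: the polynomials
all of whose monomials have degree divisible by `d`. -/
def veronese (K : Type u) [Field K] (n d : ℕ) : Subalgebra K (MvPolynomial (Fin n) K) where
  carrier := {f | ∀ m ∈ f.support, d ∣ m.degree}
  mul_mem' := by
    classical
    intro f g hf hg m hm
    obtain ⟨a, ha, b, hb, rfl⟩ := Finset.mem_add.mp (MvPolynomial.support_mul f g hm)
    rw [map_add]
    exact dvd_add (hf a ha) (hg b hb)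
  add_mem' := by
    classical
    intro f g hf hg m hm
    rcases Finset.mem_union.mp (MvPolynomial.support_add hm) with h | h
    exacts [hf m h, hg m h]
  algebraMap_mem' := by
    classical
    intro c m hm
    rw [MvPolynomial.algebraMap_eq, MvPolynomial.mem_support_iff, MvPolynomial.coeff_C] at hm
    have h0 : (0 : Fin n →₀ ℕ) = m := by
      by_contra h
      exact hm (if_neg h)
    simp [← h0]

/-- The grading `(S^{(d)})_i = S_{id}` of the `d`-th Veronese subring. -/
def veroneseGrading (K : Type u) [Field K] (n d : ℕ) (i : ℕ) : Submodule K (veronese K n d) :=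
  (MvPolynomial.homogeneousSubmodule (Fin n) K (i * d)).comap (veronese K n d).val.toLinearMap

end Veronese

end GradedReg

end

/-!
Let `R` be a Koszul algebra of positive depth.

*Tor-regularity of `𝔪^j`.* The sequences `0 → 𝔪^{j+1} → 𝔪^j → 𝔪^j/𝔪^{j+1} → 0` end in a sum of
copies of `K(-j)`, whose `Tor_i` lives in degree `i + j` because `R` is Koszul. Starting from
`Tor_i(R, K) = 0` for `i > 0`, induction on `j` gives `reg^T(𝔪^j) ≤ j`. Equality holds because
`Tor_0(𝔪^j, K)_j = R_j ≠ 0`: otherwise `𝔪^j = 0`, which contradicts the existence of a regular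
element (`IsKoszul.regT_maxIdeal_pow`).

*Local regularity of `𝔪^j`.* The module `R/𝔪^j` is `𝔪`-torsion, so its local cohomology is
concentrated in cohomological degree `0`, where it is `R/𝔪^j` itself and has nonzero components
exactly in the degrees `0, …, j - 1`. Since `H^0_𝔪(R) = 0` by the depth hypothesis, the long exact
sequence of `0 → 𝔪^j → R → R/𝔪^j → 0` leaves `H^i_𝔪` unchanged for `i ≥ 2` and enlarges `H^1_𝔪` by
`R/𝔪^j`. Hence `reg^L(𝔪^j) = max(j, reg^L(R))` (`IsStandardGraded.regL_maxIdeal_pow`). The argument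
works for each homogeneous system separately, so the independence of Čech cohomology of the system
is never needed. That `reg^L(R) < ∞`, without which the difference in the second part of the claim
would be meaningless, is shown by Noetherian induction on `I` for all `R/I`. A homogeneous `a ∉ I` of
degree `e` gives `0 → (R/(I : a))(-e) → R/I → R/(I + (a)) → 0`. If `I ≠ (I : a)`, the induction
hypothesis applies to both outer terms. If `I = (I : a)` and `e > 0`, then `a` acts injectively on
local cohomology in high degrees, whereas each class is killed by a power of `a`, so that the bound
for `R/(I + (a))` is a bound for `R/I` (`IsPositivelyGraded.regL_self_ne_top`).

*Veronese subrings.* Put `R = S^{(d)}` with `S = K[x_1, …, x_n]`, and consider the Veronese modules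
`⨁_i (S/(x_1, …, x_k))_{a + id}` with `a ≥ 0`. Multiplication by `x_{k+1}` gives short exact
sequences between them, and induction shows that all of them have linear resolutions over `R`. For
`k = n` and `a = 0` the module is `K`, so that `R` is Koszul (`isKoszul_veronese`); the existence of
a graded free resolution of `K` is needed for `reg^T(K)` not to be `-∞`. If `d ≥ n`, there is a
monomial `x^{-a}` of degree `-d` all of whose exponents are negative. It defines a nonzero class in
the top Čech cohomology `H^n_𝔪(R)_{-1}`, because no sum of fractions that each omit a variable in
the denominator contains it (`not_vanishes_veronese`). Therefore `reg^L(R) ≥ n - 1 > 0`.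
-/

noncomputable section

namespace GradedReg

universe u v w

set_option linter.unusedSectionVars false

open DirectSum
open scoped Pointwise

/-! ### Infima of sets of integers -/

theorem intInf_le_intCast_iff {s : Set ℤ} (hs : IsUpperSet s) (n : ℤ) :
    intInf s ≤ ((n : ℝ) : EReal) ↔ n ∈ s := by
  constructor
  · intro h
    have h1 : intInf s < (((n + 1 : ℤ) : ℝ) : EReal) :=
      lt_of_le_of_lt h (by exact_mod_cast lt_add_one n)
    obtain ⟨_, ⟨r, hr, rfl⟩, hlt⟩ := sInf_lt_iff.mp h1
    have : r < n + 1 := by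
      simp only at hlt
      exact_mod_cast hlt
    exact hs (by omega) hr
  · intro h
    exact sInf_le ⟨n, h, rfl⟩

theorem le_intInf_iff {s : Set ℤ} {x : EReal} :
    x ≤ intInf s ↔ ∀ n ∈ s, x ≤ ((n : ℝ) : EReal) := by
  simp [intInf, le_sInf_iff]

theorem isUpperSet_setOf_forall_lt (P : ℕ → ℤ → Prop) :
    IsUpperSet {r : ℤ | ∀ (i : ℕ) (s : ℤ), r < s → P i s} :=
  fun _ _ hab ha i s hs => ha i s (hab.trans_lt hs)

theorem intInf_inter_Ici {s : Set ℤ} (hs : IsUpperSet s) (j : ℤ) :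
    intInf (s ∩ Set.Ici j) = max ((j : ℝ) : EReal) (intInf s) := by
  apply le_antisymm
  · by_contra! hlt
    obtain ⟨h1, h2⟩ := max_lt_iff.mp hlt
    obtain ⟨_, ⟨r, hr, rfl⟩, hlt'⟩ := sInf_lt_iff.mp h2
    have hmem : max j r ∈ s ∩ Set.Ici j := ⟨hs (le_max_right _ _) hr, le_max_left j r⟩
    have hle : intInf (s ∩ Set.Ici j) ≤ (((max j r : ℤ) : ℝ) : EReal) := sInf_le ⟨_, hmem, rfl⟩
    rcases max_choice j r with h | h <;> rw [h] at hle
    · exact absurd h1 (not_lt.mpr hle)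
    · exact absurd hlt' (not_lt.mpr hle)
  · rw [le_intInf_iff]
    rintro n ⟨hn, hj⟩
    exact max_le (by exact_mod_cast hj) (sInf_le ⟨n, hn, rfl⟩)

theorem intInf_ne_top_iff {s : Set ℤ} : intInf s ≠ ⊤ ↔ s.Nonempty := by
  constructor
  · intro h
    by_contra hs
    rw [Set.not_nonempty_iff_eq_empty] at hs
    simp [intInf, hs] at h
  · rintro ⟨n, hn⟩ h
    have : intInf s ≤ ((n : ℝ) : EReal) := sInf_le ⟨n, hn, rfl⟩
    rw [h, top_le_iff] at this
    exact EReal.coe_ne_top _ this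

/-! ### Graded rings and modules -/

section Algebra

variable {K : Type u} [Field K] {R : Type v} [CommRing R] [Algebra K R]

/-- A positively graded algebra is a graded algebra in the sense of Mathlib; the decomposition
map is chosen. -/
@[reducible] def IsPositivelyGraded.gradedAlgebra {𝒜 : ℕ → Submodule K R}
    (h : IsPositivelyGraded 𝒜) : GradedAlgebra 𝒜 :=
  { h.gradedMonoid, h.internal.chooseDecomposition with }

/-- The family `ℳ` of subspaces of an `R`-module satisfies `R_e ℳ_k ⊆ ℳ_{k+e}`. The `ℳ_k` are not
required to span the ambient module. -/
def IsGradedSMul (𝒜 : ℕ → Submodule K R) {M : Type*} [AddCommGroup M] [Module K M] [Module R M]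
    (ℳ : ℤ → Submodule K M) : Prop :=
  ∀ ⦃e : ℕ⦄ ⦃k : ℤ⦄ ⦃a : R⦄ ⦃m : M⦄, a ∈ 𝒜 e → m ∈ ℳ k → a • m ∈ ℳ (k + e)

/-- The sequence `M' → M → M''` of homogeneous maps of degree `0` induces short exact sequences
`0 → ℳ'_k → ℳ_k → ℳ''_k → 0` of the graded components. -/
structure GradedExact {M' M M'' : Type*} [AddCommGroup M'] [AddCommGroup M] [AddCommGroup M'']
    [Module K M'] [Module K M] [Module K M''] [Module R M'] [Module R M] [Module R M'']
    (ℳ' : ℤ → Submodule K M') (ℳ : ℤ → Submodule K M) (ℳ'' : ℤ → Submodule K M'')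
    (f : M' →ₗ[R] M) (g : M →ₗ[R] M'') : Prop where
  map_left : ∀ {k m}, m ∈ ℳ' k → f m ∈ ℳ k
  map_right : ∀ {k m}, m ∈ ℳ k → g m ∈ ℳ'' k
  injective : ∀ {k m}, m ∈ ℳ' k → f m = 0 → m = 0
  comp_eq_zero : ∀ m, g (f m) = 0
  exact : ∀ {k m}, m ∈ ℳ k → g m = 0 → ∃ m' ∈ ℳ' k, f m' = m
  surjective : ∀ {k m}, m ∈ ℳ'' k → ∃ m' ∈ ℳ k, g m' = m

section Self

variable {𝒜 : ℕ → Submodule K R}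

theorem selfGrading_natCast (n : ℕ) : selfGrading 𝒜 (n : ℤ) = 𝒜 n := rfl

theorem selfGrading_of_neg {k : ℤ} (hk : k < 0) : selfGrading 𝒜 k = ⊥ := by
  obtain ⟨n, rfl⟩ := Int.eq_negSucc_of_lt_zero hk
  rfl

variable (𝒜) in
theorem isGradedSMul_selfGrading [SetLike.GradedMonoid 𝒜] :
    IsGradedSMul 𝒜 (selfGrading 𝒜) := by
  intro e k a m ha hm
  rcases lt_or_ge k 0 with hk | hk
  · rw [selfGrading_of_neg hk, Submodule.mem_bot] at hm
    simp [hm]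
  · lift k to ℕ using hk
    rw [show (k : ℤ) + e = ((e + k : ℕ) : ℤ) by push_cast; ring, selfGrading_natCast]
    exact SetLike.mul_mem_graded ha hm

variable (𝒜) in
theorem isGradedSMul_idealGrading [SetLike.GradedMonoid 𝒜] (I : Ideal R) :
    IsGradedSMul 𝒜 (idealGrading 𝒜 I) := by
  intro e k a m ha hm
  exact isGradedSMul_selfGrading 𝒜 ha hm

variable (𝒜) in
theorem isGradedSMul_quotientGrading [SetLike.GradedMonoid 𝒜] (I : Ideal R) :
    IsGradedSMul 𝒜 (quotientGrading 𝒜 I) := by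
  rintro e k a _ ha ⟨m, hm, rfl⟩
  exact ⟨a • m, isGradedSMul_selfGrading 𝒜 ha hm, rfl⟩

/-- Shifting by `e`: the grading of `M(-e)`. -/
def shift {M : Type*} [AddCommGroup M] [Module K M] (ℳ : ℤ → Submodule K M) (e : ℤ) (k : ℤ) :
    Submodule K M := ℳ (k - e)

/-- The action of homogeneous elements, with degrees in `ℤ`. -/
theorem IsGradedSMul.smul_mem {M : Type*} [AddCommGroup M] [Module K M] [Module R M]
    {ℳ : ℤ → Submodule K M} (hℳ : IsGradedSMul 𝒜 ℳ) {e k : ℤ} {a : R} {m : M}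
    (ha : a ∈ selfGrading 𝒜 e) (hm : m ∈ ℳ k) : a • m ∈ ℳ (k + e) := by
  rcases lt_or_ge e 0 with he | he
  · rw [selfGrading_of_neg he, Submodule.mem_bot] at ha
    rw [ha, zero_smul]
    exact zero_mem _
  · lift e to ℕ using he
    exact hℳ ha hm

theorem mem_maxIdeal_of_mem {i : ℕ} (hi : 0 < i) {a : R} (ha : a ∈ 𝒜 i) : a ∈ maxIdeal 𝒜 :=
  Ideal.subset_span (Set.mem_iUnion₂.mpr ⟨i, hi, ha⟩)

theorem mem_maxIdeal_of_mem_selfGrading {k : ℤ} (hk : k ≠ 0) {a : R}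
    (ha : a ∈ selfGrading 𝒜 k) : a ∈ maxIdeal 𝒜 := by
  rcases lt_or_ge k 0 with hk' | hk'
  · rw [selfGrading_of_neg hk', Submodule.mem_bot] at ha
    rw [ha]
    exact zero_mem _
  · lift k to ℕ using hk'
    exact mem_maxIdeal_of_mem (by omega) ha

variable [GradedAlgebra 𝒜]

variable (𝒜) in
/-- The projection of `R` onto its component of degree `k`, for `k ∈ ℤ`. -/
def intProj : ℤ → R →ₗ[K] R
  | Int.ofNat n => GradedAlgebra.proj 𝒜 n
  | Int.negSucc _ => 0

theorem intProj_of_neg {k : ℤ} (hk : k < 0) (x : R) : intProj 𝒜 k x = 0 := by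
  obtain ⟨n, rfl⟩ := Int.eq_negSucc_of_lt_zero hk
  rfl

theorem intProj_mem (k : ℤ) (x : R) : intProj 𝒜 k x ∈ selfGrading 𝒜 k := by
  rcases lt_or_ge k 0 with hk | hk
  · rw [intProj_of_neg hk]; exact zero_mem _
  · lift k to ℕ using hk
    exact SetLike.coe_mem _

theorem intProj_of_mem {k : ℤ} {x : R} (hx : x ∈ selfGrading 𝒜 k) : intProj 𝒜 k x = x := by
  rcases lt_or_ge k 0 with hk | hk
  · rw [selfGrading_of_neg hk, Submodule.mem_bot] at hx
    simp [hx]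
  · lift k to ℕ using hk
    exact decompose_of_mem_same 𝒜 hx

theorem intProj_of_mem_ne {k l : ℤ} {x : R} (hx : x ∈ selfGrading 𝒜 k) (h : k ≠ l) :
    intProj 𝒜 l x = 0 := by
  rcases lt_or_ge k 0 with hk | hk
  · rw [selfGrading_of_neg hk, Submodule.mem_bot] at hx
    simp [hx]
  rcases lt_or_ge l 0 with hl | hl
  · exact intProj_of_neg hl x
  lift k to ℕ using hk
  lift l to ℕ using hl
  exact decompose_of_mem_ne 𝒜 hx (by exact_mod_cast h)

theorem exists_sum_intProj (e : ℤ) (x : R) :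
    ∃ N : ℤ, ∀ N', N ≤ N' → ∑ j ∈ Finset.Icc (-N') N', intProj 𝒜 (j - e) x = x := by
  induction x using DirectSum.Decomposition.inductionOn 𝒜 with
  | zero => exact ⟨0, fun _ _ => by simp⟩
  | @homogeneous i m =>
    refine ⟨|i + e|, fun N' hN' => ?_⟩
    have hm : (m : R) ∈ selfGrading 𝒜 (i : ℤ) := m.2
    rw [Finset.sum_eq_single ((i : ℤ) + e), add_sub_cancel_right, intProj_of_mem hm]
    · intro j _ hj
      exact intProj_of_mem_ne hm (fun h => hj (by omega))
    · intro h
      exact absurd (Finset.mem_Icc.mpr (abs_le.mp hN')) h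
  | add m m' h h' =>
    obtain ⟨N, hN⟩ := h
    obtain ⟨N₁, hN₁⟩ := h'
    refine ⟨max N N₁, fun N' hN' => ?_⟩
    simp only [map_add, Finset.sum_add_distrib]
    rw [hN N' ((le_max_left _ _).trans hN'), hN₁ N' ((le_max_right _ _).trans hN')]

theorem selfGrading_mul_mem {k l : ℤ} {a b : R} (ha : a ∈ selfGrading 𝒜 k)
    (hb : b ∈ selfGrading 𝒜 l) : a * b ∈ selfGrading 𝒜 (k + l) := by
  rcases lt_or_ge k 0 with hk | hk
  · rw [selfGrading_of_neg hk, Submodule.mem_bot] at ha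
    simp [ha]
  · lift k to ℕ using hk
    rw [add_comm]
    exact isGradedSMul_selfGrading 𝒜 ha hb

theorem intProj_mul_of_left_mem {k : ℤ} {a : R} (ha : a ∈ selfGrading 𝒜 k) (l : ℤ) (b : R) :
    intProj 𝒜 l (a * b) = a * intProj 𝒜 (l - k) b := by
  induction b using DirectSum.Decomposition.inductionOn 𝒜 with
  | zero => simp
  | @homogeneous i m =>
    have hm : (m : R) ∈ selfGrading 𝒜 (i : ℤ) := m.2
    by_cases h : (i : ℤ) = l - k
    · rw [← h, intProj_of_mem hm, intProj_of_mem]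
      have := selfGrading_mul_mem ha hm
      rwa [h, add_sub_cancel] at this
    · rw [intProj_of_mem_ne hm h, mul_zero]
      exact intProj_of_mem_ne (selfGrading_mul_mem ha hm) (fun h' => h (by omega))
  | add m m' h h' => simp [mul_add, h, h']

/-- If `a = ∑ r_t y_t` with `a` and the `y_t` homogeneous, then the coefficients can be chosen
homogeneous. -/
theorem exists_homogeneous_coeff {ι : Type*} [Fintype ι] {D : ℤ} {a : R}
    (ha : a ∈ selfGrading 𝒜 D) {y : ι → R} {δ : ι → ℤ} (hy : ∀ t, y t ∈ selfGrading 𝒜 (δ t))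
    (h : a ∈ Ideal.span (Set.range y)) :
    ∃ r : ι → R, (∀ t, r t ∈ selfGrading 𝒜 (D - δ t)) ∧ ∑ t, r t * y t = a := by
  obtain ⟨c, hc⟩ := (Ideal.mem_span_range_iff_exists_fun).mp h
  refine ⟨fun t => intProj 𝒜 (D - δ t) (c t), fun t => intProj_mem _ _, ?_⟩
  rw [← intProj_of_mem ha, ← hc, map_sum]
  refine Finset.sum_congr rfl fun t _ => ?_
  rw [mul_comm (c t), intProj_mul_of_left_mem (hy t), mul_comm]

/-- A homogeneous ideal contains the components of its elements. -/
theorem intProj_mem_of_isHomogeneous {I : Ideal R} (hI : I.IsHomogeneous 𝒜) {x : R} (hx : x ∈ I)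
    (k : ℤ) : intProj 𝒜 k x ∈ I := by
  rcases lt_or_ge k 0 with hk | hk
  · rw [intProj_of_neg hk]; exact zero_mem _
  · lift k to ℕ using hk
    exact hI k hx

theorem isHomogeneous_maxIdeal : (maxIdeal 𝒜).IsHomogeneous 𝒜 := by
  apply Ideal.homogeneous_span
  intro x hx
  obtain ⟨i, _, hx⟩ := Set.mem_iUnion₂.mp hx
  exact ⟨i, hx⟩

/-- Elements of `𝔪 ^ j` have no components of degree `< j`. -/
theorem intProj_eq_zero_of_mem_maxIdeal_pow {j : ℕ} {x : R} (hx : x ∈ maxIdeal 𝒜 ^ j) :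
    ∀ k : ℤ, k < j → intProj 𝒜 k x = 0 := by
  induction j generalizing x with
  | zero => intro k hk; exact intProj_of_neg (by exact_mod_cast hk) x
  | succ j ih =>
    rw [pow_succ'] at hx
    refine Submodule.mul_induction_on hx (fun a ha b hb => ?_) (fun a b ha hb k hk => by
      rw [map_add, ha k hk, hb k hk, add_zero])
    refine Submodule.span_induction (p := fun a _ => ∀ k : ℤ, k < (j + 1 : ℕ) →
      intProj 𝒜 k (a * b) = 0) ?_ (by simp) ?_ ?_ ha
    · intro a ha k hk
      obtain ⟨i, hi, ha⟩ := Set.mem_iUnion₂.mp ha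
      rw [intProj_mul_of_left_mem (k := i) ha, ih hb _ (by push_cast at hk; omega), mul_zero]
    · intro a a' _ _ h h' k hk
      rw [add_mul, map_add, h k hk, h' k hk, add_zero]
    · intro c a _ h k hk
      induction c using DirectSum.Decomposition.inductionOn 𝒜 with
      | zero => simp
      | @homogeneous i m =>
        rw [smul_eq_mul, mul_assoc, intProj_mul_of_left_mem (k := i) m.2,
          h _ (by omega), mul_zero]
      | add m m' h h' => rw [add_smul, add_mul, map_add, h, h', add_zero]

theorem eq_zero_of_mem_maxIdeal_pow {j : ℕ} {k : ℤ} (hk : k < j) {x : R}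
    (hx : x ∈ maxIdeal 𝒜 ^ j) (hxk : x ∈ selfGrading 𝒜 k) : x = 0 := by
  rw [← intProj_of_mem hxk, intProj_eq_zero_of_mem_maxIdeal_pow hx k hk]

end Self

namespace IsStandardGraded

variable {𝒜 : ℕ → Submodule K R} (h : IsStandardGraded 𝒜)
include h

theorem mem_span_pow {k : ℕ} {x : R} (hx : x ∈ 𝒜 k) :
    x ∈ Ideal.span (𝒜 1 : Set R) ^ k := by
  let _ := h.gradedAlgebra
  let P : Subalgebra K R :=
    { carrier := {x | ∀ k : ℕ, (decompose 𝒜 x k : R) ∈ Ideal.span (𝒜 1 : Set R) ^ k}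
      mul_mem' := by
        intro a b ha hb k
        rw [decompose_mul, coe_mul_apply_eq_sum_antidiagonal]
        refine Ideal.sum_mem _ fun ij hij => ?_
        rw [← Finset.HasAntidiagonal.mem_antidiagonal.mp hij, pow_add]
        exact Ideal.mul_mem_mul (ha _) (hb _)
      add_mem' := by
        intro a b ha hb k
        simpa using add_mem (ha k) (hb k)
      algebraMap_mem' := by
        intro c k
        rcases Nat.eq_zero_or_pos k with rfl | hk
        · simp
        · rw [decompose_of_mem_ne 𝒜 (SetLike.algebraMap_mem_graded 𝒜 c) hk.ne]
          exact zero_mem _ }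
  have hP : x ∈ P := by
    have : (⊤ : Subalgebra K R) ≤ P := by
      rw [← h.adjoin_eq_top, Algebra.adjoin_le_iff]
      intro a ha k
      by_cases hk : k = 1
      · subst hk
        rw [decompose_of_mem_same 𝒜 ha, pow_one]
        exact Ideal.subset_span ha
      · rw [decompose_of_mem_ne 𝒜 ha (Ne.symm hk)]
        exact zero_mem _
    exact this trivial
  have := hP k
  rwa [decompose_of_mem_same 𝒜 hx] at this

theorem maxIdeal_eq_span : maxIdeal 𝒜 = Ideal.span (𝒜 1 : Set R) := by
  apply le_antisymm
  · rw [maxIdeal, Ideal.span_le]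
    intro x hx
    obtain ⟨i, hi, hx⟩ := Set.mem_iUnion₂.mp hx
    exact Ideal.pow_le_self hi.ne' (h.mem_span_pow hx)
  · rw [Ideal.span_le]
    exact fun x hx => mem_maxIdeal_of_mem one_pos hx

theorem mem_maxIdeal_pow {j k : ℕ} (hjk : j ≤ k) {x : R} (hx : x ∈ 𝒜 k) :
    x ∈ maxIdeal 𝒜 ^ j := by
  rw [h.maxIdeal_eq_span]
  exact Ideal.pow_le_pow_right hjk (h.mem_span_pow hx)

/-- If `𝔪` contains a nonzerodivisor, all components of `R` are nonzero: `R_k = 0` would force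
`𝔪 ^ k = 0`. -/
theorem exists_ne_zero {a : R} (ha : a ∈ maxIdeal 𝒜) (hreg : IsSMulRegular R a) (k : ℕ) :
    ∃ x ∈ 𝒜 k, x ≠ 0 := by
  have := h.nontrivial
  have := h.gradedMonoid
  by_contra! h0
  have hpow : maxIdeal 𝒜 ^ k = ⊥ := by
    rw [h.maxIdeal_eq_span, Ideal.span, Submodule.span_pow, Submodule.span_eq_bot]
    intro x hx
    refine h0 x ?_
    have key : ∀ (k : ℕ) (x : R), x ∈ (𝒜 1 : Set R) ^ k → x ∈ 𝒜 k := by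
      intro k
      induction k with
      | zero => intro x hx; simp at hx; subst hx; exact SetLike.one_mem_graded 𝒜
      | succ k ih =>
        intro x hx
        rw [pow_succ] at hx
        obtain ⟨a, ha, b, hb, rfl⟩ := hx
        exact SetLike.mul_mem_graded (ih a ha) hb
    exact key k x hx
  have hak : a ^ k = 0 := by
    have := Ideal.pow_mem_pow ha k
    rwa [hpow] at this
  have := (hreg.pow k) (a₁ := (1 : R)) (a₂ := 0) (by simp [hak])
  exact one_ne_zero this

end IsStandardGraded

theorem exists_regular_of_depth_pos {𝒜 : ℕ → Submodule K R} (h : 0 < depth 𝒜) :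
    ∃ a ∈ maxIdeal 𝒜, IsSMulRegular R a := by
  unfold depth at h
  obtain ⟨rs, h⟩ := lt_iSup_iff.mp h
  obtain ⟨⟨hm, hreg⟩, hpos⟩ := lt_iSup_iff.mp h
  cases rs with
  | nil => simp at hpos
  | cons a rs =>
    exact ⟨a, hm a (by simp), ((RingTheory.Sequence.isRegular_cons_iff R a rs).mp hreg).1⟩

end Algebra

/-! ### Long exact sequences for graded Tor -/

section Tor

variable {K : Type u} [Field K] {R : Type v} [CommRing R] [Algebra K R]

theorem subsingleton_quotient_submoduleOf_iff {V : Type*} [AddCommGroup V] [Module K V]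
    (A B : Submodule K V) : Subsingleton (A ⧸ B.submoduleOf A) ↔ A ≤ B := by
  rw [Submodule.Quotient.subsingleton_iff, Submodule.submoduleOf_eq_top]

namespace GradedFreeResolution

variable {𝒜 : ℕ → Submodule K R} {N : Type w} [AddCommGroup N] [Module K N] [Module R N]
  {𝒩 : ℤ → Submodule K N} (F : GradedFreeResolution 𝒜 𝒩)

section Basic

variable {M : Type*} [AddCommGroup M] [Module K M] [Module R M] [IsScalarTower K R M]
  {ℳ : ℤ → Submodule K M}

theorem tensorD_apply (i : ℕ) (z : Fin (F.rank (i + 1)) → M) (a : Fin (F.rank i)) :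
    F.tensorD M i z a = ∑ c, F.d i a c • z c := by
  simp [tensorD, LinearMap.sum_apply]

theorem mem_tensorDegree {i : ℕ} {j : ℤ} {z : Fin (F.rank i) → M} :
    z ∈ F.tensorDegree ℳ i j ↔ ∀ a, z a ∈ ℳ (j - F.deg i a) := by
  simp [tensorDegree, Submodule.mem_pi]

theorem d_mul_d (i : ℕ) : F.d i * F.d (i + 1) = 0 := by
  have h := (F.exact_succ i).comp_eq_zero
  have h2 : (F.d i * F.d (i + 1)).mulVecLin = 0 := by
    rw [Matrix.mulVecLin_mul]
    exact LinearMap.ext fun x => congrFun h x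
  ext a c
  have := congrFun (LinearMap.congr_fun h2 (Pi.single c 1)) a
  rwa [Matrix.mulVecLin_apply, Matrix.mulVec_single_one] at this

theorem tensorD_tensorD (i : ℕ) (z : Fin (F.rank (i + 2)) → M) :
    F.tensorD M i (F.tensorD M (i + 1) z) = 0 := by
  ext a
  simp only [tensorD_apply, Finset.smul_sum, smul_smul, Pi.zero_apply]
  rw [Finset.sum_comm]
  simp_rw [← Finset.sum_smul]
  refine Finset.sum_eq_zero fun c _ => ?_
  have := congrFun (congrFun (F.d_mul_d i) a) c
  rw [Matrix.mul_apply] at this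
  rw [this]
  simp

theorem sum_smul_aug_d (c : Fin (F.rank 1)) : ∑ a, F.d 0 a c • F.aug a = 0 := by
  have h := congrFun F.exact_zero.comp_eq_zero (Pi.single c 1)
  simpa [Fintype.linearCombination_apply, Matrix.mulVec_single] using h

theorem tensorD_mem (hℳ : IsGradedSMul 𝒜 ℳ) {i : ℕ} {j : ℤ} {z : Fin (F.rank (i + 1)) → M}
    (hz : z ∈ F.tensorDegree ℳ (i + 1) j) : F.tensorD M i z ∈ F.tensorDegree ℳ i j := by
  rw [mem_tensorDegree] at hz ⊢
  intro a
  rw [tensorD_apply]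
  refine Submodule.sum_mem _ fun c _ => ?_
  have := hℳ.smul_mem (F.d_mem i a c) (hz c)
  rwa [show j - F.deg (i + 1) c + (F.deg (i + 1) c - F.deg i a) = j - F.deg i a by ring] at this

variable (ℳ) in
/-- `Tor_i^R(M, N)_j = 0`, in terms of cycles and boundaries. -/
def Vanishes (i : ℕ) (j : ℤ) : Prop := F.cycles ℳ i j ≤ F.boundaries ℳ i j

variable (ℳ) in
theorem subsingleton_tor_iff (i : ℕ) (j : ℤ) :
    Subsingleton (F.Tor ℳ i j) ↔ F.Vanishes ℳ i j :=
  subsingleton_quotient_submoduleOf_iff _ _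

variable (ℳ) in
/-- `z` is a cycle of `M ⊗ F`; every element in homological degree `0` is one. -/
def IsCycle : (i : ℕ) → (Fin (F.rank i) → M) → Prop
  | 0, _ => True
  | i + 1, z => F.tensorD M i z = 0

theorem mem_cycles {i : ℕ} {j : ℤ} {z : Fin (F.rank i) → M} :
    z ∈ F.cycles ℳ i j ↔ z ∈ F.tensorDegree ℳ i j ∧ F.IsCycle i z := by
  cases i with
  | zero => simp [cycles, IsCycle]
  | succ i => rfl

theorem vanishes_iff {i : ℕ} {j : ℤ} : F.Vanishes ℳ i j ↔
    ∀ z ∈ F.tensorDegree ℳ i j, F.IsCycle i z →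
      ∃ y ∈ F.tensorDegree ℳ (i + 1) j, F.tensorD M i y = z := by
  simp only [Vanishes, SetLike.le_def, mem_cycles, boundaries, Submodule.mem_map, and_imp]

theorem isCycle_tensorD (i : ℕ) (y : Fin (F.rank (i + 1)) → M) :
    F.IsCycle i (F.tensorD M i y) := by
  cases i with
  | zero => trivial
  | succ i => exact F.tensorD_tensorD i y

theorem IsCycle.sub {i : ℕ} {z w : Fin (F.rank i) → M} (hz : F.IsCycle i z)
    (hw : F.IsCycle i w) : F.IsCycle i (z - w) := by
  cases i with
  | zero => trivial
  | succ i =>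
    simp only [IsCycle] at hz hw ⊢
    rw [map_sub, hz, hw, sub_zero]

theorem vanishes_shift_iff {e : ℤ} {i : ℕ} {j : ℤ} :
    F.Vanishes (shift ℳ e) i j ↔ F.Vanishes ℳ i (j - e) := by
  have h : ∀ i, F.tensorDegree (shift ℳ e) i j = F.tensorDegree ℳ i (j - e) := by
    intro i
    ext z
    simp only [mem_tensorDegree, shift, sub_right_comm]
  simp only [vanishes_iff, h]

theorem vanishes_congr {ℳ' : ℤ → Submodule K M} (h : ∀ k, ℳ k = ℳ' k) {i : ℕ} {j : ℤ} :
    F.Vanishes ℳ i j ↔ F.Vanishes ℳ' i j := by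
  rw [funext h]

theorem vanishes_of_eq_bot (h : ∀ k, ℳ k = ⊥) (i : ℕ) (j : ℤ) : F.Vanishes ℳ i j := by
  rw [vanishes_iff]
  intro z hz _
  refine ⟨0, zero_mem _, ?_⟩
  rw [mem_tensorDegree] at hz
  ext a
  have := hz a
  rw [h, Submodule.mem_bot] at this
  simp [this]

end Basic

section Exact

variable {M' M M'' : Type*} [AddCommGroup M'] [AddCommGroup M] [AddCommGroup M'']
    [Module K M'] [Module K M] [Module K M''] [Module R M'] [Module R M] [Module R M'']
    [IsScalarTower K R M'] [IsScalarTower K R M] [IsScalarTower K R M'']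
    {ℳ' : ℤ → Submodule K M'} {ℳ : ℤ → Submodule K M} {ℳ'' : ℤ → Submodule K M''}
    {f : M' →ₗ[R] M} {g : M →ₗ[R] M''}

theorem tensorD_comp (f : M' →ₗ[R] M) (i : ℕ) (z : Fin (F.rank (i + 1)) → M') :
    F.tensorD M i (f ∘ z) = f ∘ F.tensorD M' i z := by
  ext a
  simp [tensorD_apply]

theorem IsCycle.map {i : ℕ} {z : Fin (F.rank i) → M'} (hz : F.IsCycle i z) (f : M' →ₗ[R] M) :
    F.IsCycle i (f ∘ z) := by
  cases i with
  | zero => trivial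
  | succ i =>
    simp only [IsCycle] at hz ⊢
    rw [tensorD_comp, hz]
    ext; simp

variable (E : GradedExact ℳ' ℳ ℳ'' f g)
include E

theorem lift_of_exact {i : ℕ} {j : ℤ} {z : Fin (F.rank i) → M} (hz : z ∈ F.tensorDegree ℳ i j)
    (hgz : g ∘ z = 0) : ∃ z' ∈ F.tensorDegree ℳ' i j, f ∘ z' = z := by
  rw [mem_tensorDegree] at hz
  choose z' hz' hfz' using fun a => E.exact (hz a) (congrFun hgz a)
  exact ⟨z', F.mem_tensorDegree.mpr hz', funext hfz'⟩

theorem lift_of_surjective {i : ℕ} {j : ℤ} {z : Fin (F.rank i) → M''}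
    (hz : z ∈ F.tensorDegree ℳ'' i j) : ∃ y ∈ F.tensorDegree ℳ i j, g ∘ y = z := by
  rw [mem_tensorDegree] at hz
  choose y hy hgy using fun a => E.surjective (hz a)
  exact ⟨y, F.mem_tensorDegree.mpr hy, funext hgy⟩

theorem eq_zero_of_map_eq_zero {i : ℕ} {j : ℤ} {z : Fin (F.rank i) → M'}
    (hz : z ∈ F.tensorDegree ℳ' i j) (hfz : f ∘ z = 0) : z = 0 := by
  rw [mem_tensorDegree] at hz
  exact funext fun a => E.injective (hz a) (congrFun hfz a)

theorem isCycle_of_map (hℳ' : IsGradedSMul 𝒜 ℳ') {i : ℕ} {j : ℤ} {z : Fin (F.rank i) → M'}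
    (hz : z ∈ F.tensorDegree ℳ' i j) (hfz : F.IsCycle i (f ∘ z)) : F.IsCycle i z := by
  cases i with
  | zero => trivial
  | succ i =>
    simp only [IsCycle] at hfz ⊢
    rw [tensorD_comp] at hfz
    exact F.eq_zero_of_map_eq_zero E (F.tensorD_mem hℳ' hz) hfz

theorem map_left_mem {i : ℕ} {j : ℤ} {z : Fin (F.rank i) → M'}
    (hz : z ∈ F.tensorDegree ℳ' i j) : f ∘ z ∈ F.tensorDegree ℳ i j := by
  rw [mem_tensorDegree] at hz ⊢
  exact fun a => E.map_left (hz a)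

theorem map_right_mem {i : ℕ} {j : ℤ} {z : Fin (F.rank i) → M}
    (hz : z ∈ F.tensorDegree ℳ i j) : g ∘ z ∈ F.tensorDegree ℳ'' i j := by
  rw [mem_tensorDegree] at hz ⊢
  exact fun a => E.map_right (hz a)

/-- Exactness of `Tor_i(M') → Tor_i(M) → Tor_i(M'')` at `Tor_i(M)`. -/
theorem vanishes_middle (hℳ : IsGradedSMul 𝒜 ℳ) (hℳ' : IsGradedSMul 𝒜 ℳ') {i : ℕ} {j : ℤ}
    (h' : F.Vanishes ℳ' i j) (h'' : F.Vanishes ℳ'' i j) : F.Vanishes ℳ i j := by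
  rw [vanishes_iff] at *
  intro z hz hcz
  obtain ⟨y'', hy'', hdy''⟩ := h'' (g ∘ z) (F.map_right_mem E hz) (hcz.map F g)
  obtain ⟨y, hy, rfl⟩ := F.lift_of_surjective E hy''
  obtain ⟨z', hz', hfz'⟩ := F.lift_of_exact E (sub_mem hz (F.tensorD_mem hℳ hy))
    (by rw [← sub_eq_zero.mpr hdy''.symm, tensorD_comp]; ext; simp)
  have hcz' : F.IsCycle i z' := F.isCycle_of_map E hℳ' hz' <| by
    rw [hfz']; exact hcz.sub F (F.isCycle_tensorD i y)
  obtain ⟨y', hy', rfl⟩ := h' z' hz' hcz'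
  refine ⟨y + f ∘ y', add_mem hy (F.map_left_mem E hy'), ?_⟩
  rw [map_add, tensorD_comp, hfz']
  abel

/-- Right exactness of the tensor product with `N`. -/
theorem vanishes_right_zero {j : ℤ} (h : F.Vanishes ℳ 0 j) : F.Vanishes ℳ'' 0 j := by
  rw [vanishes_iff] at *
  intro z'' hz'' _
  obtain ⟨z, hz, rfl⟩ := F.lift_of_surjective E hz''
  obtain ⟨y, hy, rfl⟩ := h z hz trivial
  exact ⟨g ∘ y, F.map_right_mem E hy, F.tensorD_comp g 0 y⟩

/-- Exactness of `Tor_{i+1}(M) → Tor_{i+1}(M'') → Tor_i(M')` at `Tor_{i+1}(M'')`. -/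
theorem vanishes_right_succ (hℳ : IsGradedSMul 𝒜 ℳ) (hℳ' : IsGradedSMul 𝒜 ℳ') {i : ℕ} {j : ℤ}
    (h : F.Vanishes ℳ (i + 1) j) (h' : F.Vanishes ℳ' i j) : F.Vanishes ℳ'' (i + 1) j := by
  rw [vanishes_iff] at *
  intro z'' hz'' hcz''
  obtain ⟨z, hz, rfl⟩ := F.lift_of_surjective E hz''
  obtain ⟨w', hw', hfw'⟩ := F.lift_of_exact E (F.tensorD_mem hℳ hz)
    (by rw [← tensorD_comp]; exact hcz'')
  have hcw' : F.IsCycle i w' := F.isCycle_of_map E hℳ' hw' <| by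
    rw [hfw']; exact F.isCycle_tensorD i z
  obtain ⟨y', hy', rfl⟩ := h' w' hw' hcw'
  obtain ⟨x, hx, hdx⟩ := h (z - f ∘ y') (sub_mem hz (F.map_left_mem E hy')) <| by
    simp only [IsCycle]
    rw [map_sub, tensorD_comp, hfw', sub_self]
  refine ⟨g ∘ x, F.map_right_mem E hx, ?_⟩
  rw [tensorD_comp, hdx]
  ext a
  simp [E.comp_eq_zero]

/-- Exactness of `Tor_{i+1}(M'') → Tor_i(M') → Tor_i(M)` at `Tor_i(M')`. -/
theorem vanishes_left (hℳ : IsGradedSMul 𝒜 ℳ) (hℳ' : IsGradedSMul 𝒜 ℳ') {i : ℕ} {j : ℤ}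
    (h : F.Vanishes ℳ i j) (h'' : F.Vanishes ℳ'' (i + 1) j) : F.Vanishes ℳ' i j := by
  rw [vanishes_iff] at *
  intro z' hz' hcz'
  obtain ⟨y, hy, hdy⟩ := h (f ∘ z') (F.map_left_mem E hz') (hcz'.map F f)
  obtain ⟨x'', hx'', hdx''⟩ := h'' (g ∘ y) (F.map_right_mem E hy) <| by
    simp only [IsCycle]
    rw [tensorD_comp, hdy]
    ext a
    simp [E.comp_eq_zero]
  obtain ⟨x, hx, rfl⟩ := F.lift_of_surjective E hx''
  obtain ⟨y', hy', hfy'⟩ := F.lift_of_exact E (sub_mem hy (F.tensorD_mem hℳ hx))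
    (by rw [← sub_eq_zero.mpr hdx''.symm, tensorD_comp]; ext; simp)
  refine ⟨y', hy', sub_eq_zero.mp ?_⟩
  refine F.eq_zero_of_map_eq_zero E (sub_mem (F.tensorD_mem hℳ' hy') hz') ?_
  have h1 := F.tensorD_comp f i y'
  rw [hfy', map_sub, tensorD_tensorD, sub_zero, hdy] at h1
  ext a
  simpa [sub_eq_zero] using (congrFun h1 a).symm

end Exact
end GradedFreeResolution

theorem torVanishes_iff {𝒜 : ℕ → Submodule K R} {M : Type*} [AddCommGroup M] [Module K M]
    [Module R M] [IsScalarTower K R M] {ℳ : ℤ → Submodule K M} {i : ℕ} {j : ℤ} :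
    TorVanishes 𝒜 ℳ i j ↔
      ∀ F : GradedFreeResolution 𝒜 (quotientGrading 𝒜 (maxIdeal 𝒜)), F.Vanishes ℳ i j :=
  forall_congr' fun F => F.subsingleton_tor_iff ℳ i j

/-! ### Tor of the algebra and of vector spaces -/

namespace GradedFreeResolution

variable {𝒜 : ℕ → Submodule K R}

section
variable {N : Type w} [AddCommGroup N] [Module K N] [Module R N]
  {𝒩 : ℤ → Submodule K N} (F : GradedFreeResolution 𝒜 𝒩)

theorem tensorD_self (i : ℕ) (z : Fin (F.rank (i + 1)) → R) :
    F.tensorD R i z = (F.d i).mulVecLin z := by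
  ext a
  simp [tensorD_apply, Matrix.mulVec, dotProduct]

theorem exists_homogeneous_preimage [GradedAlgebra 𝒜] {i : ℕ} {j : ℤ} {z : Fin (F.rank i) → R}
    (hz : z ∈ F.tensorDegree (selfGrading 𝒜) i j) {y : Fin (F.rank (i + 1)) → R}
    (hy : F.tensorD R i y = z) :
    ∃ y' ∈ F.tensorDegree (selfGrading 𝒜) (i + 1) j, F.tensorD R i y' = z := by
  refine ⟨fun c => intProj 𝒜 (j - F.deg (i + 1) c) (y c),
    F.mem_tensorDegree.mpr fun c => intProj_mem _ _, ?_⟩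
  ext a
  rw [← intProj_of_mem (F.mem_tensorDegree.mp hz a), ← hy, tensorD_apply, tensorD_apply, map_sum]
  refine Finset.sum_congr rfl fun c _ => ?_
  rw [smul_eq_mul, smul_eq_mul, intProj_mul_of_left_mem (F.d_mem i a c)]
  congr 3
  ring

end

variable (F : GradedFreeResolution 𝒜 (quotientGrading 𝒜 (maxIdeal 𝒜)))

/-- `Tor_i(R, K)` is `0` for `i > 0` and `K` in degree `0` for `i = 0`. -/
theorem vanishes_self [GradedAlgebra 𝒜] (i : ℕ) {s : ℤ} (hs : 0 < s) :
    F.Vanishes (selfGrading 𝒜) i (i + s) := by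
  rw [vanishes_iff]
  intro z hz hcz
  suffices ∃ y, F.tensorD R i y = z from this.elim fun y hy => F.exists_homogeneous_preimage hz hy
  simp only [tensorD_self]
  cases i with
  | zero =>
    refine (F.exact_zero z).mp ?_
    rw [Fintype.linearCombination_apply]
    refine Finset.sum_eq_zero fun a _ => ?_
    obtain ⟨b, hb, hab⟩ := F.aug_mem a
    rw [← hab]
    change Ideal.Quotient.mk (maxIdeal 𝒜) (z a * b) = 0
    rw [Ideal.Quotient.eq_zero_iff_mem]
    have hm := selfGrading_mul_mem (F.mem_tensorDegree.mp hz a) hb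
    rw [show ((0 : ℕ) : ℤ) + s - F.deg 0 a + F.deg 0 a = s by push_cast; ring] at hm
    exact mem_maxIdeal_of_mem_selfGrading hs.ne' hm
  | succ i =>
    refine (F.exact_succ i z).mp ?_
    rw [← tensorD_self]
    exact hcz

/-- A graded module concentrated in a single degree `j` and killed by `𝔪` is a direct sum of
copies of `K(-j)`, so the vanishing of its Tor reduces to that of `Tor(K, K)`. -/
theorem vanishes_of_concentrated (h𝒜 : IsPositivelyGraded 𝒜) {M : Type*} [AddCommGroup M]
    [Module K M] [Module R M] [IsScalarTower K R M] {ℳ : ℤ → Submodule K M}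
    (hℳ : IsGradedSMul 𝒜 ℳ) {j : ℤ} (hbot : ∀ k, k ≠ j → ℳ k = ⊥)
    (hkill : ∀ a ∈ maxIdeal 𝒜, ∀ m ∈ ℳ j, a • m = 0) {i : ℕ} {l : ℤ}
    (hK : F.Vanishes (quotientGrading 𝒜 (maxIdeal 𝒜)) i (l - j)) : F.Vanishes ℳ i l := by
  classical
  let _ := h𝒜.gradedAlgebra
  -- `δ a` is the residue class of `a` in `K = R ⧸ 𝔪`
  have hres : ∀ a : R, ∃ c : K, a - algebraMap K R c ∈ maxIdeal 𝒜 := by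
    intro a
    induction a using DirectSum.Decomposition.inductionOn 𝒜 with
    | zero => exact ⟨0, by simp⟩
    | @homogeneous n m =>
      obtain ⟨m, hm⟩ := m
      rcases Nat.eq_zero_or_pos n with rfl | hn
      · obtain ⟨c, hc⟩ := Submodule.mem_one.mp (h𝒜.zero_eq ▸ hm)
        exact ⟨c, by simp [hc]⟩
      · exact ⟨0, by simpa using mem_maxIdeal_of_mem hn hm⟩
    | add m m' h h' =>
      obtain ⟨c, hc⟩ := h
      obtain ⟨c', hc'⟩ := h'
      refine ⟨c + c', ?_⟩
      rw [map_add, add_sub_add_comm]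
      exact add_mem hc hc'
  choose δ hδ using hres
  have hδsmul : ∀ a : R, ∀ m ∈ ℳ j, a • m = δ a • m := by
    intro a m hm
    rw [← sub_eq_zero, ← algebraMap_smul R (δ a) m, ← sub_smul]
    exact hkill _ (hδ a) m hm
  have hδmk : ∀ a : R, Ideal.Quotient.mk (maxIdeal 𝒜) a
      = algebraMap K (R ⧸ maxIdeal 𝒜) (δ a) := by
    intro a
    exact (Ideal.Quotient.eq).mpr (hδ a)
  have hmem_of : ∀ {k : ℤ} {m : M}, m ∈ ℳ k → m ∈ ℳ j := by
    intro k m hm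
    by_cases h : k = j
    · rwa [h] at hm
    · rw [hbot k h, Submodule.mem_bot] at hm
      rw [hm]; exact zero_mem _
  rw [vanishes_iff] at hK ⊢
  intro z hz hcz
  rw [mem_tensorDegree] at hz
  let b := Module.Basis.ofVectorSpace K (ℳ j)
  let zV : Fin (F.rank i) → ℳ j := fun a => ⟨z a, hmem_of (hz a)⟩
  let w := fun β (a : Fin (F.rank i)) => algebraMap K (R ⧸ maxIdeal 𝒜) (b.repr (zV a) β)
  have hw : ∀ β, w β ∈ F.tensorDegree (quotientGrading 𝒜 (maxIdeal 𝒜)) i (l - j) := by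
    intro β
    rw [mem_tensorDegree]
    intro a
    by_cases h : l - F.deg i a = j
    · rw [show l - j - F.deg i a = ((0 : ℕ) : ℤ) by push_cast; omega]
      exact ⟨algebraMap K R (b.repr (zV a) β), SetLike.algebraMap_mem_graded 𝒜 _, rfl⟩
    · have h0 : zV a = 0 := by
        have := hz a
        rw [hbot _ h, Submodule.mem_bot] at this
        exact Subtype.ext this
      simp [w, h0]
  have hcw : ∀ β, F.IsCycle i (w β) := by
    intro β
    cases i with
    | zero => trivial
    | succ i =>
      ext a
      have h1 : ∑ c, δ (F.d i a c) • zV c = 0 := by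
        have h2 := congrFun hcz a
        rw [tensorD_apply] at h2
        apply Subtype.ext
        rw [Submodule.coe_zero, ← Pi.zero_apply (M := fun _ => M) a, ← h2, Submodule.coe_sum]
        exact Finset.sum_congr rfl fun c _ => (hδsmul _ _ (zV c).2).symm
      have h3 := congrArg (fun v => algebraMap K (R ⧸ maxIdeal 𝒜) (b.repr v β)) h1
      simp only [map_sum, map_smul, Finsupp.coe_finsetSum, Finset.sum_apply, Finsupp.smul_apply,
        smul_eq_mul, map_mul, map_zero, Finsupp.coe_zero, Pi.zero_apply, ← hδmk] at h3
      rw [tensorD_apply]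
      exact h3
  choose y hy hdy using fun β => hK (w β) (hw β) (hcw β)
  let φ := fun β => (maxIdeal 𝒜).liftQ (LinearMap.toSpanSingleton R M (b β : M))
    (fun a ha => hkill a ha _ (b β).2)
  have hφ : ∀ β (c : K), φ β (algebraMap K (R ⧸ maxIdeal 𝒜) c) = c • (b β : M) := by
    intro β c
    exact algebraMap_smul R c (b β : M)
  let S := Finset.univ.biUnion fun a => (b.repr (zV a)).support
  refine ⟨∑ β ∈ S, φ β ∘ y β, ?_, ?_⟩
  · refine Submodule.sum_mem _ fun β _ => ?_
    rw [mem_tensorDegree]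
    intro c
    obtain ⟨r, hr, hrc⟩ := F.mem_tensorDegree.mp (hy β) c
    rw [Function.comp_apply, ← hrc]
    change r • (b β : M) ∈ _
    have := hℳ.smul_mem hr (b β).2
    rwa [show j + (l - j - F.deg (i + 1) c) = l - F.deg (i + 1) c by ring] at this
  · rw [map_sum]
    simp_rw [tensorD_comp, hdy]
    ext a
    rw [Finset.sum_apply]
    simp only [Function.comp_apply, w, hφ]
    have h1 := b.linearCombination_repr (zV a)
    rw [Finsupp.linearCombination_apply, Finsupp.sum_of_support_subset (s := S) _
      (Finset.subset_biUnion_of_mem (fun a => (b.repr (zV a)).support) (Finset.mem_univ a)) _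
      (by simp)] at h1
    have h2 := congrArg (Subtype.val) h1
    rwa [Submodule.coe_sum] at h2

variable {F} in
/-- Some basis element of `F_0` maps to a nonzero element of `K`; it has degree `0`. -/
theorem exists_aug_ne_zero (h𝒜 : IsPositivelyGraded 𝒜) :
    ∃ a, F.aug a ≠ 0 ∧ F.deg 0 a = 0 := by
  let _ := h𝒜.gradedAlgebra
  have := h𝒜.nontrivial
  have hne : ∃ a, F.aug a ≠ 0 := by
    by_contra! h0
    obtain ⟨v, hv⟩ := F.aug_surjective (Ideal.Quotient.mk (maxIdeal 𝒜) 1)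
    rw [Fintype.linearCombination_apply] at hv
    simp only [h0, smul_zero, Finset.sum_const_zero] at hv
    have h1 := (Ideal.Quotient.eq_zero_iff_mem).mp hv.symm
    rw [← pow_one (maxIdeal 𝒜)] at h1
    have h2 := intProj_eq_zero_of_mem_maxIdeal_pow h1 0 (by norm_num)
    rw [intProj_of_mem (show (1 : R) ∈ selfGrading 𝒜 0 from
      SetLike.one_mem_graded 𝒜)] at h2
    exact one_ne_zero h2
  obtain ⟨a, ha⟩ := hne
  refine ⟨a, ha, ?_⟩
  by_contra hdeg
  obtain ⟨r, hr, hra⟩ := F.aug_mem a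
  apply ha
  rw [← hra]
  change Ideal.Quotient.mk (maxIdeal 𝒜) r = 0
  rw [Ideal.Quotient.eq_zero_iff_mem]
  exact mem_maxIdeal_of_mem_selfGrading hdeg hr

/-- `Tor_0(𝔪 ^ j, K)_j` is `(𝔪 ^ j ⧸ 𝔪 ^ (j+1))_j = R_j`, so it is nonzero if `R_j` is. -/
theorem not_vanishes_zero (h𝒜 : IsPositivelyGraded 𝒜) {j : ℕ} {x : R} (hx : x ∈ 𝒜 j)
    (hxm : x ∈ maxIdeal 𝒜 ^ j) (hx0 : x ≠ 0) :
    ¬ F.Vanishes (idealGrading 𝒜 (maxIdeal 𝒜 ^ j)) 0 j := by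
  classical
  let _ := h𝒜.gradedAlgebra
  intro hvan
  obtain ⟨a, ha, hdeg⟩ := exists_aug_ne_zero (F := F) h𝒜
  obtain ⟨y, -, hdy⟩ := F.vanishes_iff.mp hvan (Pi.single a ⟨x, hxm⟩) (by
    rw [mem_tensorDegree]
    intro a'
    by_cases h : a' = a
    · subst h
      rw [Pi.single_eq_same, hdeg, sub_zero]
      exact hx
    · rw [Pi.single_eq_of_ne h]
      exact zero_mem _) trivial
  choose u hu using fun a => Ideal.Quotient.mk_surjective (F.aug a)
  have hud : ∀ c, ∑ a, u a * F.d 0 a c ∈ maxIdeal 𝒜 := by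
    intro c
    rw [← Ideal.Quotient.eq_zero_iff_mem, map_sum, ← F.sum_smul_aug_d c]
    refine Finset.sum_congr rfl fun a _ => ?_
    rw [← hu a, mul_comm]
    rfl
  have h1 : u a * x ∈ maxIdeal 𝒜 ^ (j + 1) := by
    have h2 : u a * x = ∑ c, (∑ a, u a * F.d 0 a c) * (y c : R) := by
      have h3 : ∀ a', ((F.tensorD _ 0 y a' : ↥(maxIdeal 𝒜 ^ j)) : R)
          = ∑ c, F.d 0 a' c * (y c : R) := by
        intro a'
        rw [tensorD_apply, Submodule.coe_sum]
        rfl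
      simp_rw [Finset.sum_mul, mul_assoc]
      rw [Finset.sum_comm]
      simp_rw [← Finset.mul_sum, ← h3, hdy]
      rw [Finset.sum_eq_single a]
      · rw [Pi.single_eq_same]
      · intro b _ hb
        rw [Pi.single_eq_of_ne hb, Submodule.coe_zero, mul_zero]
      · simp
    rw [h2, pow_succ']
    exact Ideal.sum_mem _ fun c _ => Ideal.mul_mem_mul (hud c) (y c).2
  -- `u a` may be replaced by its component of degree `0`, a nonzero scalar
  have h4 := intProj_eq_zero_of_mem_maxIdeal_pow h1 j (by push_cast; omega)
  rw [mul_comm, intProj_mul_of_left_mem (k := j) hx, sub_self] at h4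
  have h5 := intProj_mem (𝒜 := 𝒜) ((0 : ℕ) : ℤ) (u a)
  rw [selfGrading_natCast, h𝒜.zero_eq, Submodule.mem_one] at h5
  obtain ⟨c, hc⟩ := h5
  rw [← Nat.cast_zero, ← hc, mul_comm, ← Algebra.smul_def] at h4
  have hc0 : c = 0 := by
    by_contra hc0
    exact hx0 ((smul_eq_zero_iff_right hc0).mp h4)
  obtain ⟨r, hr, hra⟩ := F.aug_mem a
  rw [hdeg] at hr
  have h6 : Ideal.Quotient.mk (maxIdeal 𝒜) (u a) = Ideal.Quotient.mk (maxIdeal 𝒜) r :=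
    (hu a).trans hra.symm
  have h7 := (Ideal.Quotient.eq).mp h6
  rw [← pow_one (maxIdeal 𝒜)] at h7
  have h8 := intProj_eq_zero_of_mem_maxIdeal_pow h7 0 (by norm_num)
  rw [map_sub, intProj_of_mem hr, ← Nat.cast_zero, ← hc, hc0, map_zero, zero_sub,
    neg_eq_zero] at h8
  apply ha
  rw [← hra, h8, map_zero]

end GradedFreeResolution

namespace IsKoszul

variable {𝒜 : ℕ → Submodule K R} (h : IsKoszul 𝒜)
include h

theorem vanishes_residueField (F : GradedFreeResolution 𝒜 (quotientGrading 𝒜 (maxIdeal 𝒜)))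
    (i : ℕ) {s : ℤ} (hs : 0 < s) : F.Vanishes (quotientGrading 𝒜 (maxIdeal 𝒜)) i (i + s) := by
  have h0 : intInf {r : ℤ | ∀ (i : ℕ) (s : ℤ), r < s →
      TorVanishes 𝒜 (quotientGrading 𝒜 (maxIdeal 𝒜)) i (i + s)} ≤ (((0 : ℤ) : ℝ) : EReal) := by
    refine (le_of_eq h.regT_eq_zero).trans ?_
    simp
  rw [intInf_le_intCast_iff (isUpperSet_setOf_forall_lt _)] at h0
  exact torVanishes_iff.mp (h0 i s hs) F

/-- A resolution of `K` exists: otherwise all `r` would be admissible and `reg^T(K) = -∞`. -/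
theorem nonempty_resolution :
    Nonempty (GradedFreeResolution 𝒜 (quotientGrading 𝒜 (maxIdeal 𝒜))) := by
  by_contra hne
  rw [not_nonempty_iff] at hne
  have h0 : intInf {r : ℤ | ∀ (i : ℕ) (s : ℤ), r < s →
      TorVanishes 𝒜 (quotientGrading 𝒜 (maxIdeal 𝒜)) i (i + s)}
        ≤ (((-1 : ℤ) : ℝ) : EReal) := by
    rw [intInf_le_intCast_iff (isUpperSet_setOf_forall_lt _)]
    exact fun i s _ F => hne.elim F
  have h1 : regT 𝒜 (quotientGrading 𝒜 (maxIdeal 𝒜)) ≤ (((-1 : ℤ) : ℝ) : EReal) := h0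
  rw [h.regT_eq_zero] at h1
  have h2 : (0 : ℤ) ≤ -1 := by exact_mod_cast h1
  omega

theorem vanishes_maxIdeal_pow (F : GradedFreeResolution 𝒜 (quotientGrading 𝒜 (maxIdeal 𝒜)))
    (j : ℕ) : ∀ (i : ℕ) (s : ℤ), j < s →
      F.Vanishes (idealGrading 𝒜 (maxIdeal 𝒜 ^ j)) i (i + s) := by
  classical
  let _ := h.gradedAlgebra
  induction j with
  | zero =>
    intro i s hs
    have E : GradedExact (idealGrading 𝒜 (maxIdeal 𝒜 ^ 0)) (selfGrading 𝒜)
        (fun _ => (⊥ : Submodule K PUnit)) (maxIdeal 𝒜 ^ 0).subtype (0 : R →ₗ[R] PUnit) :=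
      { map_left := fun hm => hm
        map_right := fun _ => zero_mem _
        injective := fun _ h0 => Subtype.ext h0
        comp_eq_zero := fun _ => rfl
        exact := fun {k m} hm _ => ⟨⟨m, by simp⟩, hm, rfl⟩
        surjective := fun _ => ⟨0, zero_mem _, rfl⟩ }
    exact F.vanishes_left E (isGradedSMul_selfGrading 𝒜) (isGradedSMul_idealGrading 𝒜 _)
      (F.vanishes_self i (by exact_mod_cast hs)) (F.vanishes_of_eq_bot (fun _ => rfl) _ _)
  | succ j ih =>
    intro i s hs
    push_cast at hs
    -- `𝔪 ^ j ⧸ 𝔪 ^ (j+1)`, the component of degree `j` of `R ⧸ 𝔪 ^ (j+1)`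
    let 𝒬 : ℤ → Submodule K (R ⧸ maxIdeal 𝒜 ^ (j + 1)) := fun k =>
      if k = j then quotientGrading 𝒜 (maxIdeal 𝒜 ^ (j + 1)) k else ⊥
    have h𝒬 : IsGradedSMul 𝒜 𝒬 := by
      intro e k a m ha hm
      by_cases hk : k = j
      · rcases Nat.eq_zero_or_pos e with rfl | he
        · have := isGradedSMul_quotientGrading 𝒜 (maxIdeal 𝒜 ^ (j + 1)) ha
            (show m ∈ quotientGrading 𝒜 _ k by simpa [𝒬, hk] using hm)
          simpa [𝒬, hk] using this
        · have h0 : a • m = 0 := by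
            have hm' : m ∈ quotientGrading 𝒜 (maxIdeal 𝒜 ^ (j + 1)) k := by
              simpa [𝒬, hk] using hm
            obtain ⟨r, hr, rfl⟩ := hm'
            rw [hk, selfGrading_natCast] at hr
            change Ideal.Quotient.mk _ (a * r) = 0
            rw [Ideal.Quotient.eq_zero_iff_mem]
            exact h.mem_maxIdeal_pow (k := e + j) (by omega) (SetLike.mul_mem_graded ha hr)
          rw [h0]
          exact zero_mem _
      · have h0 : m = 0 := by simpa [𝒬, hk] using hm
        rw [h0, smul_zero]
        exact zero_mem _
    have E : GradedExact (idealGrading 𝒜 (maxIdeal 𝒜 ^ (j + 1)))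
        (idealGrading 𝒜 (maxIdeal 𝒜 ^ j)) 𝒬
        (Submodule.inclusion (Ideal.pow_le_pow_right j.le_succ))
        ((maxIdeal 𝒜 ^ (j + 1)).mkQ ∘ₗ (maxIdeal 𝒜 ^ j).subtype) :=
      { map_left := fun hm => hm
        map_right := by
          intro k m hm
          by_cases hk : k = j
          · simp only [𝒬, if_pos hk]
            exact ⟨m, hm, rfl⟩
          · have h0 : (m : R) ∈ maxIdeal 𝒜 ^ (j + 1) := by
              rcases lt_or_gt_of_ne hk with hk | hk
              · rw [eq_zero_of_mem_maxIdeal_pow hk m.2 hm]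
                exact zero_mem _
              · lift k to ℕ using (by omega)
                exact h.mem_maxIdeal_pow (by omega) hm
            rw [LinearMap.comp_apply, Submodule.mkQ_apply, Submodule.subtype_apply,
              (Submodule.Quotient.mk_eq_zero _).mpr h0]
            exact zero_mem _
        injective := fun _ h0 => Subtype.ext (by simpa using congrArg Subtype.val h0)
        comp_eq_zero := fun m => (Submodule.Quotient.mk_eq_zero _).mpr m.2
        exact := fun {k m} hm h0 =>
          ⟨⟨m, (Submodule.Quotient.mk_eq_zero _).mp h0⟩, hm, Subtype.ext rfl⟩
        surjective := by
          intro k m hm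
          by_cases hk : k = j
          · simp only [𝒬, if_pos hk] at hm
            obtain ⟨r, hr, rfl⟩ := hm
            subst hk
            exact ⟨⟨r, h.mem_maxIdeal_pow le_rfl hr⟩, hr, rfl⟩
          · simp only [𝒬, if_neg hk, Submodule.mem_bot] at hm
            exact ⟨0, zero_mem _, by rw [map_zero, hm]⟩ }
    refine F.vanishes_left E (isGradedSMul_idealGrading 𝒜 _) (isGradedSMul_idealGrading 𝒜 _)
      (ih i s (by omega)) ?_
    refine F.vanishes_of_concentrated h.toIsPositivelyGraded h𝒬 (j := j)
      (fun k hk => if_neg hk) ?_ ?_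
    · intro a ha m hm
      simp only [𝒬, if_true] at hm
      obtain ⟨r, hr, rfl⟩ := hm
      change Ideal.Quotient.mk _ (a * r) = 0
      rw [Ideal.Quotient.eq_zero_iff_mem, pow_succ']
      exact Ideal.mul_mem_mul ha (h.mem_maxIdeal_pow le_rfl hr)
    · have := h.vanishes_residueField F (i + 1) (s := s - 1 - j) (by omega)
      rwa [show ((i + 1 : ℕ) : ℤ) + (s - 1 - j) = i + s - j by push_cast; ring] at this

/-- The Tor-regularity of `𝔪 ^ j` over a Koszul algebra of positive depth. -/
theorem regT_maxIdeal_pow (hdepth : 0 < depth 𝒜) (j : ℕ) :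
    regT 𝒜 (idealGrading 𝒜 (maxIdeal 𝒜 ^ j)) = j := by
  obtain ⟨a, ha, hreg⟩ := exists_regular_of_depth_pos hdepth
  obtain ⟨x, hx, hx0⟩ := h.exists_ne_zero ha hreg j
  obtain ⟨F⟩ := h.nonempty_resolution
  have hcast : (j : EReal) = (((j : ℤ) : ℝ) : EReal) := by norm_cast
  rw [hcast]
  apply le_antisymm
  · refine (intInf_le_intCast_iff (isUpperSet_setOf_forall_lt _) _).mpr fun i s hs => ?_
    exact torVanishes_iff.mpr fun F => h.vanishes_maxIdeal_pow F j i s hs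
  · refine le_intInf_iff.mpr fun n hn => ?_
    by_contra! hlt
    have hlt' : n < j := by exact_mod_cast hlt
    refine F.not_vanishes_zero h.toIsPositivelyGraded hx (h.mem_maxIdeal_pow le_rfl hx) hx0 ?_
    have := torVanishes_iff.mp (hn 0 j hlt') F
    rwa [Nat.cast_zero, zero_add] at this

end IsKoszul

end Tor

section LocalCohomology

variable {K : Type u} [Field K] {R : Type v} [CommRing R] [Algebra K R]

/-! ### Graded localizations -/

namespace HomogeneousSystem

variable {𝒜 : ℕ → Submodule K R} (X : HomogeneousSystem 𝒜)

theorem exists_mem_of_mem_mult [SetLike.GradedMonoid 𝒜] {T : Finset (Fin X.n)} {s : R}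
    (hs : s ∈ X.mult T) : ∃ e, s ∈ 𝒜 e := by
  induction hs using Submonoid.closure_induction with
  | mem x hx =>
    obtain ⟨t, -, rfl⟩ := hx
    obtain ⟨e, -, he⟩ := X.homogeneous t
    exact ⟨e, he⟩
  | one => exact ⟨0, SetLike.one_mem_graded 𝒜⟩
  | mul x y _ _ hx hy =>
    obtain ⟨e, he⟩ := hx
    obtain ⟨e', he'⟩ := hy
    exact ⟨e + e', SetLike.mul_mem_graded he he'⟩

theorem x_mem_mult {T : Finset (Fin X.n)} {t : Fin X.n} (ht : t ∈ T) : X.x t ∈ X.mult T :=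
  Submonoid.subset_closure ⟨t, ht, rfl⟩

theorem exists_pow_mul_of_mem_mult_insert {S : Finset (Fin X.n)} {t : Fin X.n} {s : R}
    (hs : s ∈ X.mult (insert t S)) : ∃ a, ∃ s' ∈ X.mult S, s = X.x t ^ a * s' := by
  rw [mult, Finset.coe_insert, Set.image_insert_eq, Set.insert_eq, Submonoid.closure_union,
    Submonoid.mem_sup] at hs
  obtain ⟨y, hy, z, hz, rfl⟩ := hs
  obtain ⟨a, rfl⟩ := Submonoid.mem_closure_singleton.mp hy
  exact ⟨a, z, hz, rfl⟩

theorem eq_one_of_mem_mult_empty {s : R} (hs : s ∈ X.mult ∅) : s = 1 := by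
  simpa [mult] using hs

theorem x_mem_maxIdeal (t : Fin X.n) : X.x t ∈ maxIdeal 𝒜 := by
  obtain ⟨e, he, hx⟩ := X.homogeneous t
  exact mem_maxIdeal_of_mem he hx

section Module

variable {M : Type*} [AddCommGroup M] [Module K M] [Module R M] [IsScalarTower K R M]
  {ℳ : ℤ → Submodule K M}

theorem mem_localizedDegree_iff [SetLike.GradedMonoid 𝒜] (hℳ : IsGradedSMul 𝒜 ℳ)
    {U : Submonoid R} {j : ℤ} {z : LocalizedModule U M} : z ∈ localizedDegree 𝒜 ℳ U j ↔
      ∃ (e : ℕ) (s : U) (m : M), (s : R) ∈ 𝒜 e ∧ m ∈ ℳ (j + e) ∧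
        z = LocalizedModule.mk m s := by
  refine ⟨fun hz => ?_, fun hz => Submodule.subset_span hz⟩
  induction hz using Submodule.span_induction with
  | mem z hz => exact hz
  | zero =>
    exact ⟨0, 1, 0, SetLike.one_mem_graded 𝒜, zero_mem _, (LocalizedModule.zero_mk 1).symm⟩
  | add z w _ _ hz hw =>
    obtain ⟨e, s, m, hs, hm, rfl⟩ := hz
    obtain ⟨e', s', m', hs', hm', rfl⟩ := hw
    refine ⟨e + e', s * s', s' • m + s • m', SetLike.mul_mem_graded hs hs', ?_,
      LocalizedModule.mk_add_mk⟩
    have h1 := hℳ hs' hm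
    have h2 := hℳ hs hm'
    rw [show j + e + e' = j + ((e + e' : ℕ) : ℤ) by push_cast; ring] at h1
    rw [show j + e' + e = j + ((e + e' : ℕ) : ℤ) by push_cast; ring] at h2
    exact add_mem h1 h2
  | smul c z _ hz =>
    obtain ⟨e, s, m, hs, hm, rfl⟩ := hz
    refine ⟨e, s, c • m, hs, Submodule.smul_mem _ _ hm, ?_⟩
    rw [← algebraMap_smul R c m, ← algebraMap_smul R c (LocalizedModule.mk m s),
      LocalizedModule.smul'_mk]

theorem localizedDegree_smul_mem [SetLike.GradedMonoid 𝒜] (hℳ : IsGradedSMul 𝒜 ℳ)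
    {U : Submonoid R} : IsGradedSMul 𝒜 (localizedDegree 𝒜 ℳ U) := by
  intro e j a z ha hz
  rw [mem_localizedDegree_iff hℳ] at hz ⊢
  obtain ⟨e', s, m, hs, hm, rfl⟩ := hz
  refine ⟨e', s, a • m, hs, ?_, LocalizedModule.smul'_mk _ _ _⟩
  have := hℳ ha hm
  rwa [add_right_comm] at this

theorem localizedDegree_shift (e : ℤ) (U : Submonoid R) (j : ℤ) :
    localizedDegree 𝒜 (shift ℳ e) U j = localizedDegree 𝒜 ℳ U (j - e) := by
  simp only [localizedDegree, shift, add_sub_right_comm]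

theorem res_mk {S T : Finset (Fin X.n)} (h : S ⊆ T) (m : M) (s : X.mult S) :
    X.res M h (LocalizedModule.mk m s) = LocalizedModule.mk m ⟨s.1, X.mult_mono h s.2⟩ := by
  rw [IsLocalizedModule.mk_eq_mk', IsLocalizedModule.mk_eq_mk']
  exact IsLocalizedModule.liftOfLE_mk' _ _ _ _ _ _ _

theorem res_res {S T U : Finset (Fin X.n)} (h : S ⊆ T) (h' : T ⊆ U)
    (z : LocalizedModule (X.mult S) M) :
    X.res M h' (X.res M h z) = X.res M (h.trans h') z := by
  induction z using LocalizedModule.induction_on with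
  | h m s => simp only [res_mk]

theorem res_refl {S : Finset (Fin X.n)} (h : S ⊆ S) (z : LocalizedModule (X.mult S) M) :
    X.res M h z = z := by
  induction z using LocalizedModule.induction_on with
  | h m s => simp only [res_mk]

theorem res_mem [SetLike.GradedMonoid 𝒜] (hℳ : IsGradedSMul 𝒜 ℳ) {S T : Finset (Fin X.n)}
    (h : S ⊆ T) {j : ℤ} {z : LocalizedModule (X.mult S) M}
    (hz : z ∈ localizedDegree 𝒜 ℳ (X.mult S) j) :
    X.res M h z ∈ localizedDegree 𝒜 ℳ (X.mult T) j := by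
  rw [mem_localizedDegree_iff hℳ] at hz ⊢
  obtain ⟨e, s, m, hs, hm, rfl⟩ := hz
  exact ⟨e, _, m, hs, hm, X.res_mk h m s⟩

theorem exists_pow_smul_eq_zero {S : Finset (Fin X.n)} {t : Fin X.n}
    {z : LocalizedModule (X.mult S) M} (hz : X.res M (Finset.subset_insert t S) z = 0) :
    ∃ N₀, ∀ N, N₀ ≤ N → X.x t ^ N • z = 0 := by
  induction z using LocalizedModule.induction_on with
  | h m s =>
    rw [res_mk, ← LocalizedModule.zero_mk ⟨s.1, X.mult_mono (Finset.subset_insert t S) s.2⟩,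
      LocalizedModule.mk_eq] at hz
    obtain ⟨⟨v, hv⟩, hvm⟩ := hz
    obtain ⟨a, s', hs', rfl⟩ := X.exists_pow_mul_of_mem_mult_insert hv
    refine ⟨a, fun N hN => ?_⟩
    obtain ⟨b, rfl⟩ := Nat.exists_eq_add_of_le hN
    rw [LocalizedModule.smul'_mk, ← LocalizedModule.zero_mk s, LocalizedModule.mk_eq]
    refine ⟨⟨s', hs'⟩, ?_⟩
    simp only [smul_zero, Submonoid.smul_def, smul_smul] at hvm ⊢
    have := congrArg (fun w => X.x t ^ b • w) hvm
    simp only [smul_smul, smul_zero] at this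
    rw [← this]
    congr 1
    ring

theorem exists_pow_smul_eq_res [GradedAlgebra 𝒜] (hℳ : IsGradedSMul 𝒜 ℳ)
    {S : Finset (Fin X.n)} {t : Fin X.n} {e : ℕ} (ht : X.x t ∈ 𝒜 e) {j : ℤ}
    {z : LocalizedModule (X.mult (insert t S)) M}
    (hz : z ∈ localizedDegree 𝒜 ℳ (X.mult (insert t S)) j) :
    ∃ N₀, ∀ N, N₀ ≤ N → ∃ y ∈ localizedDegree 𝒜 ℳ (X.mult S) (j + (N * e : ℕ)),
      X.x t ^ N • z = X.res M (Finset.subset_insert t S) y := by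
  rw [mem_localizedDegree_iff hℳ] at hz
  obtain ⟨e₁, ⟨s, hs⟩, m, hse, hm, rfl⟩ := hz
  obtain ⟨a, s', hs', rfl⟩ := X.exists_pow_mul_of_mem_mult_insert hs
  by_cases h0 : X.x t ^ a * s' = 0
  · -- inverting `0` gives the zero module
    refine ⟨0, fun N _ => ⟨0, zero_mem _, ?_⟩⟩
    have : Subsingleton (LocalizedModule (X.mult (insert t S)) M) :=
      LocalizedModule.subsingleton (h0 ▸ hs)
    exact Subsingleton.elim _ _
  · obtain ⟨e₂, he₂⟩ := X.exists_mem_of_mem_mult hs'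
    have hdeg : a * e + e₂ = e₁ := by
      refine DirectSum.degree_eq_of_mem_mem 𝒜 ?_ hse h0
      exact SetLike.mul_mem_graded (SetLike.pow_mem_graded a ht) he₂
    refine ⟨a, fun N hN => ?_⟩
    obtain ⟨b, rfl⟩ := Nat.exists_eq_add_of_le hN
    refine ⟨LocalizedModule.mk (X.x t ^ b • m) ⟨s', hs'⟩, ?_, ?_⟩
    · rw [mem_localizedDegree_iff hℳ]
      refine ⟨e₂, _, _, he₂, ?_, rfl⟩
      have := hℳ (SetLike.pow_mem_graded b ht) hm
      rwa [show j + e₁ + ((b • e : ℕ) : ℤ) = j + (((a + b) * e : ℕ) : ℤ) + e₂ by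
        rw [← hdeg, smul_eq_mul]; push_cast; ring] at this
    · rw [res_mk, LocalizedModule.smul'_mk, LocalizedModule.mk_eq]
      refine ⟨1, ?_⟩
      simp only [one_smul, Submonoid.smul_def, smul_smul]
      congr 1
      ring

theorem exists_eq_mk_one [GradedAlgebra 𝒜] [Nontrivial R] (hℳ : IsGradedSMul 𝒜 ℳ) {j : ℤ}
    {z : LocalizedModule (X.mult ∅) M} (hz : z ∈ localizedDegree 𝒜 ℳ (X.mult ∅) j) :
    ∃ m ∈ ℳ j, z = LocalizedModule.mk m 1 := by
  rw [mem_localizedDegree_iff hℳ] at hz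
  obtain ⟨e, ⟨s, hs⟩, m, hse, hm, rfl⟩ := hz
  obtain rfl := X.eq_one_of_mem_mult_empty hs
  have he : e = 0 :=
    DirectSum.degree_eq_of_mem_mem 𝒜 hse (SetLike.one_mem_graded 𝒜) one_ne_zero
  subst he
  exact ⟨m, by simpa using hm, rfl⟩

theorem mk_empty_eq_zero_iff {m : M} {s : X.mult ∅} :
    (LocalizedModule.mk m s : LocalizedModule (X.mult ∅) M) = 0 ↔ m = 0 := by
  refine ⟨fun h => ?_, fun h => by rw [h, LocalizedModule.zero_mk]⟩
  rw [← LocalizedModule.zero_mk s, LocalizedModule.mk_eq] at h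
  obtain ⟨⟨v, hv⟩, h⟩ := h
  obtain ⟨s, hs⟩ := s
  obtain rfl := X.eq_one_of_mem_mult_empty hs
  obtain rfl := X.eq_one_of_mem_mult_empty hv
  simpa [Submonoid.smul_def] using h

/-! ### The Čech complex -/

/-- The sign `(-1)^{#{s ∈ T : s < t}}`. -/
def sign {n : ℕ} (R : Type v) [CommRing R] (t : Fin n) (T : Finset (Fin n)) : R :=
  (-1) ^ (T.filter (· < t)).card

section Sign

variable {n : ℕ} {t u : Fin n} {T : Finset (Fin n)}

theorem sign_mul_self (t : Fin n) (T : Finset (Fin n)) : sign R t T * sign R t T = 1 := by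
  rw [sign, ← mul_pow]
  simp

theorem sign_erase_of_lt (h : t < u) (ht : t ∈ T) : sign R u (T.erase t) = - sign R u T := by
  rw [sign, sign, Finset.filter_erase,
    ← Finset.card_erase_add_one (Finset.mem_filter.mpr ⟨ht, h⟩), pow_succ]
  ring

theorem sign_erase_of_gt (h : t < u) : sign R t (T.erase u) = sign R t T := by
  rw [sign, sign, Finset.filter_erase, Finset.erase_eq_of_notMem]
  simp [h.le]

theorem sign_mul_sign_erase (h : t ≠ u) (ht : t ∈ T) (hu : u ∈ T) :
    sign R t T * sign R u (T.erase t) = -(sign R u T * sign R t (T.erase u)) := by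
  rcases lt_or_gt_of_ne h with h | h
  · rw [sign_erase_of_lt h ht, sign_erase_of_gt h]; ring
  · rw [sign_erase_of_lt h hu, sign_erase_of_gt h]; ring

theorem sign_erase_mul_sign_erase (h : t ≠ u) (ht : t ∈ T) (hu : u ∈ T) :
    sign R u (T.erase t) * sign R t (T.erase u) = -(sign R t T * sign R u T) := by
  rcases lt_or_gt_of_ne h with h | h
  · rw [sign_erase_of_lt h ht, sign_erase_of_gt h]; ring
  · rw [sign_erase_of_lt h hu, sign_erase_of_gt h]; ring

end Sign

/-- The component of a cochain at `S`, which is `0` unless `S` has the right number of elements. -/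
def component {p : ℕ} (c : X.Cochain M p) (S : Finset (Fin X.n)) :
    LocalizedModule (X.mult S) M :=
  if h : S.card = p then c ⟨S, h⟩ else 0

theorem component_of_card {p : ℕ} (c : X.Cochain M p) (S : {S : Finset (Fin X.n) // S.card = p}) :
    X.component c S.1 = c S := dif_pos S.2

theorem component_mk {p : ℕ} (c : X.Cochain M p) {S : Finset (Fin X.n)} (hS : S.card = p) :
    X.component c S = c ⟨S, hS⟩ := dif_pos hS

theorem res_component_congr {p : ℕ} (c : X.Cochain M p) {S S' T : Finset (Fin X.n)}
    (hSS' : S = S') (h : S ⊆ T) (h' : S' ⊆ T) :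
    X.res M h (X.component c S) = X.res M h' (X.component c S') := by
  subst hSS'
  rfl

theorem cechD_apply {p : ℕ} (c : X.Cochain M p)
    (T : {T : Finset (Fin X.n) // T.card = p + 1}) :
    X.cechD M p c T = ∑ t ∈ T.1, sign R t T.1 •
      X.res M (Finset.erase_subset t T.1) (X.component c (T.1.erase t)) := by
  rw [← Finset.sum_coe_sort T.1]
  simp only [cechD, LinearMap.pi_apply, LinearMap.sum_apply]
  refine Finset.sum_congr rfl fun t _ => ?_
  rw [X.component_mk c (S := T.1.erase t.1)
    (by rw [Finset.card_erase_of_mem t.2, T.2, Nat.add_sub_cancel])]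
  rfl

theorem cechD_smul {p : ℕ} (a : R) (c : X.Cochain M p) :
    X.cechD M p (a • c) = a • X.cechD M p c := by
  funext T
  rw [Pi.smul_apply, cechD_apply, cechD_apply, Finset.smul_sum]
  refine Finset.sum_congr rfl fun t _ => ?_
  have : X.component (a • c) (T.1.erase t) = a • X.component c (T.1.erase t) := by
    unfold component
    split_ifs
    · rfl
    · rw [smul_zero]
  rw [this, map_smul, smul_comm]

theorem cechD_cechD {p : ℕ} (c : X.Cochain M p) : X.cechD M (p + 1) (X.cechD M p c) = 0 := by
  funext T
  rw [cechD_apply, Pi.zero_apply]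
  have h1 : ∀ t ∈ T.1, sign R t T.1 • X.res M (Finset.erase_subset t T.1)
        (X.component (X.cechD M p c) (T.1.erase t))
      = ∑ u ∈ T.1.erase t, (sign R t T.1 * sign R u (T.1.erase t)) •
        X.res M ((Finset.erase_subset u _).trans (Finset.erase_subset t T.1))
          (X.component c ((T.1.erase t).erase u)) := by
    intro t ht
    rw [X.component_mk _ (S := T.1.erase t)
      (by rw [Finset.card_erase_of_mem ht, T.2, Nat.add_sub_cancel]), cechD_apply, map_sum,
      Finset.smul_sum]
    refine Finset.sum_congr rfl fun u _ => ?_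
    rw [map_smul, smul_smul, res_res]
  rw [Finset.sum_congr rfl h1, Finset.sum_sigma']
  refine Finset.sum_involution (fun a _ => ⟨a.2, a.1⟩) ?_ ?_ ?_ ?_
  · rintro ⟨t, u⟩ h
    simp only [Finset.mem_sigma, Finset.mem_erase] at h
    rw [sign_mul_sign_erase (Ne.symm h.2.1) h.1 h.2.2, X.res_component_congr c
      (Finset.erase_right_comm (s := T.1) (a := t) (b := u)) _
      ((Finset.erase_subset _ _).trans (Finset.erase_subset _ _)), neg_smul, neg_add_cancel]
  · rintro ⟨t, u⟩ h _ h'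
    simp only [Finset.mem_sigma, Finset.mem_erase] at h
    simp only [Sigma.mk.injEq] at h'
    exact h.2.1 h'.1
  · rintro ⟨t, u⟩ h
    simp only [Finset.mem_sigma, Finset.mem_erase] at h ⊢
    exact ⟨h.2.2, Ne.symm h.2.1, h.1⟩
  · rintro ⟨t, u⟩ _
    rfl

theorem mem_cochainDegree {p : ℕ} {j : ℤ} {c : X.Cochain M p} :
    c ∈ X.cochainDegree ℳ p j ↔ ∀ T, c T ∈ localizedDegree 𝒜 ℳ (X.mult T.1) j := by
  simp [cochainDegree, Submodule.mem_pi]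

theorem component_mem {p : ℕ} {j : ℤ} {c : X.Cochain M p} (hc : c ∈ X.cochainDegree ℳ p j)
    (S : Finset (Fin X.n)) : X.component c S ∈ localizedDegree 𝒜 ℳ (X.mult S) j := by
  unfold component
  split_ifs with h
  · exact X.mem_cochainDegree.mp hc ⟨S, h⟩
  · exact zero_mem _

theorem sign_smul_mem {V : Type*} [AddCommGroup V] [Module K V] [Module R V] (W : Submodule K V)
    {n : ℕ} (t : Fin n) (T : Finset (Fin n)) {w : V} (hw : w ∈ W) : sign R t T • w ∈ W := by
  rcases neg_one_pow_eq_or R (T.filter (· < t)).card with h | h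
  · rw [sign, h, one_smul]; exact hw
  · rw [sign, h, neg_smul, one_smul]; exact neg_mem hw

theorem cechD_mem [SetLike.GradedMonoid 𝒜] (hℳ : IsGradedSMul 𝒜 ℳ) {p : ℕ} {j : ℤ}
    {c : X.Cochain M p} (hc : c ∈ X.cochainDegree ℳ p j) :
    X.cechD M p c ∈ X.cochainDegree ℳ (p + 1) j := by
  rw [mem_cochainDegree]
  intro T
  rw [cechD_apply]
  exact Submodule.sum_mem _ fun t _ =>
    sign_smul_mem _ _ _ (X.res_mem hℳ _ (X.component_mem hc _))

theorem cochainDegree_smul_mem [SetLike.GradedMonoid 𝒜] (hℳ : IsGradedSMul 𝒜 ℳ) (p : ℕ) :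
    IsGradedSMul 𝒜 (X.cochainDegree ℳ p) := by
  intro e j a c ha hc
  rw [mem_cochainDegree] at hc ⊢
  exact fun T => localizedDegree_smul_mem hℳ ha (hc T)

theorem coboundaries_smul_mem [SetLike.GradedMonoid 𝒜] (hℳ : IsGradedSMul 𝒜 ℳ) (p : ℕ) :
    IsGradedSMul 𝒜 (X.coboundaries ℳ p) := by
  intro e j a c ha hc
  cases p with
  | zero =>
    have hc : c = 0 := (Submodule.mem_bot K).mp hc
    rw [hc, smul_zero]
    exact zero_mem _
  | succ p =>
    obtain ⟨b, hb, rfl⟩ := hc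
    exact ⟨a • b, X.cochainDegree_smul_mem hℳ p ha hb, X.cechD_smul a b⟩

theorem cochainDegree_shift (e : ℤ) (p : ℕ) (j : ℤ) :
    X.cochainDegree (shift ℳ e) p j = X.cochainDegree ℳ p (j - e) := by
  simp only [cochainDegree, localizedDegree_shift]

theorem coboundaries_shift (e : ℤ) (p : ℕ) (j : ℤ) :
    X.coboundaries (shift ℳ e) p j = X.coboundaries ℳ p (j - e) := by
  cases p with
  | zero => rfl
  | succ p => simp only [coboundaries, cochainDegree_shift]

variable (ℳ) in
/-- `H^p_𝔪(M)_j = 0`, in terms of cocycles and coboundaries. -/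
def Vanishes (p : ℕ) (j : ℤ) : Prop := X.cocycles ℳ p j ≤ X.coboundaries ℳ p j

variable (ℳ) in
theorem subsingleton_localCohomology_iff (p : ℕ) (j : ℤ) :
    Subsingleton (X.LocalCohomology ℳ p j) ↔ X.Vanishes ℳ p j :=
  subsingleton_quotient_submoduleOf_iff _ _

theorem vanishes_iff {p : ℕ} {j : ℤ} : X.Vanishes ℳ p j ↔
    ∀ c ∈ X.cochainDegree ℳ p j, X.cechD M p c = 0 → c ∈ X.coboundaries ℳ p j := by
  simp only [Vanishes, SetLike.le_def, cocycles, Submodule.mem_inf, LinearMap.mem_ker, and_imp]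

theorem vanishes_shift_iff {e : ℤ} {p : ℕ} {j : ℤ} :
    X.Vanishes (shift ℳ e) p j ↔ X.Vanishes ℳ p (j - e) := by
  simp only [vanishes_iff, cochainDegree_shift, coboundaries_shift]

theorem cechD_eq_zero_of_mem_coboundaries {p : ℕ} {j : ℤ} {c : X.Cochain M p}
    (hc : c ∈ X.coboundaries ℳ p j) : X.cechD M p c = 0 := by
  cases p with
  | zero => rw [(Submodule.mem_bot K).mp hc, map_zero]
  | succ p =>
    obtain ⟨b, -, rfl⟩ := hc
    exact X.cechD_cechD b

theorem coboundaries_le [SetLike.GradedMonoid 𝒜] (hℳ : IsGradedSMul 𝒜 ℳ) {p : ℕ} {j : ℤ} :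
    X.coboundaries ℳ p j ≤ X.cochainDegree ℳ p j := by
  cases p with
  | zero => exact bot_le
  | succ p =>
    rintro _ ⟨b, hb, rfl⟩
    exact X.cechD_mem hℳ hb

end Module
end HomogeneousSystem
end LocalCohomology

section LocalCohomology

variable {K : Type u} [Field K] {R : Type v} [CommRing R] [Algebra K R]

/-! ### Long exact sequences for local cohomology -/

namespace HomogeneousSystem

variable {𝒜 : ℕ → Submodule K R} (X : HomogeneousSystem 𝒜)

section Exact

variable {M' M M'' : Type*} [AddCommGroup M'] [AddCommGroup M] [AddCommGroup M'']
    [Module K M'] [Module K M] [Module K M''] [Module R M'] [Module R M] [Module R M'']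
    [IsScalarTower K R M'] [IsScalarTower K R M] [IsScalarTower K R M'']
    {ℳ' : ℤ → Submodule K M'} {ℳ : ℤ → Submodule K M} {ℳ'' : ℤ → Submodule K M''}
    {f : M' →ₗ[R] M} {g : M →ₗ[R] M''}

/-- The map of localizations induced by a linear map. -/
def localizedMap (f : M' →ₗ[R] M) (S : Finset (Fin X.n)) :
    LocalizedModule (X.mult S) M' →ₗ[R] LocalizedModule (X.mult S) M :=
  IsLocalizedModule.map (X.mult S) (LocalizedModule.mkLinearMap (X.mult S) M')
    (LocalizedModule.mkLinearMap (X.mult S) M) f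

theorem localizedMap_mk (f : M' →ₗ[R] M) (S : Finset (Fin X.n)) (m : M') (s : X.mult S) :
    X.localizedMap f S (LocalizedModule.mk m s) = LocalizedModule.mk (f m) s := by
  rw [IsLocalizedModule.mk_eq_mk', IsLocalizedModule.mk_eq_mk']
  exact IsLocalizedModule.map_mk' _ _ _ _ _ _

theorem localizedMap_res (f : M' →ₗ[R] M) {S T : Finset (Fin X.n)} (h : S ⊆ T)
    (z : LocalizedModule (X.mult S) M') :
    X.localizedMap f T (X.res M' h z) = X.res M h (X.localizedMap f S z) := by
  induction z using LocalizedModule.induction_on with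
  | h m s => simp only [res_mk, localizedMap_mk]

theorem localizedMap_injective (hf : Function.Injective f) (S : Finset (Fin X.n)) :
    Function.Injective (X.localizedMap f S) :=
  IsLocalizedModule.map_injective _ _ _ _ hf

/-- The map of Čech cochains induced by a linear map. -/
def cochainMap (f : M' →ₗ[R] M) (p : ℕ) : X.Cochain M' p →ₗ[R] X.Cochain M p :=
  LinearMap.pi fun S => X.localizedMap f S.1 ∘ₗ LinearMap.proj S

theorem cochainMap_apply (f : M' →ₗ[R] M) {p : ℕ} (c : X.Cochain M' p)
    (S : {S : Finset (Fin X.n) // S.card = p}) :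
    X.cochainMap f p c S = X.localizedMap f S.1 (c S) := rfl

theorem cechD_cochainMap (f : M' →ₗ[R] M) {p : ℕ} (c : X.Cochain M' p) :
    X.cechD M p (X.cochainMap f p c) = X.cochainMap f (p + 1) (X.cechD M' p c) := by
  funext T
  rw [cochainMap_apply, cechD_apply, cechD_apply, map_sum]
  refine Finset.sum_congr rfl fun t _ => ?_
  rw [map_smul, localizedMap_res]
  congr 2
  unfold component
  split_ifs
  · rfl
  · rw [map_zero]

theorem cochainMap_injective (hf : Function.Injective f) (p : ℕ) :
    Function.Injective (X.cochainMap f p) := by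
  intro c c' h
  funext S
  exact X.localizedMap_injective hf S.1 (congrFun h S)

variable [SetLike.GradedMonoid 𝒜] (hℳ' : IsGradedSMul 𝒜 ℳ') (hℳ : IsGradedSMul 𝒜 ℳ)
  (hℳ'' : IsGradedSMul 𝒜 ℳ'') (E : GradedExact ℳ' ℳ ℳ'' f g)

include hℳ' hℳ E in
theorem cochainMap_left_mem {p : ℕ} {j : ℤ} {c : X.Cochain M' p}
    (hc : c ∈ X.cochainDegree ℳ' p j) : X.cochainMap f p c ∈ X.cochainDegree ℳ p j := by
  rw [mem_cochainDegree] at hc ⊢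
  intro T
  obtain ⟨e, s, m, hs, hm, h⟩ := (mem_localizedDegree_iff hℳ').mp (hc T)
  rw [cochainMap_apply, h, localizedMap_mk]
  exact (mem_localizedDegree_iff hℳ).mpr ⟨e, s, _, hs, E.map_left hm, rfl⟩

include hℳ hℳ'' E in
theorem cochainMap_right_mem {p : ℕ} {j : ℤ} {c : X.Cochain M p}
    (hc : c ∈ X.cochainDegree ℳ p j) : X.cochainMap g p c ∈ X.cochainDegree ℳ'' p j := by
  rw [mem_cochainDegree] at hc ⊢
  intro T
  obtain ⟨e, s, m, hs, hm, h⟩ := (mem_localizedDegree_iff hℳ).mp (hc T)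
  rw [cochainMap_apply, h, localizedMap_mk]
  exact (mem_localizedDegree_iff hℳ'').mpr ⟨e, s, _, hs, E.map_right hm, rfl⟩

include E in
theorem cochainMap_cochainMap {p : ℕ} (c : X.Cochain M' p) :
    X.cochainMap g p (X.cochainMap f p c) = 0 := by
  funext T
  rw [cochainMap_apply, cochainMap_apply, Pi.zero_apply]
  induction c T using LocalizedModule.induction_on with
  | h m s => rw [localizedMap_mk, localizedMap_mk, E.comp_eq_zero, LocalizedModule.zero_mk]

include hℳ'' hℳ E in
theorem cochain_lift_of_surjective {p : ℕ} {j : ℤ} {c'' : X.Cochain M'' p}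
    (hc : c'' ∈ X.cochainDegree ℳ'' p j) :
    ∃ c ∈ X.cochainDegree ℳ p j, X.cochainMap g p c = c'' := by
  rw [mem_cochainDegree] at hc
  have : ∀ T : {T : Finset (Fin X.n) // T.card = p}, ∃ z ∈ localizedDegree 𝒜 ℳ (X.mult T.1) j, X.localizedMap g T.1 z = c'' T := by
    intro T
    obtain ⟨e, s, m'', hs, hm'', h⟩ := (mem_localizedDegree_iff hℳ'').mp (hc T)
    obtain ⟨m, hm, rfl⟩ := E.surjective hm''
    exact ⟨LocalizedModule.mk m s,
      (mem_localizedDegree_iff hℳ).mpr ⟨e, s, m, hs, hm, rfl⟩,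
      (X.localizedMap_mk g T.1 m s).trans h.symm⟩
  choose c hc hgc using this
  exact ⟨c, X.mem_cochainDegree.mpr hc, funext hgc⟩

include hℳ' hℳ E in
theorem cochain_lift_of_exact {p : ℕ} {j : ℤ} {c : X.Cochain M p}
    (hc : c ∈ X.cochainDegree ℳ p j) (hgc : X.cochainMap g p c = 0) :
    ∃ c' ∈ X.cochainDegree ℳ' p j, X.cochainMap f p c' = c := by
  rw [mem_cochainDegree] at hc
  have : ∀ T : {T : Finset (Fin X.n) // T.card = p}, ∃ z ∈ localizedDegree 𝒜 ℳ' (X.mult T.1) j, X.localizedMap f T.1 z = c T := by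
    intro T
    obtain ⟨e, s, m, hs, hm, h⟩ := (mem_localizedDegree_iff hℳ).mp (hc T)
    have h0 := congrFun hgc T
    rw [cochainMap_apply, h, localizedMap_mk, Pi.zero_apply, ← LocalizedModule.zero_mk s,
      LocalizedModule.mk_eq] at h0
    obtain ⟨v, hv⟩ := h0
    obtain ⟨e', he'⟩ := X.exists_mem_of_mem_mult v.2
    have hvs : ((v * s : X.mult T.1) : R) ∈ 𝒜 (e' + e) := SetLike.mul_mem_graded he' hs
    have hv0 : g (((v * s : X.mult T.1) : R) • m) = 0 := by
      rw [map_smul]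
      simpa [Submonoid.smul_def, mul_smul] using hv
    obtain ⟨m', hm', hfm'⟩ := E.exact (hℳ hvs hm) hv0
    refine ⟨LocalizedModule.mk m' (v * s * s), (mem_localizedDegree_iff hℳ').mpr
      ⟨e' + e + e, v * s * s, m', SetLike.mul_mem_graded hvs hs, ?_, rfl⟩, ?_⟩
    · rwa [show j + ((e' + e + e : ℕ) : ℤ) = j + e + ((e' + e : ℕ) : ℤ) by push_cast; ring]
    · rw [localizedMap_mk, h, hfm']
      exact LocalizedModule.mk_cancel_common_left (v * s) s m
  choose c' hc' hfc' using this
  exact ⟨c', X.mem_cochainDegree.mpr hc', funext hfc'⟩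

include hℳ' hℳ E in
theorem coboundary_map {p : ℕ} {j : ℤ} {c : X.Cochain M' p}
    (hc : c ∈ X.coboundaries ℳ' p j) : X.cochainMap f p c ∈ X.coboundaries ℳ p j := by
  cases p with
  | zero =>
    rw [(Submodule.mem_bot K).mp hc, map_zero]
    exact zero_mem _
  | succ p =>
    obtain ⟨b, hb, rfl⟩ := hc
    exact ⟨_, X.cochainMap_left_mem hℳ' hℳ E hb, X.cechD_cochainMap f b⟩

include hℳ' hℳ hℳ'' E in
/-- Exactness of `H^p(M') → H^p(M) → H^p(M'')` at `H^p(M)`. -/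
theorem vanishes_middle (hf : Function.Injective f) {p : ℕ} {j : ℤ}
    (h' : X.Vanishes ℳ' p j) (h'' : X.Vanishes ℳ'' p j) : X.Vanishes ℳ p j := by
  rw [vanishes_iff] at *
  intro c hc hdc
  have hgc := h'' _ (X.cochainMap_right_mem hℳ hℳ'' E hc) (by rw [cechD_cochainMap, hdc, map_zero])
  -- subtract a coboundary to move `c` into the kernel of `g`
  have key : ∃ b ∈ X.coboundaries ℳ p j, X.cochainMap g p (c - b) = 0 := by
    cases p with
    | zero => exact ⟨0, zero_mem _, by rw [sub_zero]; exact (Submodule.mem_bot K).mp hgc⟩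
    | succ p =>
      obtain ⟨b'', hb'', hdb''⟩ := hgc
      obtain ⟨b, hb, rfl⟩ := X.cochain_lift_of_surjective hℳ hℳ'' E hb''
      exact ⟨X.cechD M p b, ⟨b, hb, rfl⟩, by
        rw [map_sub, ← cechD_cochainMap, hdb'', sub_self]⟩
  obtain ⟨b, hb, hgcb⟩ := key
  obtain ⟨c', hc', hfc'⟩ := X.cochain_lift_of_exact hℳ' hℳ E
    (sub_mem hc (X.coboundaries_le hℳ hb)) hgcb
  have hdc' : X.cechD M' p c' = 0 := by
    apply X.cochainMap_injective hf
    rw [← cechD_cochainMap, hfc', map_sub, hdc, X.cechD_eq_zero_of_mem_coboundaries hb,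
      sub_zero, map_zero]
  have := X.coboundary_map hℳ' hℳ E (h' c' hc' hdc')
  rw [hfc'] at this
  rw [← sub_add_cancel c b]
  exact add_mem this hb

include hℳ' hℳ hℳ'' E in
/-- If `H^{p-1}(M'')_j = 0`, then `H^p(M')_j → H^p(M)_j` is injective. -/
theorem mem_coboundaries_of_map (hf : Function.Injective f) {p : ℕ} {j : ℤ}
    (h'' : ∀ q, p = q + 1 → X.Vanishes ℳ'' q j) {c : X.Cochain M' p}
    (hfc : X.cochainMap f p c ∈ X.coboundaries ℳ p j) : c ∈ X.coboundaries ℳ' p j := by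
  cases p with
  | zero =>
    have h0 : X.cochainMap f 0 c = 0 := (Submodule.mem_bot K).mp hfc
    rw [X.cochainMap_injective hf 0 (h0.trans (map_zero _).symm)]
    exact zero_mem _
  | succ p =>
    obtain ⟨b, hb, hdb⟩ := hfc
    have hgb := X.vanishes_iff.mp (h'' p rfl) _ (X.cochainMap_right_mem hℳ hℳ'' E hb)
      (by rw [cechD_cochainMap, hdb, X.cochainMap_cochainMap E])
    have key : ∃ a ∈ X.coboundaries ℳ p j, X.cochainMap g p (b - a) = 0 := by
      cases p with
      | zero => exact ⟨0, zero_mem _, by rw [sub_zero]; exact (Submodule.mem_bot K).mp hgb⟩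
      | succ p =>
        obtain ⟨a'', ha'', hda''⟩ := hgb
        obtain ⟨a, ha, rfl⟩ := X.cochain_lift_of_surjective hℳ hℳ'' E ha''
        exact ⟨X.cechD M p a, ⟨a, ha, rfl⟩, by
          rw [map_sub, ← cechD_cochainMap, hda'', sub_self]⟩
    obtain ⟨a, ha, hgba⟩ := key
    obtain ⟨b', hb', hfb'⟩ := X.cochain_lift_of_exact hℳ' hℳ E
      (sub_mem hb (X.coboundaries_le hℳ ha)) hgba
    refine ⟨b', hb', X.cochainMap_injective hf _ ?_⟩
    rw [← cechD_cochainMap, hfb', map_sub, hdb, X.cechD_eq_zero_of_mem_coboundaries ha, sub_zero]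

end Exact

/-! ### Local cohomology is `𝔪`-torsion -/

section Torsion

variable {M : Type*} [AddCommGroup M] [Module K M] [Module R M] [IsScalarTower K R M]
  {ℳ : ℤ → Submodule K M}

theorem component_smul {p : ℕ} (a : R) (c : X.Cochain M p) (S : Finset (Fin X.n)) :
    X.component (a • c) S = a • X.component c S := by
  unfold component
  split_ifs
  · rfl
  · rw [smul_zero]

/-- Čech cocycles in cohomological degree `0` are killed by powers of the `x_t`. -/
theorem exists_pow_smul_eq_zero_of_cechD {c : X.Cochain M 0} (hc : X.cechD M 0 c = 0)
    (t : Fin X.n) : ∃ N, X.x t ^ N • c = 0 := by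
  have h1 := congrFun hc ⟨{t}, rfl⟩
  rw [cechD_apply, Finset.sum_singleton, Pi.zero_apply] at h1
  have h2 : X.res M (Finset.subset_insert t ∅) (X.component c ∅) = 0 := by
    have h3 := congrArg (fun z => sign R t {t} • z) h1
    simp only [smul_smul, sign_mul_self, one_smul, smul_zero] at h3
    exact (X.res_component_congr c (by simp) _ _).trans h3
  obtain ⟨N, hN⟩ := X.exists_pow_smul_eq_zero h2
  refine ⟨N, funext fun S => ?_⟩
  obtain ⟨S, hS⟩ := S
  obtain rfl := Finset.card_eq_zero.mp hS
  rw [← X.component_mk (X.x t ^ N • c) hS, component_smul]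
  exact hN N le_rfl

/-- The `x_t` act nilpotently on every Čech cohomology class. After multiplication by a power of
`x_t`, the components `c_{S ∪ {t}}` come from elements `h_S` of `M_{x_S}`; with the right signs,
`h` is a cochain with `δ h = x_t ^ N c`. -/
theorem exists_pow_smul_mem_coboundaries [GradedAlgebra 𝒜] (hℳ : IsGradedSMul 𝒜 ℳ) {p : ℕ}
    {j : ℤ} {c : X.Cochain M p} (hc : c ∈ X.cochainDegree ℳ p j) (hdc : X.cechD M p c = 0)
    {t : Fin X.n} {e : ℕ} (ht : X.x t ∈ 𝒜 e) :
    ∃ N : ℕ, X.x t ^ N • c ∈ X.coboundaries ℳ p (j + (N * e : ℕ)) := by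
  classical
  cases p with
  | zero =>
    obtain ⟨N, hN⟩ := X.exists_pow_smul_eq_zero_of_cechD hdc t
    exact ⟨N, by rw [hN]; exact zero_mem _⟩
  | succ p =>
    have h1 := fun S : Finset (Fin X.n) =>
      X.exists_pow_smul_eq_res (S := S) hℳ ht (X.component_mem hc (insert t S))
    choose N₀ hN₀ using h1
    obtain ⟨N₁, hN₁⟩ : ∃ N₁, ∀ S, N₀ S ≤ N₁ :=
      ⟨Finset.univ.sup N₀, fun S => Finset.le_sup (Finset.mem_univ S)⟩
    choose y hy hycS using fun S => hN₀ S N₁ (hN₁ S)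
    have hyres : ∀ (S T : Finset (Fin X.n)) (hST : insert t S ⊆ T),
        X.res M ((Finset.subset_insert t S).trans hST) (y S)
          = X.x t ^ N₁ • X.res M hST (X.component c (insert t S)) := by
      intro S T hST
      rw [← map_smul, hycS, res_res]
    let h : X.Cochain M p := fun S => if t ∈ S.1 then 0 else sign R t (insert t S.1) • y S.1
    have hh : h ∈ X.cochainDegree ℳ p (j + (N₁ * e : ℕ)) := by
      rw [mem_cochainDegree]
      intro S
      simp only [h]
      split_ifs
      · exact zero_mem _
      · exact sign_smul_mem _ _ _ (hy S.1)
    have hcomp : ∀ S : Finset (Fin X.n), S.card = p → t ∉ S →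
        X.component h S = sign R t (insert t S) • y S := by
      intro S hS htS
      rw [X.component_mk h hS]
      exact if_neg htS
    have hcomp0 : ∀ S : Finset (Fin X.n), t ∈ S → X.component h S = 0 := by
      intro S htS
      unfold component
      split_ifs
      · exact if_pos htS
      · rfl
    -- at the sets containing `t`, the identity `δ h = x_t ^ N c` holds on the nose
    have hmem : ∀ T : {T : Finset (Fin X.n) // T.card = p + 1}, t ∈ T.1 →
        X.cechD M p h T = X.x t ^ N₁ • c T := by
      intro T htT
      rw [cechD_apply, Finset.sum_eq_single_of_mem t htT]
      · rw [hcomp _ (by rw [Finset.card_erase_of_mem htT, T.2, Nat.add_sub_cancel])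
          (Finset.notMem_erase t T.1), map_smul, smul_smul, Finset.insert_erase htT,
          sign_mul_self, one_smul, hyres _ _ (Finset.insert_erase htT).le,
          X.res_component_congr c (Finset.insert_erase htT) _ subset_rfl, res_refl,
          component_of_card]
      · intro u _ hut
        rw [hcomp0 _ (Finset.mem_erase.mpr ⟨Ne.symm hut, htT⟩), map_zero, smul_zero]
    -- at the other sets it holds after inverting `x_t`, by the cocycle condition
    have hnot : ∀ T : {T : Finset (Fin X.n) // T.card = p + 1}, t ∉ T.1 →
        X.res M (Finset.subset_insert t T.1) (X.cechD M p h T - X.x t ^ N₁ • c T) = 0 := by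
      intro T htT
      have hcoc := congrFun hdc ⟨insert t T.1, by rw [Finset.card_insert_of_notMem htT, T.2]⟩
      rw [cechD_apply, Finset.sum_insert htT, Pi.zero_apply] at hcoc
      rw [X.res_component_congr c (Finset.erase_insert htT) _ (Finset.subset_insert t T.1),
        component_of_card] at hcoc
      have h2 : X.res M (Finset.subset_insert t T.1) (X.cechD M p h T)
          = - (sign R t (insert t T.1) • X.x t ^ N₁ • ∑ u ∈ T.1, sign R u (insert t T.1) •
            X.res M (Finset.erase_subset u (insert t T.1))
              (X.component c ((insert t T.1).erase u))) := by
        rw [cechD_apply, map_sum, Finset.smul_sum, Finset.smul_sum, ← Finset.sum_neg_distrib]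
        refine Finset.sum_congr rfl fun u hu => ?_
        have hut : u ≠ t := fun h => htT (h ▸ hu)
        have hins : insert t (T.1.erase u) = (insert t T.1).erase u :=
          (Finset.erase_insert_of_ne (Ne.symm hut)).symm
        rw [hcomp _ (by rw [Finset.card_erase_of_mem hu, T.2, Nat.add_sub_cancel])
          (fun h => htT (Finset.mem_of_mem_erase h)), map_smul, map_smul, map_smul, res_res,
          hyres (T.1.erase u) (insert t T.1)
            (Finset.insert_subset_insert t (Finset.erase_subset u T.1)),
          X.res_component_congr c hins _ (Finset.erase_subset u _), hins]
        simp only [smul_smul]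
        rw [← neg_smul]
        congr 1
        have h3 := sign_erase_mul_sign_erase (R := R) (Ne.symm hut)
          (Finset.mem_insert_self t T.1) (Finset.mem_insert_of_mem hu)
        rw [Finset.erase_insert htT] at h3
        linear_combination (X.x t ^ N₁) * h3
      rw [map_sub, h2, eq_neg_of_add_eq_zero_right hcoc, map_smul, smul_neg, smul_neg, neg_neg,
        smul_comm (X.x t ^ N₁), smul_smul, sign_mul_self, one_smul, sub_self]
    have hkill : ∀ T : {T : Finset (Fin X.n) // T.card = p + 1}, ∃ N₀, ∀ N, N₀ ≤ N →
        X.x t ^ N • (X.cechD M p h T - X.x t ^ N₁ • c T) = 0 := by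
      intro T
      by_cases htT : t ∈ T.1
      · exact ⟨0, fun N _ => by rw [hmem T htT, sub_self, smul_zero]⟩
      · exact X.exists_pow_smul_eq_zero (hnot T htT)
    choose N₂ hN₂ using hkill
    obtain ⟨N₃, hN₃⟩ : ∃ N₃, ∀ T, N₂ T ≤ N₃ :=
      ⟨Finset.univ.sup N₂, fun S => Finset.le_sup (Finset.mem_univ S)⟩
    refine ⟨N₁ + N₃, X.x t ^ N₃ • h, ?_, ?_⟩
    · have := X.cochainDegree_smul_mem hℳ p (SetLike.pow_mem_graded N₃ ht) hh
      rwa [show j + ((N₁ * e : ℕ) : ℤ) + ((N₃ • e : ℕ) : ℤ) = j + (((N₁ + N₃) * e : ℕ) : ℤ) by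
        rw [smul_eq_mul]; push_cast; ring] at this
    · rw [cechD_smul]
      funext T
      have := hN₂ T N₃ (hN₃ T)
      rw [smul_sub, sub_eq_zero, smul_smul, ← pow_add, add_comm N₃] at this
      exact this

/-- Homogeneous elements of `𝔪` act nilpotently on every class of `H^p_𝔪(M)`. -/
theorem exists_pow_smul_mem_coboundaries_of_mem [GradedAlgebra 𝒜] (hℳ : IsGradedSMul 𝒜 ℳ)
    {p : ℕ} {j : ℤ} {c : X.Cochain M p} (hc : c ∈ X.cochainDegree ℳ p j)
    (hdc : X.cechD M p c = 0) {a : R} {e : ℕ} (ha : a ∈ 𝒜 e) (ham : a ∈ maxIdeal 𝒜) :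
    ∃ N : ℕ, a ^ N • c ∈ X.coboundaries ℳ p (j + (N * e : ℕ)) := by
  choose d _ hd using X.homogeneous
  choose N hN using fun t => X.exists_pow_smul_mem_coboundaries hℳ hc hdc (hd t)
  -- a power of `a` lies in the ideal of the `x_t ^ N_t`
  have hrad : a ∈ (Ideal.span (Set.range fun t => X.x t ^ N t)).radical := by
    rw [← Ideal.radical_idem]
    have h1 : Ideal.span (Set.range X.x) ≤ (Ideal.span (Set.range fun t => X.x t ^ N t)).radical := by
      rw [Ideal.span_le]
      rintro _ ⟨t, rfl⟩
      exact ⟨N t, Ideal.subset_span ⟨t, rfl⟩⟩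
    apply Ideal.radical_mono h1
    rw [X.radical_eq]
    exact Ideal.le_radical ham
  obtain ⟨n, hn⟩ := hrad
  obtain ⟨r, hr, hra⟩ := exists_homogeneous_coeff (𝒜 := 𝒜) (D := ((n • e : ℕ) : ℤ))
    (SetLike.pow_mem_graded n ha) (δ := fun t => ((N t • d t : ℕ) : ℤ))
    (fun t => SetLike.pow_mem_graded (N t) (hd t)) hn
  refine ⟨n, ?_⟩
  rw [← hra, Finset.sum_smul]
  refine Submodule.sum_mem _ fun t _ => ?_
  rw [mul_smul]
  have := (X.coboundaries_smul_mem hℳ p).smul_mem (hr t) (hN t)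
  rwa [show j + ((N t * d t : ℕ) : ℤ) + (((n • e : ℕ) : ℤ) - ((N t • d t : ℕ) : ℤ))
    = j + ((n * e : ℕ) : ℤ) by simp only [smul_eq_mul]; ring] at this

/-- `H^0_𝔪(M) = 0` if `𝔪` contains a nonzerodivisor on `M`. -/
theorem eq_zero_of_cechD_eq_zero {a : R} (ham : a ∈ maxIdeal 𝒜) (hreg : IsSMulRegular M a)
    {c : X.Cochain M 0} (hdc : X.cechD M 0 c = 0) : c = 0 := by
  let J : Ideal R := LinearMap.ker (LinearMap.toSpanSingleton R (X.Cochain M 0) c)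
  have hrad : a ∈ J.radical := by
    rw [← Ideal.radical_idem]
    have h1 : Ideal.span (Set.range X.x) ≤ J.radical := by
      rw [Ideal.span_le]
      rintro _ ⟨t, rfl⟩
      exact X.exists_pow_smul_eq_zero_of_cechD hdc t
    apply Ideal.radical_mono h1
    rw [X.radical_eq]
    exact Ideal.le_radical ham
  obtain ⟨n, hn⟩ := hrad
  have hn : a ^ n • c = 0 := hn
  funext S
  obtain ⟨S, hS⟩ := S
  have hnS : a ^ n • c ⟨S, hS⟩ = 0 := congrFun hn ⟨S, hS⟩
  obtain rfl := Finset.card_eq_zero.mp hS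
  rw [Pi.zero_apply]
  generalize c ⟨∅, hS⟩ = z at hnS
  induction z using LocalizedModule.induction_on with
  | h m s =>
    rw [LocalizedModule.smul'_mk, mk_empty_eq_zero_iff] at hnS
    rw [mk_empty_eq_zero_iff]
    exact (hreg.pow n) (by simpa using hnS)

/-- If every element of `M` is killed by powers of the `x_t`, the Čech complex of `M` is
concentrated in cohomological degree `0`. -/
theorem subsingleton_cochain {p : ℕ} (hp : p ≠ 0)
    (h : ∀ (t : Fin X.n) (m : M), ∃ N : ℕ, X.x t ^ N • m = 0) : Subsingleton (X.Cochain M p) := by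
  have : ∀ T : {T : Finset (Fin X.n) // T.card = p},
      Subsingleton (LocalizedModule (X.mult T.1) M) := by
    intro T
    obtain ⟨t, ht⟩ := Finset.card_ne_zero.mp (T.2.trans_ne hp)
    rw [LocalizedModule.subsingleton_iff]
    intro m
    obtain ⟨N, hN⟩ := h t m
    exact ⟨X.x t ^ N, pow_mem (X.x_mem_mult ht) N, hN⟩
  infer_instance

end Torsion
end HomogeneousSystem
end LocalCohomology

section LocalCohomology

variable {K : Type u} [Field K] {R : Type v} [CommRing R] [Algebra K R]
  {𝒜 : ℕ → Submodule K R}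

/-! ### Finiteness of the local regularity -/

namespace HomogeneousSystem

variable (X : HomogeneousSystem 𝒜)

section

variable {M : Type*} [AddCommGroup M] [Module K M] [Module R M] [IsScalarTower K R M]
  {ℳ : ℤ → Submodule K M}

theorem vanishes_of_subsingleton {p : ℕ} {j : ℤ} (h : Subsingleton (X.Cochain M p)) :
    X.Vanishes ℳ p j := by
  rw [vanishes_iff]
  intro c _ _
  rw [Subsingleton.elim c 0]
  exact zero_mem _

theorem cochain_eq_zero_of_eq_bot [GradedAlgebra 𝒜] [Nontrivial R] (hℳ : IsGradedSMul 𝒜 ℳ)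
    {j : ℤ} (hj : ℳ j = ⊥) {c : X.Cochain M 0} (hc : c ∈ X.cochainDegree ℳ 0 j) : c = 0 := by
  rw [mem_cochainDegree] at hc
  funext S
  obtain ⟨S, hS⟩ := S
  have hcS := hc ⟨S, hS⟩
  obtain rfl := Finset.card_eq_zero.mp hS
  obtain ⟨m, hm, h⟩ := X.exists_eq_mk_one hℳ hcS
  rw [hj, Submodule.mem_bot] at hm
  rw [h, hm, LocalizedModule.zero_mk]
  rfl

theorem cochainMap_eq_smul {f : M →ₗ[R] M} {a : R} (hf : ∀ m, f m = a • m) {p : ℕ}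
    (c : X.Cochain M p) : X.cochainMap f p c = a • c := by
  funext S
  rw [cochainMap_apply, Pi.smul_apply]
  induction c S using LocalizedModule.induction_on with
  | h m s => rw [localizedMap_mk, LocalizedModule.smul'_mk, hf]

/-- If `a ∈ 𝔪` is a homogeneous nonzerodivisor on `M` and `H^{p-1}(M ⧸ a M)` vanishes in degrees
`> k`, then `a` acts injectively on `H^p(M)` in degrees `≥ k`; since every class is killed by a
power of `a`, `H^p(M)_k = 0`. -/
theorem vanishes_of_injective_smul [GradedAlgebra 𝒜] (hℳ : IsGradedSMul 𝒜 ℳ)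
    {M'' : Type*} [AddCommGroup M''] [Module K M''] [Module R M''] [IsScalarTower K R M'']
    {ℳ'' : ℤ → Submodule K M''} (hℳ'' : IsGradedSMul 𝒜 ℳ'') {f : M →ₗ[R] M} {g : M →ₗ[R] M''}
    {a : R} {e : ℕ} (he : 0 < e) (ha : a ∈ 𝒜 e) (hfa : ∀ m, f m = a • m)
    (hf : Function.Injective f) (E : GradedExact (shift ℳ e) ℳ ℳ'' f g) {p : ℕ} {k : ℤ}
    (h'' : ∀ q, p = q + 1 → ∀ l, k < l → X.Vanishes ℳ'' q l) : X.Vanishes ℳ p k := by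
  have hshift : IsGradedSMul 𝒜 (shift ℳ e) := by
    intro e' k' b m hb hm
    have := hℳ hb hm
    rwa [sub_add_eq_add_sub] at this
  rw [vanishes_iff]
  intro c hc hdc
  obtain ⟨N, hN⟩ :=
    X.exists_pow_smul_mem_coboundaries_of_mem hℳ hc hdc ha (mem_maxIdeal_of_mem he ha)
  induction N with
  | zero => simpa using hN
  | succ n ih =>
    apply ih
    have h1 : X.cochainMap f p (a ^ n • c) ∈ X.coboundaries ℳ p (k + ((n + 1) * e : ℕ)) := by
      rwa [cochainMap_eq_smul X hfa, smul_smul, ← pow_succ']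
    have h2 := X.mem_coboundaries_of_map hshift hℳ hℳ'' E hf
      (fun q hq => h'' q hq _ (by
        have : 0 < (n + 1) * e := by positivity
        omega)) h1
    rw [coboundaries_shift] at h2
    rwa [show k + (((n + 1) * e : ℕ) : ℤ) - e = k + ((n * e : ℕ) : ℤ) by push_cast; ring] at h2

end

end HomogeneousSystem

/-- The exact sequence `0 → (R ⧸ (I : a))(-e) → R ⧸ I → R ⧸ (I + (a)) → 0` given by a homogeneous
element `a` of degree `e`. -/
theorem gradedExact_colon [GradedAlgebra 𝒜] {I J : Ideal R} (hI : I.IsHomogeneous 𝒜) {a : R}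
    {e : ℕ} (ha : a ∈ 𝒜 e) (hJ : J = Submodule.comap (LinearMap.mulLeft R a) I) :
    GradedExact (shift (quotientGrading 𝒜 J) e) (quotientGrading 𝒜 I)
      (quotientGrading 𝒜 (I ⊔ Ideal.span {a}))
      (Submodule.mapQ J I (LinearMap.mulLeft R a) hJ.le)
      (Submodule.mapQ I (I ⊔ Ideal.span {a}) LinearMap.id le_sup_left) where
  map_left := by
    rintro k _ ⟨x, hx, rfl⟩
    refine ⟨a * x, ?_, rfl⟩
    have := selfGrading_mul_mem (𝒜 := 𝒜) (k := e) ha hx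
    rwa [add_sub_cancel] at this
  map_right := by
    rintro k _ ⟨x, hx, rfl⟩
    exact ⟨x, hx, rfl⟩
  injective := by
    rintro k _ ⟨x, hx, rfl⟩ h0
    have h1 : a * x ∈ I := (Submodule.Quotient.mk_eq_zero I).mp h0
    refine (Submodule.Quotient.mk_eq_zero J).mpr ?_
    rw [hJ]
    exact h1
  comp_eq_zero := by
    intro m
    induction m using Submodule.Quotient.induction_on with
    | H x =>
      refine (Submodule.Quotient.mk_eq_zero _).mpr ?_
      exact Ideal.mul_mem_right _ _ (Ideal.mem_sup_right (Ideal.mem_span_singleton_self a))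
  exact := by
    rintro k _ ⟨r, hr, rfl⟩ h0
    have h1 : r ∈ I ⊔ Ideal.span {a} := (Submodule.Quotient.mk_eq_zero _).mp h0
    obtain ⟨y, hy, z, hz, rfl⟩ := Submodule.mem_sup.mp h1
    obtain ⟨x, rfl⟩ := Ideal.mem_span_singleton'.mp hz
    refine ⟨Submodule.Quotient.mk (intProj 𝒜 (k - e) x), ⟨_, intProj_mem _ _, rfl⟩, ?_⟩
    refine (Submodule.Quotient.eq I).mpr ?_
    have h2 := intProj_of_mem hr
    rw [map_add, mul_comm, intProj_mul_of_left_mem (k := e) ha] at h2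
    change a * intProj 𝒜 (k - e) x - (y + x * a) ∈ I
    rw [mul_comm x a, ← h2]
    rw [sub_add_cancel_right]
    exact neg_mem (intProj_mem_of_isHomogeneous hI hy k)
  surjective := by
    rintro k _ ⟨r, hr, rfl⟩
    exact ⟨Submodule.Quotient.mk r, ⟨r, hr, rfl⟩, rfl⟩

/-- For every homogeneous ideal `I` the local regularity of `R ⧸ I` is bounded above, uniformly in
the system of elements: Noetherian induction along `gradedExact_colon`. -/
theorem IsPositivelyGraded.exists_bound_quotient (h : IsPositivelyGraded 𝒜) (I : Ideal R)
    (hI : letI := h.gradedAlgebra; I.IsHomogeneous 𝒜) :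
    ∃ B : ℤ, ∀ (X : HomogeneousSystem 𝒜) (p : ℕ) (s : ℤ), B < s →
      X.Vanishes (quotientGrading 𝒜 I) p (s - p) := by
  let _ := h.gradedAlgebra
  have := h.noetherian
  have := h.nontrivial
  induction I using IsNoetherian.induction with
  | hgt I ih =>
  have hcolon : ∀ a, ∀ e, a ∈ 𝒜 e →
      (Submodule.comap (LinearMap.mulLeft R a) I : Ideal R).IsHomogeneous 𝒜 := by
    intro a e ha k x hx
    change a * _ ∈ I
    have h1 := intProj_mem_of_isHomogeneous hI (x := a * x) hx (e + k)
    rwa [intProj_mul_of_left_mem (k := e) ha, add_sub_cancel_left] at h1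
  have hsup : ∀ a, ∀ e, a ∈ 𝒜 e → (I ⊔ Ideal.span {a}).IsHomogeneous 𝒜 := by
    intro a e ha
    refine hI.sup (Ideal.homogeneous_span 𝒜 _ ?_)
    rintro _ rfl
    exact ⟨e, ha⟩
  have hlt : ∀ a, a ∉ I → I < I ⊔ Ideal.span {a} := by
    intro a ha
    refine lt_of_le_of_ne le_sup_left fun h => ha ?_
    rw [h]
    exact Ideal.mem_sup_right (Ideal.mem_span_singleton_self a)
  have hle : ∀ a, I ≤ Submodule.comap (LinearMap.mulLeft R a) I :=
    fun a x hx => Ideal.mul_mem_left _ _ hx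
  have hgr := fun J => isGradedSMul_quotientGrading 𝒜 J
  by_cases hA : ∃ e a, a ∈ 𝒜 e ∧ a ∉ I ∧ I < Submodule.comap (LinearMap.mulLeft R a) I
  · obtain ⟨e, a, ha, haI, hC⟩ := hA
    obtain ⟨B₁, hB₁⟩ := ih _ hC (hcolon a e ha)
    obtain ⟨B₂, hB₂⟩ := ih _ (hlt a haI) (hsup a e ha)
    refine ⟨max (B₁ + e) B₂, fun X p s hs => ?_⟩
    obtain ⟨hs₁, hs₂⟩ := max_lt_iff.mp hs
    have E := gradedExact_colon hI ha rfl
    refine X.vanishes_middle ?_ (hgr _) (hgr _) E ?_ ?_ (hB₂ X p s hs₂)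
    · intro e' k' b m hb hm
      have := hgr _ hb hm
      rwa [sub_add_eq_add_sub] at this
    · rw [← LinearMap.ker_eq_bot, LinearMap.ker_eq_bot']
      intro m hm
      induction m using Submodule.Quotient.induction_on with
      | H x =>
        refine (Submodule.Quotient.mk_eq_zero _).mpr ?_
        exact (Submodule.Quotient.mk_eq_zero I).mp hm
    · rw [HomogeneousSystem.vanishes_shift_iff]
      have := hB₁ X p (s - e) (by omega)
      rwa [sub_right_comm] at this
  by_cases hB : ∃ e a, 0 < e ∧ a ∈ 𝒜 e ∧ a ∉ I
  · obtain ⟨e, a, he, ha, haI⟩ := hB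
    have hC : I = Submodule.comap (LinearMap.mulLeft R a) I := by
      by_contra hne
      exact hA ⟨e, a, ha, haI, lt_of_le_of_ne (hle a) hne⟩
    obtain ⟨B, hB⟩ := ih _ (hlt a haI) (hsup a e ha)
    refine ⟨B, fun X p s hs => ?_⟩
    refine X.vanishes_of_injective_smul (hgr _) (hgr _) he ha ?_ ?_ (gradedExact_colon hI ha hC) ?_
    · intro m
      induction m using Submodule.Quotient.induction_on with
      | H x => rfl
    · rw [← LinearMap.ker_eq_bot, LinearMap.ker_eq_bot']
      intro m hm
      induction m using Submodule.Quotient.induction_on with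
      | H x =>
        refine (Submodule.Quotient.mk_eq_zero _).mpr ?_
        have h1 : a * x ∈ I := (Submodule.Quotient.mk_eq_zero I).mp hm
        rw [hC]
        exact h1
    · rintro q rfl l hl
      have := hB X q (l + q) (by push_cast at hl; omega)
      rwa [add_sub_cancel_right] at this
  -- now `𝔪 ≤ I`, and `R ⧸ I` is concentrated in degree `0`
  push Not at hB
  refine ⟨0, fun X p s hs => ?_⟩
  rcases Nat.eq_zero_or_pos p with rfl | hp
  · rw [HomogeneousSystem.vanishes_iff]
    intro c hc _
    rw [X.cochain_eq_zero_of_eq_bot (hgr I) ?_ hc]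
    · exact zero_mem _
    · rw [eq_bot_iff]
      rintro _ ⟨r, hr, rfl⟩
      rw [Nat.cast_zero, sub_zero] at hr
      lift s to ℕ using hs.le
      refine (Submodule.mem_bot K).mpr ((Submodule.Quotient.mk_eq_zero I).mpr ?_)
      exact hB s r (by exact_mod_cast hs) hr
  · refine X.vanishes_of_subsingleton (X.subsingleton_cochain hp.ne' fun t m => ⟨1, ?_⟩)
    induction m using Submodule.Quotient.induction_on with
    | H x =>
      obtain ⟨e, he, hx⟩ := X.homogeneous t
      refine (Submodule.Quotient.mk_eq_zero I).mpr ?_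
      rw [pow_one]
      exact Ideal.mul_mem_right _ _ (hB e _ he hx)

/-- The case `I = 0`, with `R ⧸ 0` replaced by `R` itself. -/
theorem IsPositivelyGraded.exists_bound_self (h : IsPositivelyGraded 𝒜) :
    ∃ B : ℤ, ∀ (X : HomogeneousSystem 𝒜) (p : ℕ) (s : ℤ), B < s →
      X.Vanishes (selfGrading 𝒜) p (s - p) := by
  let _ := h.gradedAlgebra
  obtain ⟨B, hB⟩ := h.exists_bound_quotient ⊥ (Ideal.IsHomogeneous.bot 𝒜)
  refine ⟨B, fun X p s hs => ?_⟩
  have E : GradedExact (fun _ => (⊥ : Submodule K PUnit)) (selfGrading 𝒜)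
      (quotientGrading 𝒜 ⊥) (0 : PUnit →ₗ[R] R) (Submodule.mkQ (⊥ : Ideal R)) :=
    { map_left := fun _ => zero_mem _
      map_right := fun {k m} hm => ⟨m, hm, rfl⟩
      injective := fun _ _ => rfl
      comp_eq_zero := fun _ => map_zero _
      exact := fun {k m} _ h0 => ⟨0, zero_mem _,
        ((Submodule.mem_bot R).mp ((Submodule.Quotient.mk_eq_zero _).mp h0)).symm⟩
      surjective := by
        rintro k _ ⟨r, hr, rfl⟩
        exact ⟨r, hr, rfl⟩ }
  refine X.vanishes_middle (fun _ _ _ _ _ _ => Submodule.mem_bot K |>.mpr rfl)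
    (isGradedSMul_selfGrading 𝒜)
    (isGradedSMul_quotientGrading 𝒜 _) E (Function.injective_of_subsingleton _)
    (X.vanishes_of_subsingleton ?_) (hB X p s hs)
  have : ∀ T : {T : Finset (Fin X.n) // T.card = p},
      Subsingleton (LocalizedModule (X.mult T.1) PUnit) := fun T =>
    LocalizedModule.subsingleton_iff.mpr fun m => ⟨1, one_mem _, rfl⟩
  infer_instance

/-! ### The local regularity of the powers of `𝔪` -/

theorem localCohomologyVanishes_iff {M : Type*} [AddCommGroup M] [Module K M] [Module R M]
    [IsScalarTower K R M] {ℳ : ℤ → Submodule K M} {i : ℕ} {j : ℤ} :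
    LocalCohomologyVanishes 𝒜 ℳ i j ↔ ∀ X : HomogeneousSystem 𝒜, X.Vanishes ℳ i j :=
  forall_congr' fun X => X.subsingleton_localCohomology_iff ℳ i j

theorem gradedExact_ideal (I : Ideal R) :
    GradedExact (idealGrading 𝒜 I) (selfGrading 𝒜) (quotientGrading 𝒜 I) I.subtype I.mkQ where
  map_left hm := hm
  map_right {k m} hm := ⟨m, hm, rfl⟩
  injective _ h0 := Subtype.ext h0
  comp_eq_zero m := (Submodule.Quotient.mk_eq_zero _).mpr m.2
  exact {k m} hm h0 := ⟨⟨m, (Submodule.Quotient.mk_eq_zero _).mp h0⟩, hm, rfl⟩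
  surjective := by
    rintro k _ ⟨r, hr, rfl⟩
    exact ⟨r, hr, rfl⟩

/-- The sequence `0 → 𝔪 ^ j → R → R ⧸ 𝔪 ^ j → 0` identifies the local cohomology of `𝔪 ^ j` with
that of `R`, except that `H^1` grows by `R ⧸ 𝔪 ^ j = H^0(R ⧸ 𝔪 ^ j)`. -/
theorem IsPositivelyGraded.vanishes_maxIdeal_pow_iff (h : IsPositivelyGraded 𝒜) {a : R}
    (ham : a ∈ maxIdeal 𝒜) (hreg : IsSMulRegular R a) (j : ℕ) (X : HomogeneousSystem 𝒜) (p : ℕ)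
    (k : ℤ) : X.Vanishes (idealGrading 𝒜 (maxIdeal 𝒜 ^ j)) p k ↔
      X.Vanishes (selfGrading 𝒜) p k ∧
        (p = 1 → quotientGrading 𝒜 (maxIdeal 𝒜 ^ j) k = ⊥) := by
  let _ := h.gradedAlgebra
  have := h.nontrivial
  have h' := isGradedSMul_idealGrading 𝒜 (maxIdeal 𝒜 ^ j)
  have h0 := isGradedSMul_selfGrading 𝒜
  have h'' := isGradedSMul_quotientGrading 𝒜 (maxIdeal 𝒜 ^ j)
  have E := gradedExact_ideal (𝒜 := 𝒜) (maxIdeal 𝒜 ^ j)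
  have hinj : Function.Injective (maxIdeal 𝒜 ^ j).subtype := Subtype.val_injective
  have hsub : ∀ {q : ℕ}, q ≠ 0 → Subsingleton (X.Cochain (R ⧸ maxIdeal 𝒜 ^ j) q) := by
    intro q hq
    refine X.subsingleton_cochain hq fun t m => ⟨j, ?_⟩
    induction m using Submodule.Quotient.induction_on with
    | H x =>
      refine (Submodule.Quotient.mk_eq_zero _).mpr ?_
      exact Ideal.mul_mem_right _ _ (Ideal.pow_mem_pow (X.x_mem_maxIdeal t) j)
  constructor
  · intro hv
    refine ⟨?_, ?_⟩
    · rcases Nat.eq_zero_or_pos p with rfl | hp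
      · rw [HomogeneousSystem.vanishes_iff]
        intro c _ hdc
        rw [X.eq_zero_of_cechD_eq_zero ham hreg hdc]
        exact zero_mem _
      · exact X.vanishes_middle h' h0 h'' E hinj hv (X.vanishes_of_subsingleton (hsub hp.ne'))
    · rintro rfl
      rw [eq_bot_iff]
      rintro _ ⟨r, hr, rfl⟩
      -- the image of the constant cochain `r` under the connecting map
      let b : X.Cochain R 0 := fun _ => LocalizedModule.mk r 1
      have hb : b ∈ X.cochainDegree (selfGrading 𝒜) 0 k := by
        rw [HomogeneousSystem.mem_cochainDegree]
        intro T
        exact (HomogeneousSystem.mem_localizedDegree_iff h0).mpr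
          ⟨0, 1, r, SetLike.one_mem_graded 𝒜, by simpa using hr, rfl⟩
      obtain ⟨c', hc', hfc'⟩ := X.cochain_lift_of_exact h' h0 E (X.cechD_mem h0 hb)
        ((hsub one_ne_zero).elim _ _)
      obtain ⟨b', hb', hdb'⟩ := X.vanishes_iff.mp hv c' hc' (by
        apply X.cochainMap_injective hinj
        rw [← X.cechD_cochainMap, hfc', X.cechD_cechD, map_zero])
      have hbb' : X.cochainMap (maxIdeal 𝒜 ^ j).subtype 0 b' = b := by
        rw [← sub_eq_zero]
        refine X.eq_zero_of_cechD_eq_zero ham hreg ?_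
        rw [map_sub, X.cechD_cochainMap, hdb', hfc', sub_self]
      have hgb : X.cochainMap (maxIdeal 𝒜 ^ j).mkQ 0 b = 0 := by
        rw [← hbb', X.cochainMap_cochainMap E]
      have hgb0 := congrFun hgb ⟨∅, rfl⟩
      rw [X.cochainMap_apply, X.localizedMap_mk, Pi.zero_apply, X.mk_empty_eq_zero_iff] at hgb0
      exact (Submodule.mem_bot K).mpr hgb0
  · rintro ⟨hv, h1⟩
    rw [HomogeneousSystem.vanishes_iff] at hv ⊢
    intro c hc hdc
    refine X.mem_coboundaries_of_map h' h0 h'' E hinj ?_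
      (hv _ (X.cochainMap_left_mem h' h0 E hc) (by rw [X.cechD_cochainMap, hdc, map_zero]))
    rintro q rfl
    rcases Nat.eq_zero_or_pos q with rfl | hq
    · rw [HomogeneousSystem.vanishes_iff]
      intro c hc _
      rw [X.cochain_eq_zero_of_eq_bot h'' (h1 rfl) hc]
      exact zero_mem _
    · exact X.vanishes_of_subsingleton (hsub hq.ne')

theorem IsPositivelyGraded.regL_self_ne_top (h : IsPositivelyGraded 𝒜) :
    regL 𝒜 (selfGrading 𝒜) ≠ ⊤ := by
  obtain ⟨B, hB⟩ := h.exists_bound_self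
  exact intInf_ne_top_iff.mpr
    ⟨B, fun i s hs => localCohomologyVanishes_iff.mpr fun X => hB X i s hs⟩

theorem IsStandardGraded.regL_maxIdeal_pow (h : IsStandardGraded 𝒜) (hdepth : 0 < depth 𝒜)
    (hpos : 0 < regL 𝒜 (selfGrading 𝒜)) (j : ℕ) :
    regL 𝒜 (idealGrading 𝒜 (maxIdeal 𝒜 ^ j)) = max (j : EReal) (regL 𝒜 (selfGrading 𝒜)) := by
  let _ := h.gradedAlgebra
  obtain ⟨a, ham, hreg⟩ := exists_regular_of_depth_pos hdepth
  have hiff : ∀ (i : ℕ) (k : ℤ),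
      LocalCohomologyVanishes 𝒜 (idealGrading 𝒜 (maxIdeal 𝒜 ^ j)) i k ↔
        ∀ X : HomogeneousSystem 𝒜, X.Vanishes (selfGrading 𝒜) i k ∧
          (i = 1 → quotientGrading 𝒜 (maxIdeal 𝒜 ^ j) k = ⊥) := by
    intro i k
    rw [localCohomologyVanishes_iff]
    exact forall_congr' fun X => h.vanishes_maxIdeal_pow_iff ham hreg j X i k
  -- a system exists, since otherwise the regularity of `R` would be `-∞`
  have hX : Nonempty (HomogeneousSystem 𝒜) := by
    by_contra hne
    rw [not_nonempty_iff] at hne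
    have h1 : regL 𝒜 (selfGrading 𝒜) ≤ (((0 : ℤ) : ℝ) : EReal) := by
      refine (intInf_le_intCast_iff (isUpperSet_setOf_forall_lt _) _).mpr ?_
      exact fun i s _ X => hne.elim X
    simp only [Int.cast_zero, EReal.coe_zero] at h1
    exact absurd hpos (not_lt.mpr h1)
  have hcast : (j : EReal) = (((j : ℤ) : ℝ) : EReal) := by norm_cast
  have hQ : ∀ k : ℤ, (j : ℤ) ≤ k → quotientGrading 𝒜 (maxIdeal 𝒜 ^ j) k = ⊥ := by
    intro k hk
    rw [eq_bot_iff]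
    rintro _ ⟨r, hr, rfl⟩
    lift k to ℕ using (by omega)
    refine (Submodule.mem_bot K).mpr ((Submodule.Quotient.mk_eq_zero _).mpr ?_)
    exact h.mem_maxIdeal_pow (by exact_mod_cast hk) hr
  rcases Nat.eq_zero_or_pos j with rfl | hj
  · have hQ0 : ∀ k : ℤ, quotientGrading 𝒜 (maxIdeal 𝒜 ^ 0) k = ⊥ := by
      intro k
      rw [eq_bot_iff]
      rintro _ ⟨r, hr, rfl⟩
      exact (Submodule.mem_bot K).mpr ((Submodule.Quotient.mk_eq_zero _).mpr (by simp))
    rw [Nat.cast_zero, max_eq_right hpos.le, regL, regL]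
    congr 1
    ext r
    refine forall_congr' fun i => forall_congr' fun s => imp_congr_right fun _ => ?_
    rw [hiff, localCohomologyVanishes_iff]
    exact forall_congr' fun X => and_iff_left fun _ => hQ0 _
  · rw [hcast, regL, regL, ← intInf_inter_Ici (isUpperSet_setOf_forall_lt _)]
    congr 1
    ext r
    simp only [hiff, Set.mem_ofPred_eq, Set.mem_inter_iff, Set.mem_Ici, localCohomologyVanishes_iff]
    constructor
    · intro hr
      refine ⟨fun i s hs X => (hr i s hs X).1, ?_⟩
      by_contra! hlt
      obtain ⟨X⟩ := hX
      -- `(R ⧸ 𝔪 ^ j)_{j-1} = R_{j-1} ≠ 0`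
      obtain ⟨x, hx, hx0⟩ := h.exists_ne_zero ham hreg (j - 1)
      have h1 := (hr 1 j hlt X).2 rfl
      rw [show (j : ℤ) - (1 : ℕ) = ((j - 1 : ℕ) : ℤ) by omega] at h1
      have h2 : Submodule.Quotient.mk x ∈ quotientGrading 𝒜 (maxIdeal 𝒜 ^ j) ((j - 1 : ℕ) : ℤ) :=
        ⟨x, hx, rfl⟩
      rw [h1, Submodule.mem_bot, Submodule.Quotient.mk_eq_zero] at h2
      exact hx0 (eq_zero_of_mem_maxIdeal_pow (k := ((j - 1 : ℕ) : ℤ)) (by omega) h2 hx)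
    · rintro ⟨hr, hjr⟩ i s hs X
      refine ⟨hr i s hs X, ?_⟩
      rintro rfl
      exact hQ _ (by push_cast; omega)

end LocalCohomology

section Resolution

variable {K : Type u} [Field K] {R : Type v} [CommRing R] [Algebra K R]
  {𝒜 : ℕ → Submodule K R}

/-! ### Existence of graded free resolutions -/

variable (𝒜) in
/-- A submodule `L` of the graded free module `⨁_a R(-deg a)` is graded. -/
def IsGradedSubmodule [GradedAlgebra 𝒜] {m : ℕ} (deg : Fin m → ℤ)
    (L : Submodule R (Fin m → R)) : Prop :=
  ∀ v ∈ L, ∀ j : ℤ, (fun a => intProj 𝒜 (j - deg a) (v a)) ∈ L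

theorem isGradedSubmodule_ker [GradedAlgebra 𝒜] {m p : ℕ} {deg : Fin m → ℤ} {deg' : Fin p → ℤ}
    {D : Matrix (Fin m) (Fin p) R} (hD : ∀ a c, D a c ∈ selfGrading 𝒜 (deg' c - deg a)) :
    IsGradedSubmodule 𝒜 deg' (LinearMap.ker D.mulVecLin) := by
  intro v hv j
  rw [LinearMap.mem_ker, Matrix.mulVecLin_apply] at hv ⊢
  ext a
  have h1 := congrArg (intProj 𝒜 (j - deg a)) (congrFun hv a)
  rw [Matrix.mulVec, dotProduct, map_sum, Pi.zero_apply, map_zero] at h1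
  rw [Matrix.mulVec, dotProduct, Pi.zero_apply, ← h1]
  refine Finset.sum_congr rfl fun c _ => ?_
  rw [intProj_mul_of_left_mem (hD a c), sub_sub_sub_cancel_right]

/-- A graded submodule of a graded free module over a Noetherian graded ring is the image of a
homogeneous matrix. -/
theorem exists_matrix_range_eq [GradedAlgebra 𝒜] [IsNoetherianRing R] {m : ℕ} {deg : Fin m → ℤ}
    {L : Submodule R (Fin m → R)} (hL : IsGradedSubmodule 𝒜 deg L) :
    ∃ (p : ℕ) (deg' : Fin p → ℤ) (D : Matrix (Fin m) (Fin p) R),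
      (∀ a c, D a c ∈ selfGrading 𝒜 (deg' c - deg a)) ∧ LinearMap.range D.mulVecLin = L := by
  let H : Set (Fin m → R) := {v | v ∈ L ∧ ∃ j : ℤ, ∀ a, v a ∈ selfGrading 𝒜 (j - deg a)}
  have hspan : Submodule.span R H = L := by
    apply le_antisymm
    · rw [Submodule.span_le]
      exact fun v hv => hv.1
    · intro v hv
      choose N hN using fun a => exists_sum_intProj (𝒜 := 𝒜) (deg a) (v a)
      obtain ⟨N', hN'⟩ := (Set.finite_range N).bddAbove
      have hsum : v = ∑ j ∈ Finset.Icc (-N') N', fun a => intProj 𝒜 (j - deg a) (v a) := by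
        ext a
        rw [Finset.sum_apply, hN a N' (hN' ⟨a, rfl⟩)]
      rw [hsum]
      exact Submodule.sum_mem _ fun j _ =>
        Submodule.subset_span ⟨hL v hv j, j, fun a => intProj_mem _ _⟩
  obtain ⟨S, hSH, hS⟩ := (Submodule.fg_span_iff_fg_span_finset_subset H).mp
    (IsNoetherian.noetherian (Submodule.span R H))
  let ε := S.equivFin
  have hH : ∀ c : Fin S.card, ((ε.symm c : S) : Fin m → R) ∈ H := fun c => hSH (ε.symm c).2
  choose hmem deg' hdeg' using hH
  refine ⟨S.card, deg', Matrix.of fun a c => (ε.symm c : Fin m → R) a, fun a c => hdeg' c a, ?_⟩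
  rw [Matrix.range_mulVecLin, ← hspan, hS]
  congr 1
  ext v
  constructor
  · rintro ⟨c, rfl⟩
    exact (ε.symm c).2
  · intro hv
    refine ⟨ε ⟨v, hv⟩, ?_⟩
    ext a
    simp [Matrix.col]

variable (𝒜) in
/-- A graded free module of finite rank together with a graded submodule, to be covered by the next
term of a resolution. -/
structure ResolutionStage [GradedAlgebra 𝒜] where
  rank : ℕ
  deg : Fin rank → ℤ
  sub : Submodule R (Fin rank → R)
  graded : IsGradedSubmodule 𝒜 deg sub

namespace ResolutionStage

variable [GradedAlgebra 𝒜] [IsNoetherianRing R] (L : ResolutionStage 𝒜)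

/-- The number of homogeneous generators chosen for `L.sub`. -/
def nextRank : ℕ := (exists_matrix_range_eq L.graded).choose

/-- The degrees of the homogeneous generators chosen for `L.sub`. -/
def nextDeg : Fin L.nextRank → ℤ := (exists_matrix_range_eq L.graded).choose_spec.choose

/-- The matrix whose columns are the homogeneous generators chosen for `L.sub`. -/
def matrix : Matrix (Fin L.rank) (Fin L.nextRank) R :=
  (exists_matrix_range_eq L.graded).choose_spec.choose_spec.choose

theorem matrix_mem (a : Fin L.rank) (c : Fin L.nextRank) :
    L.matrix a c ∈ selfGrading 𝒜 (L.nextDeg c - L.deg a) :=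
  (exists_matrix_range_eq L.graded).choose_spec.choose_spec.choose_spec.1 a c

theorem range_matrix : LinearMap.range L.matrix.mulVecLin = L.sub :=
  (exists_matrix_range_eq L.graded).choose_spec.choose_spec.choose_spec.2

/-- The free module on the chosen generators, with the module of syzygies. -/
def next : ResolutionStage 𝒜 where
  rank := L.nextRank
  deg := L.nextDeg
  sub := LinearMap.ker L.matrix.mulVecLin
  graded := isGradedSubmodule_ker L.matrix_mem

/-- The sequence of iterated syzygies. -/
def stage : ℕ → ResolutionStage 𝒜
  | 0 => L
  | i + 1 => (stage i).next

end ResolutionStage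

theorem IsPositivelyGraded.nonempty_resolution (h : IsPositivelyGraded 𝒜) :
    Nonempty (GradedFreeResolution 𝒜 (quotientGrading 𝒜 (maxIdeal 𝒜))) := by
  let _ := h.gradedAlgebra
  have := h.noetherian
  let aug : Fin 1 → R ⧸ maxIdeal 𝒜 := fun _ => Ideal.Quotient.mk _ 1
  have haug : ∀ v, Fintype.linearCombination R aug v = Ideal.Quotient.mk _ (v 0) := by
    intro v
    rw [Fintype.linearCombination_apply, Fin.sum_univ_one]
    change Ideal.Quotient.mk (maxIdeal 𝒜) (v 0 * 1) = _
    rw [mul_one]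
  let L : ResolutionStage 𝒜 :=
    { rank := 1
      deg := fun _ => 0
      sub := LinearMap.ker (Fintype.linearCombination R aug)
      graded := by
        intro v hv j
        rw [LinearMap.mem_ker, haug, Ideal.Quotient.eq_zero_iff_mem] at hv ⊢
        exact intProj_mem_of_isHomogeneous isHomogeneous_maxIdeal hv _ }
  exact ⟨
    { rank := fun i => (L.stage i).rank
      deg := fun i => (L.stage i).deg
      d := fun i => (L.stage i).matrix
      aug := aug
      d_mem := fun i a c => (L.stage i).matrix_mem a c
      aug_mem := fun _ => ⟨1, SetLike.one_mem_graded 𝒜, rfl⟩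
      aug_surjective := by
        intro y
        obtain ⟨r, rfl⟩ := Ideal.Quotient.mk_surjective y
        exact ⟨fun _ => r, haug _⟩
      exact_zero := LinearMap.exact_iff.mpr L.range_matrix.symm
      exact_succ := fun i => LinearMap.exact_iff.mpr (L.stage (i + 1)).range_matrix.symm }⟩

/-- `Tor_0(K, K)_0 ≠ 0`. -/
theorem GradedFreeResolution.not_vanishes_residueField (h : IsPositivelyGraded 𝒜)
    (F : GradedFreeResolution 𝒜 (quotientGrading 𝒜 (maxIdeal 𝒜))) :
    ¬ F.Vanishes (quotientGrading 𝒜 (maxIdeal 𝒜)) 0 0 := by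
  classical
  let _ := h.gradedAlgebra
  intro hvan
  obtain ⟨a, ha, hdeg⟩ := exists_aug_ne_zero (F := F) h
  let o : R ⧸ maxIdeal 𝒜 := Ideal.Quotient.mk _ 1
  obtain ⟨y, -, hdy⟩ := F.vanishes_iff.mp hvan (Pi.single a o) (by
    rw [mem_tensorDegree]
    intro a'
    by_cases h : a' = a
    · subst h
      rw [Pi.single_eq_same, hdeg, sub_zero]
      exact ⟨1, SetLike.one_mem_graded 𝒜, rfl⟩
    · rw [Pi.single_eq_of_ne h]
      exact zero_mem _) trivial
  apply ha
  have h1 : F.aug a = ∑ a', (Pi.single a o : Fin (F.rank 0) → R ⧸ maxIdeal 𝒜) a' * F.aug a' := by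
    rw [Finset.sum_eq_single a]
    · rw [Pi.single_eq_same]
      exact (one_mul _).symm
    · intro b _ hb
      rw [Pi.single_eq_of_ne hb, zero_mul]
    · simp
  rw [h1, ← hdy]
  simp only [tensorD_apply, Finset.sum_mul, smul_mul_assoc]
  rw [Finset.sum_comm]
  refine Finset.sum_eq_zero fun c _ => ?_
  have h2 := congrArg (fun z => y c * z) (F.sum_smul_aug_d c)
  simpa [Finset.mul_sum] using h2

/-- To check that a standard graded algebra is Koszul, it suffices to bound the degrees of
`Tor(K, K)` above; the other inequality is automatic. -/
theorem IsStandardGraded.isKoszul (h : IsStandardGraded 𝒜)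
    (hF : ∀ (F : GradedFreeResolution 𝒜 (quotientGrading 𝒜 (maxIdeal 𝒜))) (i : ℕ) (s : ℤ),
      0 < s → F.Vanishes (quotientGrading 𝒜 (maxIdeal 𝒜)) i (i + s)) : IsKoszul 𝒜 where
  toIsStandardGraded := h
  regT_eq_zero := by
    have hcast : (0 : EReal) = (((0 : ℤ) : ℝ) : EReal) := by simp
    rw [hcast]
    apply le_antisymm
    · exact (intInf_le_intCast_iff (isUpperSet_setOf_forall_lt _) _).mpr
        fun i s hs => torVanishes_iff.mpr fun F => hF F i s hs
    · refine le_intInf_iff.mpr fun n hn => ?_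
      by_contra! hlt
      have hlt' : n < 0 := by exact_mod_cast hlt
      obtain ⟨F⟩ := h.toIsPositivelyGraded.nonempty_resolution
      refine F.not_vanishes_residueField h.toIsPositivelyGraded ?_
      simpa using torVanishes_iff.mp (hn 0 0 hlt') F

end Resolution

section Veronese

open MvPolynomial

attribute [local instance] MvPolynomial.gradedAlgebra

variable {K : Type u} [Field K] {n d : ℕ}

/-! ### Veronese subrings are standard graded -/

/-- The term `c x^a`, as an element of the Veronese subring. -/
def veroneseMonomial (a : Fin n →₀ ℕ) (c : K) (h : d ∣ a.degree) : veronese K n d :=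
  ⟨monomial a c, fun m hm => by
    have := support_monomial_subset hm
    rw [Finset.mem_singleton] at this
    rwa [this]⟩

theorem coe_veroneseMonomial (a : Fin n →₀ ℕ) (c : K) (h : d ∣ a.degree) :
    (veroneseMonomial a c h : MvPolynomial (Fin n) K) = monomial a c := rfl

theorem mem_veroneseGrading {i : ℕ} {f : veronese K n d} :
    f ∈ veroneseGrading K n d i ↔ (f : MvPolynomial (Fin n) K).IsHomogeneous (i * d) :=
  Iff.rfl

theorem veroneseMonomial_mem {a : Fin n →₀ ℕ} (c : K) {i : ℕ} (ha : a.degree = i * d) :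
    veroneseMonomial a c (Dvd.intro_left i ha.symm) ∈ veroneseGrading K n d i :=
  isHomogeneous_monomial c ha

theorem degree_eq_of_mem_support {f : MvPolynomial (Fin n) K} {D : ℕ} (hf : f.IsHomogeneous D)
    {m : Fin n →₀ ℕ} (hm : m ∈ f.support) : m.degree = D := by
  by_contra h
  exact mem_support_iff.mp hm (hf.coeff_eq_zero h)

theorem mem_veronese_of_isHomogeneous {f : MvPolynomial (Fin n) K} {i : ℕ}
    (hf : f.IsHomogeneous (i * d)) : f ∈ veronese K n d := by
  intro m hm
  rw [degree_eq_of_mem_support hf hm]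
  exact Dvd.intro_left i rfl

/-- Additive subgroups of the Veronese subring can be tested on monomials. -/
theorem mem_of_veroneseMonomial_mem {S : Type*} [SetLike S (veronese K n d)]
    [AddSubmonoidClass S (veronese K n d)] {W : S} {f : veronese K n d}
    (h : ∀ m (hm : m ∈ (f : MvPolynomial (Fin n) K).support),
      veroneseMonomial m (coeff m (f : MvPolynomial (Fin n) K)) (f.2 m hm) ∈ W) : f ∈ W := by
  have hf : f = ∑ m ∈ (f : MvPolynomial (Fin n) K).support.attach,
      veroneseMonomial m.1 (coeff m.1 (f : MvPolynomial (Fin n) K)) (f.2 m.1 m.2) := by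
    apply Subtype.ext
    rw [AddSubmonoidClass.coe_finsetSum]
    simp only [coe_veroneseMonomial]
    rw [Finset.sum_attach (f := fun m => monomial m (coeff m (f : MvPolynomial (Fin n) K))),
      support_sum_monomial_coeff]
  rw [hf]
  exact sum_mem fun m _ => h m.1 m.2

instance veroneseGrading_gradedMonoid : SetLike.GradedMonoid (veroneseGrading K n d) where
  one_mem := by
    rw [mem_veroneseGrading, zero_mul]
    exact isHomogeneous_one _ _
  mul_mem i j f g hf hg := by
    rw [mem_veroneseGrading] at *
    rw [add_mul]
    exact hf.mul hg

theorem isInternal_veroneseGrading (hd : 0 < d) : DirectSum.IsInternal (veroneseGrading K n d) := by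
  rw [DirectSum.isInternal_submodule_iff_iSupIndep_and_iSup_eq_top]
  constructor
  · intro i
    rw [Submodule.disjoint_def]
    intro f hf hf'
    let W := LinearMap.ker ((homogeneousComponent (σ := Fin n) (R := K) (i * d)) ∘ₗ
      (veronese K n d).val.toLinearMap)
    have hW : ⨆ j, ⨆ (_ : j ≠ i), veroneseGrading K n d j ≤ W := by
      refine iSup₂_le fun j hj g hg => ?_
      refine (homogeneousComponent_of_mem (m := i * d) (n := j * d) hg).trans (if_neg ?_)
      exact fun h => hj (Nat.eq_of_mul_eq_mul_right hd h).symm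
    have h1 : homogeneousComponent (i * d) (f : MvPolynomial (Fin n) K) = 0 := hW hf'
    rw [homogeneousComponent_of_mem (n := i * d) (p := (f : MvPolynomial (Fin n) K)) hf,
      if_pos rfl] at h1
    exact Subtype.ext h1
  · rw [eq_top_iff]
    intro f _
    refine mem_of_veroneseMonomial_mem fun m hm => ?_
    obtain ⟨i, hi⟩ := f.2 m hm
    exact Submodule.mem_iSup_of_mem i
      (veroneseMonomial_mem _ (hi.trans (mul_comm _ _)))

theorem exists_le_degree_eq {a : Fin n →₀ ℕ} {e : ℕ} (he : e ≤ a.degree) :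
    ∃ b ≤ a, b.degree = e := by
  induction e with
  | zero => exact ⟨0, zero_le, map_zero _⟩
  | succ e ih =>
    obtain ⟨b, hba, rfl⟩ := ih (by omega)
    have hlt : ∃ i, b i < a i := by
      by_contra! h
      have : a = b := le_antisymm h hba
      rw [this] at he
      omega
    obtain ⟨i, hi⟩ := hlt
    refine ⟨b + Finsupp.single i 1, fun j => ?_, by rw [map_add, Finsupp.degree_single]⟩
    rw [Finsupp.add_apply]
    by_cases hj : j = i
    · subst hj
      rw [Finsupp.single_eq_same]
      exact hi
    · rw [Finsupp.single_eq_of_ne hj, add_zero]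
      exact hba j

theorem adjoin_veroneseMonomial :
    Algebra.adjoin K (Set.range fun a : {a : Fin n →₀ ℕ // a.degree = d} =>
      veroneseMonomial (K := K) (d := d) a.1 1 a.2.symm.dvd) = ⊤ := by
  rw [eq_top_iff]
  intro f _
  refine mem_of_veroneseMonomial_mem fun m hm => ?_
  obtain ⟨k, hk⟩ := f.2 m hm
  generalize coeff m (f : MvPolynomial (Fin n) K) = c
  have key : ∀ (k : ℕ) (m : Fin n →₀ ℕ) (hm : m.degree = d * k) (c : K),
      veroneseMonomial m c (Dvd.intro k hm.symm) ∈
        Algebra.adjoin K (Set.range fun a : {a : Fin n →₀ ℕ // a.degree = d} =>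
          veroneseMonomial (K := K) (d := d) a.1 1 a.2.symm.dvd) := by
    intro k
    induction k with
    | zero =>
      intro m hm c
      rw [mul_zero, Finsupp.degree_eq_zero_iff] at hm
      subst hm
      exact Subalgebra.algebraMap_mem _ c
    | succ k ih =>
      intro m hm c
      obtain ⟨b, hbm, hb⟩ := exists_le_degree_eq (a := m) (e := d)
        (by rw [hm]; exact Nat.le_mul_of_pos_right d k.succ_pos)
      obtain ⟨m', rfl⟩ := exists_add_of_le hbm
      have hm' : m'.degree = d * k := by
        rw [map_add, hb, mul_add, mul_one] at hm
        omega
      have hmul : veroneseMonomial (b + m') c (Dvd.intro (k + 1) hm.symm)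
          = veroneseMonomial (d := d) b 1 hb.symm.dvd
            * veroneseMonomial m' c (Dvd.intro k hm'.symm) := by
        apply Subtype.ext
        rw [MulMemClass.coe_mul]
        simp only [coe_veroneseMonomial]
        rw [monomial_mul, one_mul]
      rw [hmul]
      exact mul_mem (Algebra.subset_adjoin ⟨⟨b, hb⟩, rfl⟩) (ih m' hm' c)
  exact key k m hk c

theorem isStandardGraded_veronese (hd : 0 < d) : IsStandardGraded (veroneseGrading K n d) where
  noetherian := by
    have : Finite {a : Fin n →₀ ℕ // a.degree = d} := Finsupp.finite_of_degree_eq d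
    have : Algebra.FiniteType K (veronese K n d) :=
      ⟨Subalgebra.fg_def.mpr ⟨_, Set.finite_range _, adjoin_veroneseMonomial⟩⟩
    exact Algebra.FiniteType.isNoetherianRing K _
  nontrivial := inferInstance
  gradedMonoid := inferInstance
  internal := isInternal_veroneseGrading hd
  zero_eq := by
    apply le_antisymm
    · intro f hf
      rw [mem_veroneseGrading, zero_mul, ← mem_homogeneousSubmodule, homogeneousSubmodule_zero,
        Submodule.mem_one] at hf
      obtain ⟨c, hc⟩ := hf
      exact Submodule.mem_one.mpr ⟨c, Subtype.ext hc⟩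
    · rw [Submodule.one_le]
      exact SetLike.one_mem_graded _
  adjoin_eq_top := by
    rw [eq_top_iff, ← adjoin_veroneseMonomial]
    refine Algebra.adjoin_mono ?_
    rintro _ ⟨a, rfl⟩
    exact veroneseMonomial_mem _ (by rw [a.2, one_mul])

/-! ### Veronese modules and the Koszul property -/

/-- The Veronese module `⨁_{i ≥ 0} (S ⧸ I)_{id + c}` over `S^{(d)}`, as a family of subspaces of
`S ⧸ I`. -/
def veroneseModule (d : ℕ) (I : Ideal (MvPolynomial (Fin n) K)) (c : ℤ) (i : ℤ) :
    Submodule K (MvPolynomial (Fin n) K ⧸ I) :=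
  if 0 ≤ i then quotientGrading (homogeneousSubmodule (Fin n) K) I (i * d + c) else ⊥

theorem isGradedSMul_veroneseModule (I : Ideal (MvPolynomial (Fin n) K)) (c : ℤ) :
    IsGradedSMul (veroneseGrading K n d) (veroneseModule d I c) := by
  intro e k a m ha hm
  unfold veroneseModule at hm ⊢
  split_ifs at hm with hk
  · rw [if_pos (by omega)]
    have := isGradedSMul_quotientGrading (homogeneousSubmodule (Fin n) K) I
      (e := e * d) (a := (a : MvPolynomial (Fin n) K)) ha hm
    rw [show k * d + c + ((e * d : ℕ) : ℤ) = (k + e) * d + c by push_cast; ring] at this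
    exact this
  · rw [(Submodule.mem_bot K).mp hm, smul_zero]
    exact zero_mem _

/-- For `c = 0` the module `⨁_i S_{id + c - 1}` starts in degree `1`. -/
theorem veroneseModule_neg_one (hd : 0 < d) (I : Ideal (MvPolynomial (Fin n) K)) (i : ℤ) :
    veroneseModule d I (-1) i = shift (veroneseModule d I ((d - 1 : ℕ) : ℤ)) 1 i := by
  simp only [veroneseModule, shift]
  have hcast : ((d - 1 : ℕ) : ℤ) = d - 1 := by omega
  rcases lt_trichotomy i 0 with h | rfl | h
  · rw [if_neg (by omega), if_neg (by omega)]
  · rw [if_pos le_rfl, if_neg (by omega), quotientGrading, selfGrading_of_neg (by omega),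
      Submodule.map_bot]
  · rw [if_pos (by omega), if_pos (by omega), hcast]
    congr 1
    ring

variable (K n) in
/-- The ideal `(x_1, …, x_k)` of `S`. -/
def variableIdeal (k : ℕ) : Ideal (MvPolynomial (Fin n) K) :=
  Ideal.span (X '' {i : Fin n | i.val < k})

theorem mem_variableIdeal {k : ℕ} {f : MvPolynomial (Fin n) K} :
    f ∈ variableIdeal K n k ↔ ∀ m ∈ f.support, ∃ i : Fin n, i.val < k ∧ m i ≠ 0 :=
  mem_ideal_span_X_image

theorem variableIdeal_zero : variableIdeal K n 0 = ⊥ := by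
  simp [variableIdeal]

theorem variableIdeal_succ (k : Fin n) :
    variableIdeal K n (k + 1) = variableIdeal K n k ⊔ Ideal.span {X k} := by
  rw [variableIdeal, variableIdeal, ← Ideal.span_union, ← Set.image_singleton, ← Set.image_union]
  congr 2
  ext i
  simp only [Set.mem_ofPred_eq, Set.mem_union, Set.mem_singleton_iff, Fin.ext_iff]
  omega

theorem isHomogeneous_variableIdeal (k : ℕ) :
    (variableIdeal K n k).IsHomogeneous (homogeneousSubmodule (Fin n) K) := by
  refine Ideal.homogeneous_span _ _ ?_
  rintro _ ⟨i, -, rfl⟩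
  exact ⟨1, isHomogeneous_X K i⟩

/-- `x_{k+1}` is a nonzerodivisor modulo `(x_1, …, x_k)`. -/
theorem variableIdeal_eq_comap (k : Fin n) :
    variableIdeal K n k = Submodule.comap (LinearMap.mulLeft _ (X k)) (variableIdeal K n k) := by
  apply le_antisymm
  · exact fun f hf => Ideal.mul_mem_left _ _ hf
  · intro f hf
    have hf : X k * f ∈ variableIdeal K n k := hf
    rw [mem_variableIdeal] at hf ⊢
    intro m hm
    obtain ⟨i, hi, hmi⟩ := hf (Finsupp.single k 1 + m) (by
      rw [mem_support_iff, coeff_X_mul]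
      exact mem_support_iff.mp hm)
    refine ⟨i, hi, ?_⟩
    rwa [Finsupp.add_apply, Finsupp.single_eq_of_ne (by rintro rfl; omega), zero_add] at hmi

/-- Selecting every `d`-th component of an exact sequence over `S`. -/
theorem GradedExact.veroneseModule {I J L : Ideal (MvPolynomial (Fin n) K)}
    {f : (MvPolynomial (Fin n) K ⧸ I) →ₗ[MvPolynomial (Fin n) K] (MvPolynomial (Fin n) K ⧸ J)}
    {g : (MvPolynomial (Fin n) K ⧸ J) →ₗ[MvPolynomial (Fin n) K] (MvPolynomial (Fin n) K ⧸ L)}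
    (E : GradedExact (shift (quotientGrading (homogeneousSubmodule (Fin n) K) I) (1 : ℕ))
      (quotientGrading (homogeneousSubmodule (Fin n) K) J)
      (quotientGrading (homogeneousSubmodule (Fin n) K) L) f g) (c : ℤ) :
    GradedExact (veroneseModule d I (c - 1)) (veroneseModule d J c) (veroneseModule d L c)
      (f.restrictScalars (veronese K n d)) (g.restrictScalars (veronese K n d)) := by
  have hshift : ∀ i : ℤ, quotientGrading (homogeneousSubmodule (Fin n) K) I (i * d + (c - 1))
      = shift (quotientGrading (homogeneousSubmodule (Fin n) K) I) (1 : ℕ) (i * d + c) := by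
    intro i
    rw [shift]
    congr 1
    push_cast
    ring
  constructor <;> simp only [GradedReg.veroneseModule, hshift, LinearMap.coe_restrictScalars] <;>
    intro i <;> try split_ifs
  · exact E.map_left
  · intro hm
    rw [(Submodule.mem_bot K).mp hm, map_zero]
    exact zero_mem _
  · exact E.map_right
  · intro hm
    rw [(Submodule.mem_bot K).mp hm, map_zero]
    exact zero_mem _
  · exact E.injective
  · exact fun hm _ => (Submodule.mem_bot K).mp hm
  · exact E.comp_eq_zero i
  · exact E.exact
  · exact fun hm _ => ⟨0, zero_mem _, by rw [map_zero, (Submodule.mem_bot K).mp hm]⟩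
  · exact E.surjective
  · exact fun hm => ⟨0, zero_mem _, by rw [map_zero, (Submodule.mem_bot K).mp hm]⟩

/-- The exact sequences of Veronese modules given by multiplication by a variable. -/
theorem exists_gradedExact_veroneseModule (k : Fin n) (c : ℤ) :
    ∃ (f : (MvPolynomial (Fin n) K ⧸ variableIdeal K n k) →ₗ[veronese K n d]
        (MvPolynomial (Fin n) K ⧸ variableIdeal K n k))
      (g : (MvPolynomial (Fin n) K ⧸ variableIdeal K n k) →ₗ[veronese K n d]
        (MvPolynomial (Fin n) K ⧸ variableIdeal K n (k + 1))),
      GradedExact (veroneseModule d (variableIdeal K n k) (c - 1))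
        (veroneseModule d (variableIdeal K n k) c)
        (veroneseModule d (variableIdeal K n (k + 1)) c) f g := by
  rw [variableIdeal_succ]
  exact ⟨_, _, (gradedExact_colon (isHomogeneous_variableIdeal (K := K) (n := n) k)
    (isHomogeneous_X K k) (variableIdeal_eq_comap k)).veroneseModule c⟩

theorem mem_variableIdeal_of_isHomogeneous {f : MvPolynomial (Fin n) K} {D : ℕ} (hD : 0 < D)
    (hf : f.IsHomogeneous D) : f ∈ variableIdeal K n n := by
  rw [mem_variableIdeal]
  intro m hm
  by_contra! h0
  have hm0 : m = 0 := Finsupp.ext fun i => h0 i i.2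
  have := degree_eq_of_mem_support hf hm
  rw [hm0, map_zero] at this
  omega

theorem eq_zero_of_mem_variableIdeal {f : MvPolynomial (Fin n) K} {k : ℕ}
    (hf : f.IsHomogeneous 0) (hfI : f ∈ variableIdeal K n k) : f = 0 := by
  rw [mem_variableIdeal] at hfI
  rw [← support_eq_empty, Finset.eq_empty_iff_forall_notMem]
  intro m hm
  obtain ⟨i, -, hi⟩ := hfI m hm
  have := degree_eq_of_mem_support hf hm
  rw [Finsupp.degree_eq_zero_iff] at this
  exact hi (by rw [this]; rfl)

theorem veroneseModule_top_eq_bot {c : ℕ} (hc : 0 < c) (i : ℤ) :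
    veroneseModule d (variableIdeal K n n) (c : ℤ) i = ⊥ := by
  unfold veroneseModule
  split_ifs with hi
  · rw [eq_bot_iff]
    rintro _ ⟨f, hf, rfl⟩
    lift i to ℕ using hi
    rw [show (i : ℤ) * d + c = ((i * d + c : ℕ) : ℤ) by push_cast; ring] at hf
    exact (Submodule.mem_bot K).mpr ((Submodule.Quotient.mk_eq_zero _).mpr
      (mem_variableIdeal_of_isHomogeneous (by omega) hf))
  · rfl

/-- Every element of a Veronese module `⨁_i (S ⧸ I)_{id}` comes from `S^{(d)}`. -/
theorem exists_of_mem_veroneseModule_zero {I : Ideal (MvPolynomial (Fin n) K)} {i : ℤ}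
    {m : MvPolynomial (Fin n) K ⧸ I} (hm : m ∈ veroneseModule d I 0 i) :
    ∃ r : veronese K n d, r ∈ selfGrading (veroneseGrading K n d) i ∧
      Submodule.Quotient.mk (r : MvPolynomial (Fin n) K) = m := by
  unfold veroneseModule at hm
  split_ifs at hm with hi
  · obtain ⟨f, hf, rfl⟩ := hm
    lift i to ℕ using hi
    have hf : f.IsHomogeneous (i * d) := by
      rw [show (i : ℤ) * d + 0 = ((i * d : ℕ) : ℤ) by push_cast; ring] at hf
      exact hf
    exact ⟨⟨f, mem_veronese_of_isHomogeneous hf⟩, hf, rfl⟩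
  · exact ⟨0, zero_mem _, ((Submodule.mem_bot K).mp hm).symm⟩

theorem mem_veroneseModule_zero {I : Ideal (MvPolynomial (Fin n) K)} {i : ℤ}
    {r : veronese K n d} (hr : r ∈ selfGrading (veroneseGrading K n d) i) :
    Submodule.Quotient.mk (r : MvPolynomial (Fin n) K) ∈ veroneseModule d I 0 i := by
  rcases lt_or_ge i 0 with hi | hi
  · rw [selfGrading_of_neg hi] at hr
    rw [(Submodule.mem_bot K).mp hr]
    exact zero_mem _
  · unfold veroneseModule
    rw [if_pos hi]
    lift i to ℕ using hi
    rw [show (i : ℤ) * d + 0 = ((i * d : ℕ) : ℤ) by push_cast; ring]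
    exact ⟨r, hr, rfl⟩

/-- The Veronese modules of `S ⧸ (x_1, …, x_k)` have linear resolutions over `S^{(d)}`: their
Tor with `K` in homological degree `i` vanishes in degrees `> i`. Induction on `i`; for fixed `i`
the case `c = 0` goes up from `k = 0`, and the case `c > 0` goes down from `k = n`. -/
theorem vanishes_veroneseModule (hd : 0 < d)
    (F : GradedFreeResolution (veroneseGrading K n d)
      (quotientGrading (veroneseGrading K n d) (maxIdeal (veroneseGrading K n d)))) (i : ℕ) :
    ∀ (c k : ℕ), k ≤ n → ∀ s : ℤ, 0 < s →
      F.Vanishes (veroneseModule d (variableIdeal K n k) (c : ℤ)) i (i + s) := by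
  let _ := (isStandardGraded_veronese (K := K) (n := n) hd).gradedAlgebra
  induction i using Nat.strong_induction_on with
  | _ i ih =>
  intro c
  induction c with
  | zero =>
    intro k
    induction k with
    | zero =>
      intro _ s hs
      let f : veronese K n d →ₗ[veronese K n d] (MvPolynomial (Fin n) K ⧸ variableIdeal K n 0) :=
        LinearMap.toSpanSingleton _ _ (Submodule.Quotient.mk 1)
      have hf : ∀ r, f r = Submodule.Quotient.mk (r : MvPolynomial (Fin n) K) := by
        intro r
        change Submodule.Quotient.mk ((r : MvPolynomial (Fin n) K) * 1) = _
        rw [mul_one]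
      have E : GradedExact (selfGrading (veroneseGrading K n d))
          (veroneseModule d (variableIdeal K n 0) 0)
          (fun _ => (⊥ : Submodule K PUnit)) f (0 : _ →ₗ[_] PUnit) :=
        { map_left := fun {k m} hm => by rw [hf]; exact mem_veroneseModule_zero hm
          map_right := fun _ => zero_mem _
          injective := fun {k m} _ h0 => by
            rw [hf, Submodule.Quotient.mk_eq_zero, variableIdeal_zero] at h0
            exact Subtype.ext h0
          comp_eq_zero := fun _ => rfl
          exact := fun {k m} hm _ => by
            obtain ⟨r, hr, hrm⟩ := exists_of_mem_veroneseModule_zero hm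
            exact ⟨r, hr, (hf r).trans hrm⟩
          surjective := fun _ => ⟨0, zero_mem _, rfl⟩ }
      exact F.vanishes_middle E (isGradedSMul_veroneseModule _ _) (isGradedSMul_selfGrading _)
        (F.vanishes_self i hs) (F.vanishes_of_eq_bot (fun _ => rfl) _ _)
    | succ k ihk =>
      intro hk s hs
      obtain ⟨f, g, E⟩ := exists_gradedExact_veroneseModule (K := K) (d := d) ⟨k, hk⟩ 0
      have hM := ihk (by omega) s hs
      cases i with
      | zero => exact F.vanishes_right_zero E hM
      | succ i =>
        refine F.vanishes_right_succ E (isGradedSMul_veroneseModule _ _)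
          (isGradedSMul_veroneseModule _ _) hM ?_
        rw [zero_sub, F.vanishes_congr (veroneseModule_neg_one hd _), F.vanishes_shift_iff]
        have := ih i (Nat.lt_succ_self i) (d - 1) k (by omega) s hs
        rwa [show ((i + 1 : ℕ) : ℤ) + s - 1 = i + s by push_cast; ring]
  | succ c ihc =>
    intro k hk s hs
    induction hk using Nat.decreasingInduction with
    | self => exact F.vanishes_of_eq_bot (veroneseModule_top_eq_bot c.succ_pos) _ _
    | @of_succ k hk ihk =>
      obtain ⟨f, g, E⟩ :=
        exists_gradedExact_veroneseModule (K := K) (d := d) ⟨k, hk⟩ ((c + 1 : ℕ) : ℤ)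
      refine F.vanishes_middle E (isGradedSMul_veroneseModule _ _)
        (isGradedSMul_veroneseModule _ _) ?_ ihk
      rw [show ((c + 1 : ℕ) : ℤ) - 1 = c by push_cast; ring]
      exact ihc k hk.le s hs

theorem isKoszul_veronese (hd : 0 < d) : IsKoszul (veroneseGrading K n d) := by
  refine (isStandardGraded_veronese hd).isKoszul fun F i s hs => ?_
  -- `K = R ⧸ 𝔪` is the Veronese module of `S ⧸ (x_1, …, x_n)` with `c = 0`
  let p : veronese K n d →ₗ[veronese K n d] (MvPolynomial (Fin n) K ⧸ variableIdeal K n n) :=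
    LinearMap.toSpanSingleton _ _ (Submodule.Quotient.mk 1)
  have hp : ∀ r, p r = Submodule.Quotient.mk (r : MvPolynomial (Fin n) K) := by
    intro r
    change Submodule.Quotient.mk ((r : MvPolynomial (Fin n) K) * 1) = _
    rw [mul_one]
  have hpm : maxIdeal (veroneseGrading K n d) ≤ LinearMap.ker p := by
    refine Ideal.span_le.mpr fun r hr => ?_
    obtain ⟨j, hj, hr⟩ := Set.mem_iUnion₂.mp hr
    refine (hp r).trans ((Submodule.Quotient.mk_eq_zero _).mpr ?_)
    exact mem_variableIdeal_of_isHomogeneous (D := j * d) (by positivity) hr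
  have E : GradedExact (quotientGrading (veroneseGrading K n d) (maxIdeal (veroneseGrading K n d)))
      (veroneseModule d (variableIdeal K n n) 0) (fun _ => (⊥ : Submodule K PUnit))
      (Submodule.liftQ _ p hpm) (0 : _ →ₗ[_] PUnit) :=
    { map_left := by
        rintro k _ ⟨r, hr, rfl⟩
        change p r ∈ _
        rw [hp]
        exact mem_veroneseModule_zero hr
      map_right := fun _ => zero_mem _
      injective := by
        rintro k _ ⟨r, hr, rfl⟩ h0
        have h0 : p r = 0 := h0
        rw [hp, Submodule.Quotient.mk_eq_zero] at h0
        refine (Submodule.Quotient.mk_eq_zero _).mpr ?_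
        by_cases hk : k = 0
        · subst hk
          have hr : (r : MvPolynomial (Fin n) K).IsHomogeneous (0 * d) := hr
          rw [zero_mul] at hr
          have hr0 : r = 0 := Subtype.ext (eq_zero_of_mem_variableIdeal hr h0)
          rw [hr0]
          exact zero_mem _
        · exact mem_maxIdeal_of_mem_selfGrading hk hr
      comp_eq_zero := fun _ => rfl
      exact := fun {k m} hm _ => by
        obtain ⟨r, hr, hrm⟩ := exists_of_mem_veroneseModule_zero hm
        exact ⟨Submodule.Quotient.mk r, ⟨r, hr, rfl⟩, (hp r).trans hrm⟩
      surjective := fun _ => ⟨0, zero_mem _, rfl⟩ }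
  exact F.vanishes_left E (isGradedSMul_veroneseModule _ _) (isGradedSMul_quotientGrading _ _)
    (vanishes_veroneseModule hd F i 0 n le_rfl s hs) (F.vanishes_of_eq_bot (fun _ => rfl) _ _)

end Veronese

section Veronese

open MvPolynomial

variable {K : Type u} [Field K] {n d : ℕ}

/-! ### Depth and local regularity of Veronese subrings -/

variable (K) in
/-- The element `x_t ^ d` of the Veronese subring, homogeneous of degree `1`. -/
def veronesePower (d : ℕ) (t : Fin n) : veronese K n d :=
  veroneseMonomial (Finsupp.single t d) 1 (by rw [Finsupp.degree_single])

theorem coe_veronesePower (t : Fin n) :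
    (veronesePower K d t : MvPolynomial (Fin n) K) = X t ^ d := by
  rw [X_pow_eq_monomial]
  rfl

theorem veronesePower_mem (t : Fin n) : veronesePower K d t ∈ veroneseGrading K n d 1 :=
  veroneseMonomial_mem 1 (by rw [Finsupp.degree_single, one_mul])

theorem veronesePower_ne_zero (t : Fin n) : veronesePower K d t ≠ 0 := by
  intro h
  have := congrArg Subtype.val h
  rw [coe_veronesePower] at this
  exact pow_ne_zero d (X_ne_zero t) this

theorem one_notMem_maxIdeal {R : Type v} [CommRing R] [Algebra K R] {𝒜 : ℕ → Submodule K R}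
    (h : IsPositivelyGraded 𝒜) : (1 : R) ∉ maxIdeal 𝒜 := by
  let _ := h.gradedAlgebra
  have := h.nontrivial
  intro h1
  rw [← pow_one (maxIdeal 𝒜)] at h1
  exact one_ne_zero (eq_zero_of_mem_maxIdeal_pow (k := 0) (by norm_num) h1
    (SetLike.one_mem_graded 𝒜))

theorem depth_veronese_pos (hd : 0 < d) (t : Fin n) : 0 < depth (veroneseGrading K n d) := by
  have hm : veronesePower K d t ∈ maxIdeal (veroneseGrading K n d) :=
    mem_maxIdeal_of_mem one_pos (veronesePower_mem t)
  have hreg : RingTheory.Sequence.IsRegular (veronese K n d) [veronesePower K d t] := by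
    rw [RingTheory.Sequence.isRegular_iff, RingTheory.Sequence.isWeaklyRegular_singleton_iff]
    refine ⟨fun f g hfg => mul_left_cancel₀ (veronesePower_ne_zero t) hfg, fun htop => ?_⟩
    have h1 : (1 : veronese K n d) ∈ Ideal.ofList [veronesePower K d t] • (⊤ : Ideal _) := by
      rw [← htop]
      trivial
    rw [Ideal.ofList_singleton, smul_eq_mul, Ideal.mul_top] at h1
    exact one_notMem_maxIdeal (isStandardGraded_veronese hd).toIsPositivelyGraded
      ((Ideal.span_singleton_le_iff_mem _).mpr hm h1)
  unfold depth
  refine lt_of_lt_of_le one_pos (le_iSup₂_of_le [veronesePower K d t] ⟨?_, hreg⟩ ?_)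
  · intro a ha
    rw [List.mem_singleton] at ha
    rwa [ha]
  · simp

/-- The elements `x_1 ^ d, …, x_n ^ d` of `S^{(d)}`. -/
def veroneseSystem (hd : 0 < d) : HomogeneousSystem (veroneseGrading K n d) where
  n := n
  x := veronesePower K d
  homogeneous t := ⟨1, one_pos, veronesePower_mem t⟩
  radical_eq := by
    apply le_antisymm
    · refine Ideal.radical_mono (Ideal.span_le.mpr ?_)
      rintro _ ⟨t, rfl⟩
      exact mem_maxIdeal_of_mem one_pos (veronesePower_mem t)
    · rw [Ideal.radical_le_radical_iff, maxIdeal, Ideal.span_le]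
      intro f hf
      obtain ⟨i, hi, hf⟩ := Set.mem_iUnion₂.mp hf
      refine mem_of_veroneseMonomial_mem fun m hm => ?_
      have hdeg := degree_eq_of_mem_support hf hm
      generalize coeff m (f : MvPolynomial (Fin n) K) = c
      have hm0 : m ≠ 0 := by
        rintro rfl
        rw [map_zero] at hdeg
        have : 0 < i * d := by positivity
        omega
      obtain ⟨t, ht⟩ := Finsupp.ne_iff.mp hm0
      rw [Finsupp.zero_apply] at ht
      -- `(c x^m)^d` is divisible by `x_t ^ d`, with quotient in `S^{(d)}`
      refine ⟨d, ?_⟩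
      obtain ⟨m', hm'⟩ : ∃ m', d • m = Finsupp.single t d + m' := by
        refine exists_add_of_le fun j => ?_
        rw [Finsupp.smul_apply, smul_eq_mul]
        by_cases hj : j = t
        · subst hj
          rw [Finsupp.single_eq_same]
          exact Nat.le_mul_of_pos_right d (Nat.pos_of_ne_zero ht)
        · rw [Finsupp.single_eq_of_ne hj]
          exact Nat.zero_le _
      have hdvd : d ∣ m'.degree := by
        have h1 := congrArg Finsupp.degree hm'
        rw [map_nsmul, map_add, Finsupp.degree_single, smul_eq_mul] at h1
        exact (Nat.dvd_add_right dvd_rfl).mp (h1 ▸ dvd_mul_right d _)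
      have hmul : veroneseMonomial m c (f.2 m hm) ^ d
          = veroneseMonomial m' (c ^ d) hdvd * veronesePower K d t := by
        apply Subtype.ext
        rw [SubmonoidClass.coe_pow, MulMemClass.coe_mul]
        simp only [coe_veroneseMonomial, veronesePower]
        rw [monomial_pow, hm', monomial_mul, mul_one, add_comm]
      rw [hmul]
      exact Ideal.mul_mem_left _ _ (Ideal.subset_span ⟨t, rfl⟩)

/-- After multiplication by a power of the product of all `x_i`, a fraction whose denominator does
not involve `x_t` becomes divisible by that power of `x_t`. -/
theorem exists_prod_pow_smul_eq {R : Type v} [CommRing R] [Algebra K R] {𝒜 : ℕ → Submodule K R}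
    (X : HomogeneousSystem 𝒜) {S T : Finset (Fin X.n)} (h : S ⊆ T) {t : Fin X.n} (htS : t ∉ S)
    (z : LocalizedModule (X.mult S) R) :
    ∃ N₀, ∀ N, N₀ ≤ N → ∃ g : R, (∏ i, X.x i) ^ N • X.res R h z
      = LocalizedModule.mk (X.x t ^ N * g) 1 := by
  induction z using LocalizedModule.induction_on with
  | h m s =>
    obtain ⟨s, hs⟩ := s
    -- `s` divides a power of the product of the `x_i`, `i ∈ S`
    have hdvd : ∃ N₀, s ∣ (∏ i ∈ S, X.x i) ^ N₀ := by
      induction hs using Submonoid.closure_induction with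
      | mem x hx =>
        obtain ⟨i, hi, rfl⟩ := hx
        exact ⟨1, by rw [pow_one]; exact Finset.dvd_prod_of_mem _ hi⟩
      | one => exact ⟨0, one_dvd _⟩
      | mul x y _ _ hx hy =>
        obtain ⟨a, ha⟩ := hx
        obtain ⟨b, hb⟩ := hy
        exact ⟨a + b, by rw [pow_add]; exact mul_dvd_mul ha hb⟩
    obtain ⟨N₀, hN₀⟩ := hdvd
    refine ⟨N₀, fun N hN => ?_⟩
    obtain ⟨q, hq⟩ := hN₀.trans (pow_dvd_pow _ hN)
    have hprod : ∃ r, ∏ i, X.x i = X.x t * r * ∏ i ∈ S, X.x i := by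
      obtain ⟨r, hr⟩ := Finset.prod_dvd_prod_of_subset (insert t S) Finset.univ X.x
        (Finset.subset_univ _)
      exact ⟨r, by rw [hr, Finset.prod_insert htS]; ring⟩
    obtain ⟨r, hr⟩ := hprod
    refine ⟨r ^ N * q * m, ?_⟩
    rw [X.res_mk, LocalizedModule.smul'_mk, LocalizedModule.mk_eq]
    refine ⟨1, ?_⟩
    simp only [one_smul, Submonoid.smul_def, smul_eq_mul]
    rw [hr, mul_pow, mul_pow, hq]
    ring

/-- If the fraction `μ / ∏ x_i` is a top-dimensional Čech coboundary over a domain, then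
`(∏ x_i)^N μ` lies in the ideal generated by the `x_t^{N+1}` for some `N`. -/
theorem exists_sum_eq_of_mem_coboundaries {R : Type v} [CommRing R] [IsDomain R] [Algebra K R]
    {𝒜 : ℕ → Submodule K R} (X : HomogeneousSystem 𝒜) (hX : ∀ t, X.x t ≠ 0)
    {ℳ : ℤ → Submodule K R} {p : ℕ} (hp : 0 < p) {j : ℤ} {c : X.Cochain R p}
    (hc : c ∈ X.coboundaries ℳ p j) (hcard : (Finset.univ : Finset (Fin X.n)).card = p) {μ : R}
    (hμ : c ⟨Finset.univ, hcard⟩ =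
      LocalizedModule.mk μ ⟨∏ i, X.x i, prod_mem fun _ hi => X.x_mem_mult hi⟩) :
    ∃ (N : ℕ) (g : Fin X.n → R), ∑ t, X.x t ^ (N + 1) * g t = (∏ i, X.x i) ^ N * μ := by
  obtain ⟨p, rfl⟩ := Nat.exists_eq_add_of_lt hp
  obtain ⟨b, -, rfl⟩ := hc
  rw [X.cechD_apply] at hμ
  choose N₀ hN₀ using fun t => exists_prod_pow_smul_eq X (Finset.erase_subset t Finset.univ)
    (Finset.notMem_erase t Finset.univ) (X.component b (Finset.univ.erase t))
  obtain ⟨N, hN⟩ : ∃ N, ∀ t, N₀ t ≤ N + 1 :=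
    ⟨Finset.univ.sup N₀, fun t => (Finset.le_sup (Finset.mem_univ t)).trans (Nat.le_succ _)⟩
  choose g hg using fun t => hN₀ t (N + 1) (hN t)
  refine ⟨N, fun t => HomogeneousSystem.sign R t Finset.univ * g t, ?_⟩
  -- clearing denominators
  have hloc : (LocalizedModule.mk (∑ t, X.x t ^ (N + 1) *
        (HomogeneousSystem.sign R t Finset.univ * g t)) 1 :
          LocalizedModule (X.mult Finset.univ) R) = LocalizedModule.mk ((∏ i, X.x i) ^ N * μ) 1 := by
    have h1 := congrArg (fun w => (∏ i, X.x i) ^ (N + 1) • w) hμ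
    simp only [Finset.smul_sum] at h1
    have h2 : ∀ t, (∏ i, X.x i) ^ (N + 1) • HomogeneousSystem.sign R t Finset.univ •
        X.res _ (Finset.erase_subset t Finset.univ) (X.component b (Finset.univ.erase t))
          = LocalizedModule.mkLinearMap _ _
          (X.x t ^ (N + 1) * (HomogeneousSystem.sign R t Finset.univ * g t)) := by
      intro t
      rw [smul_comm, hg t, mul_left_comm]
      exact (map_smul (LocalizedModule.mkLinearMap (X.mult Finset.univ) R) _ _).symm
    simp only [h2] at h1
    rw [← map_sum] at h1
    refine h1.trans ?_
    rw [LocalizedModule.smul'_mk, LocalizedModule.mk_eq]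
    refine ⟨1, ?_⟩
    simp only [one_smul, Submonoid.smul_def, smul_eq_mul]
    ring
  have hmult0 : ∀ s ∈ X.mult Finset.univ, s ≠ 0 := by
    intro s hs
    induction hs using Submonoid.closure_induction with
    | mem x hx =>
      obtain ⟨i, -, rfl⟩ := hx
      exact hX i
    | one => exact one_ne_zero
    | mul x y _ _ hx hy => exact mul_ne_zero hx hy
  obtain ⟨⟨v, hv⟩, h⟩ := LocalizedModule.mk_eq.mp hloc
  simp only [one_smul, Submonoid.smul_def, smul_eq_mul] at h
  exact mul_left_cancel₀ (hmult0 v hv) h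

/-- `H^n_𝔪(S^{(d)})_{-1} ≠ 0` for `d ≥ n`: a monomial `x^{-a}` of degree `-d` with all `a_i > 0`
is not a sum of fractions whose denominators each omit one of the variables. -/
theorem not_vanishes_veronese (hn : 0 < n) (hnd : n ≤ d) :
    ¬ (veroneseSystem (K := K) (n := n) (hn.trans_le hnd)).Vanishes
      (selfGrading (veroneseGrading K n d)) n (-1) := by
  have hd : 0 < d := hn.trans_le hnd
  intro hvan
  let X := veroneseSystem (K := K) (n := n) hd
  -- the exponent `u = (d, …, d) - a`, where `a = (d - n + 1, 1, …, 1)`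
  let u : Fin n →₀ ℕ := Finsupp.equivFunOnFinite.symm fun i => if i = ⟨0, hn⟩ then n - 1 else d - 1
  have hu : ∀ i, u i < d := by
    intro i
    change (if i = ⟨0, hn⟩ then n - 1 else d - 1) < d
    split_ifs <;> omega
  have hudeg : u.degree = (n - 1) * d := by
    rw [Finsupp.degree_eq_sum]
    change ∑ i : Fin n, (if i = ⟨0, hn⟩ then n - 1 else d - 1) = _
    rw [Finset.sum_ite, Finset.sum_const, Finset.sum_const, Finset.filter_eq' Finset.univ,
      if_pos (Finset.mem_univ _), Finset.card_singleton, Finset.filter_ne',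
      Finset.card_erase_of_mem (Finset.mem_univ _), Finset.card_univ, Fintype.card_fin,
      smul_eq_mul, smul_eq_mul, one_mul]
    obtain ⟨d, rfl⟩ := Nat.exists_eq_add_of_lt hd
    simp only [zero_add, Nat.add_sub_cancel]
    ring
  let μ : veronese K n d := veroneseMonomial u 1 (Dvd.intro_left _ hudeg.symm)
  have hμ : μ ∈ veroneseGrading K n d (n - 1) := veroneseMonomial_mem 1 hudeg
  let c : X.Cochain (veronese K n d) n := fun T =>
    LocalizedModule.mk μ ⟨∏ i ∈ T.1, X.x i, prod_mem fun i hi => X.x_mem_mult hi⟩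
  have hc : c ∈ X.cochainDegree (selfGrading (veroneseGrading K n d)) n (-1) := by
    rw [HomogeneousSystem.mem_cochainDegree]
    intro T
    refine (HomogeneousSystem.mem_localizedDegree_iff (isGradedSMul_selfGrading _)).mpr
      ⟨n, _, μ, ?_, ?_, rfl⟩
    · have := SetLike.prod_mem_graded (veroneseGrading K n d) (fun _ => 1) X.x (F := T.1)
        (fun i _ => veronesePower_mem i)
      rwa [Finset.sum_const, T.2, smul_eq_mul, mul_one] at this
    · rw [show (-1 : ℤ) + n = ((n - 1 : ℕ) : ℤ) by omega]
      exact hμ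
  have hdc : X.cechD _ n c = 0 := by
    funext T
    have h1 := Finset.card_le_univ T.1
    rw [T.2, Fintype.card_fin] at h1
    exact absurd h1 (Nat.not_succ_le_self n)
  have hcob := X.vanishes_iff.mp hvan c hc hdc
  have hcard : (Finset.univ : Finset (Fin X.n)).card = n := Finset.card_fin n
  obtain ⟨N, g, heq⟩ :=
    exists_sum_eq_of_mem_coboundaries X (fun t => veronesePower_ne_zero t) hn hcob hcard rfl
  -- in `S`, the monomial on the right lies in the ideal of the `x_t ^ (d (N + 1))`
  let w : Fin n →₀ ℕ := Finsupp.equivFunOnFinite.symm (fun _ => d * N) + u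
  have hw : (((∏ i, X.x i) ^ N * μ : veronese K n d) : MvPolynomial (Fin n) K) = monomial w 1 := by
    have h1 : ((∏ i, X.x i : veronese K n d) : MvPolynomial (Fin n) K)
        = monomial (Finsupp.equivFunOnFinite.symm (fun _ => d)) 1 := by
      rw [SubmonoidClass.coe_finsetProd, monomial_eq, map_one, one_mul, Finsupp.prod_fintype]
      · exact Finset.prod_congr rfl fun i _ => coe_veronesePower i
      · intro i
        exact pow_zero _
    rw [MulMemClass.coe_mul, SubmonoidClass.coe_pow, h1, monomial_pow, coe_veroneseMonomial,
      monomial_mul, one_pow, one_mul]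
    congr 2
    ext i
    simp [mul_comm, w]
  have hpow (t : Fin n) : ((veronesePower K d t : veronese K n d) : MvPolynomial (Fin n) K) ^ (N + 1)
      = monomial (Finsupp.single t (d * (N + 1))) 1 := by
    rw [coe_veronesePower, ← pow_mul, X_pow_eq_monomial]
  have hmem : (monomial w (1 : K)) ∈ Ideal.span ((fun s => monomial s (1 : K)) ''
      (Set.range fun t : Fin n => Finsupp.single t (d * (N + 1)))) := by
    rw [← hw, ← heq, AddSubmonoidClass.coe_finsetSum]
    refine Ideal.sum_mem _ fun t _ => ?_
    rw [MulMemClass.coe_mul]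
    refine Ideal.mul_mem_right _ _ (Ideal.subset_span ⟨_, ⟨t, rfl⟩, ?_⟩)
    rw [SubmonoidClass.coe_pow]
    exact (hpow t).symm
  rw [mem_ideal_span_monomial_image] at hmem
  obtain ⟨_, ⟨t, rfl⟩, ht⟩ := hmem w (by
    rw [mem_support_iff, coeff_monomial, if_pos rfl]
    exact one_ne_zero)
  have h1 : d * (N + 1) ≤ d * N + u t := by
    have := ht t
    rwa [Finsupp.single_eq_same] at this
  have h2 := hu t
  rw [mul_add, mul_one] at h1
  omega

theorem regL_veronese_pos (hn : 2 ≤ n) (hnd : n ≤ d) :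
    0 < regL (veroneseGrading K n d) (selfGrading (veroneseGrading K n d)) := by
  by_contra! hle
  have hle' : regL (veroneseGrading K n d) (selfGrading (veroneseGrading K n d))
      ≤ (((0 : ℤ) : ℝ) : EReal) := by simpa using hle
  have h0 := (intInf_le_intCast_iff (isUpperSet_setOf_forall_lt _) 0).mp hle'
  have h1 := localCohomologyVanishes_iff.mp (h0 n (n - 1) (by omega))
    (veroneseSystem (by omega))
  rw [show (n : ℤ) - 1 - n = -1 by ring] at h1
  exact not_vanishes_veronese (by omega) hnd h1

end Veronese

end GradedReg

end

theorem mainTheorem6 :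
    (∀ (K : Type*) [Field K] (R : Type*) [CommRing R] [Algebra K R] (𝒜 : ℕ → Submodule K R),
      GradedReg.IsKoszul 𝒜 → 0 < GradedReg.depth 𝒜 →
      ∀ r : EReal, r = GradedReg.regL 𝒜 (GradedReg.selfGrading 𝒜) → 0 < r →
        (∀ j : ℕ,
          GradedReg.regL 𝒜 (GradedReg.idealGrading 𝒜 (GradedReg.maxIdeal 𝒜 ^ j))
            = max (j : EReal) r) ∧
        (∀ j : ℕ, 0 < j → (j : EReal) < r →
          0 = GradedReg.regL 𝒜 (GradedReg.idealGrading 𝒜 (GradedReg.maxIdeal 𝒜 ^ j)) - r ∧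
          GradedReg.regL 𝒜 (GradedReg.idealGrading 𝒜 (GradedReg.maxIdeal 𝒜 ^ j)) - r
            < GradedReg.regT 𝒜 (GradedReg.idealGrading 𝒜 (GradedReg.maxIdeal 𝒜 ^ j)) ∧
          GradedReg.regT 𝒜 (GradedReg.idealGrading 𝒜 (GradedReg.maxIdeal 𝒜 ^ j)) = j ∧
          (j : EReal) < r ∧
          r = GradedReg.regL 𝒜 (GradedReg.idealGrading 𝒜 (GradedReg.maxIdeal 𝒜 ^ j)))) ∧
    (∀ (K : Type*) [Field K] (n : ℕ), 2 ≤ n →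
      ∃ d₀ : ℕ, ∀ d : ℕ, d₀ ≤ d →
        GradedReg.IsKoszul (GradedReg.veroneseGrading K n d) ∧
        0 < GradedReg.depth (GradedReg.veroneseGrading K n d) ∧
        0 < GradedReg.regL (GradedReg.veroneseGrading K n d)
          (GradedReg.selfGrading (GradedReg.veroneseGrading K n d))) := by
  refine ⟨fun K _ R _ _ 𝒜 h hdepth r hr hpos => ?_, fun K _ n hn => ⟨n, fun d hd => ?_⟩⟩
  · subst hr
    have hL := h.regL_maxIdeal_pow hdepth hpos
    refine ⟨hL, fun j hj hjr => ?_⟩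
    have htop := h.toIsPositivelyGraded.regL_self_ne_top
    rw [hL j, max_eq_right hjr.le, h.regT_maxIdeal_pow hdepth j,
      EReal.sub_self htop (ne_bot_of_gt hpos)]
    exact ⟨rfl, by exact_mod_cast hj, rfl, hjr, rfl⟩
  · exact ⟨GradedReg.isKoszul_veronese (by omega),
      GradedReg.depth_veronese_pos (by omega) ⟨0, by omega⟩, GradedReg.regL_veronese_pos hn hd⟩
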